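/- Let $A_1,\dots,A_N$ be Hilbert spaces of finite dimensions $|A_1|,\dots,|A_N|$, and let $\mathcal S_{A_1:\cdots:A_N}=\mathrm{conv}\{|\phi_1\rangle\langle\phi_1|\otimes\cdots\otimes|\phi_N\rangle\langle\phi_N| : \phi_i\in A_i,\ \|\phi_i\|=1\}$ be the set of separable states. For integers $k_1,\dots,k_N\ge 1$ let $\mathcal E^{k_1,\dots,k_N}_{A_1:\cdots:A_N}$ be the set of states $\rho$ on $A_1\otimes\cdots\otimes A_N$ for which there is a state $\tau$ on $S^{k_1}(A_1)\otimes\cdots\otimes S^{k_N}(A_N)$ such that $\rho$ is the partial trace of $\tau$ over all but one copy of each $A_i$; here $S^k(A)\subseteq A^{\otimes k}$ is the subspace of vectors that are invariant under all permutations of the $k$ tensor factors. Let $\|X\|_1=\mathrm{tr}\sqrt{X^\dagger X}$ be the trace norm. (1) For every $\rho\in\mathcal E^{k_1,\dots,k_N}_{A_1:\cdots:A_N}$ there is $\sigma\in\mathcal S_{A_1:\cdots:A_N}$ with $$\|\rho-\sigma\|_1\le 4\sum_{i=1}^{N-1}\frac{|A_i|}{k_i}.$$ (2) There is an algorithm deciding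 separability of states of $N$ parties of dimension $d$ up to error $\varepsilon$ in trace norm in time $\exp(O(dN\log(N/\varepsilon)))$, up to an additive polynomial in the bit length of the numbers in the input. Precisely, there are a single program for a random access machine with logarithmic (bit) cost and a constant $C$ such that for all $N\ge1$ and $d$, all rational $\varepsilon=p/r\in(0,1]$ and all states $\rho$ on $(\mathbb C^d)^{\otimes N}$ with entries in $\frac1q\mathbb Z[i]$, the program, given $N$, $d$, $p$, $r$, $q$ and the numerators of the entries of $\rho$, halts after time at most $$\ell^{C}+\exp\bigl(C\,dN\log(N/\varepsilon)\bigr),$$ where $\ell$ is the total bit length of $p$, $r$ and $q$; its output is $1$ if $\rho$ is separable, and $0$ if $\|\rho-\sigma\|_1\ge\varepsilon$ for every separable state $\sigma$. -/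

import Mathlib

open scoped Matrix ComplexOrder

namespace SymExt

noncomputable section

/-! ### States, separable states, trace norm

The Hilbert space `A i` is `ℂ ^ (d i)`; the standard basis of `A 1 ⊗ ⋯ ⊗ A N` is indexed by
`∀ i, Fin (d i)`, and operators are matrices in that basis. -/

/-- Density matrices: positive semidefinite of trace one. -/
def IsState {n : Type*} [Fintype n] (ρ : Matrix n n ℂ) : Prop :=
  ρ.PosSemidef ∧ ρ.trace = 1

/-- The operator `|φ 1⟩⟨φ 1| ⊗ ⋯ ⊗ |φ N⟩⟨φ N|`. -/
def productProj {N : ℕ} {d : Fin N → ℕ} (φ : ∀ i, EuclideanSpace ℂ (Fin (d i))) :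
    Matrix (∀ i, Fin (d i)) (∀ i, Fin (d i)) ℂ :=
  Matrix.of fun x y => ∏ i, (φ i (x i) * star (φ i (y i)))

/-- The set of separable states: the convex hull of the pure product states. -/
def separable {N : ℕ} (d : Fin N → ℕ) : Set (Matrix (∀ i, Fin (d i)) (∀ i, Fin (d i)) ℂ) :=
  convexHull ℝ {P | ∃ φ : ∀ i, EuclideanSpace ℂ (Fin (d i)), (∀ i, ‖φ i‖ = 1) ∧ P = productProj φ}

/-- The trace norm `tr √(X† X)`: the sum of the singular values. -/
def traceNorm {n : Type*} [Fintype n] [DecidableEq n] (X : Matrix n n ℂ) : ℝ :=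
  ∑ i, √((Matrix.isHermitian_conjTranspose_mul_self X).eigenvalues i)

/-! ### Symmetric extensions -/

/-- The symmetric subspace `S^k(ℂ^d)` of `(ℂ^d)^{⊗ k}`: the vectors that are fixed by every
permutation of the tensor factors. -/
def symSubspace (k d : ℕ) : Submodule ℂ ((Fin k → Fin d) → ℂ) where
  carrier := {ψ | ∀ (π : Equiv.Perm (Fin k)) (x : Fin k → Fin d), ψ (x ∘ π) = ψ x}
  add_mem' := fun ha hb π x => by simp [ha π x, hb π x]
  zero_mem' := fun _ _ => rfl
  smul_mem' := fun c _ ha π x => by simp [ha π x]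

/-- The subspace `S^{k 1}(A 1) ⊗ ⋯ ⊗ S^{k N}(A N)` of `(A 1)^{⊗ k 1} ⊗ ⋯ ⊗ (A N)^{⊗ k N}`,
spanned by the product vectors. -/
def symTensor {N : ℕ} (k d : Fin N → ℕ) : Submodule ℂ ((∀ i, Fin (k i) → Fin (d i)) → ℂ) :=
  Submodule.span ℂ {Ψ | ∃ ψ : ∀ i, (Fin (k i) → Fin (d i)) → ℂ,
    (∀ i, ψ i ∈ symSubspace (k i) (d i)) ∧ Ψ = fun x => ∏ i, ψ i (x i)}

/-- The partial trace over all but the first copy of each `A i`, where there are `m i + 1` copies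
of `A i`. -/
def partialTrace {N : ℕ} {d m : Fin N → ℕ}
    (τ : Matrix (∀ i, Fin (m i + 1) → Fin (d i)) (∀ i, Fin (m i + 1) → Fin (d i)) ℂ) :
    Matrix (∀ i, Fin (d i)) (∀ i, Fin (d i)) ℂ :=
  Matrix.of fun x y => ∑ z : ∀ i, Fin (m i) → Fin (d i),
    τ (fun i => Fin.cons (x i) (z i)) (fun i => Fin.cons (y i) (z i))

/-- The set `E^{k 1, …, k N}` of symmetrically extendible states (`k i ≥ 1` copies of `A i`,
`m i = k i - 1` of which are traced out): the partial traces of states on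
`S^{k 1}(A 1) ⊗ ⋯ ⊗ S^{k N}(A N)`, that is, of density matrices whose range lies in that space. -/
def extendible {N : ℕ} (d k : Fin N → ℕ) : Set (Matrix (∀ i, Fin (d i)) (∀ i, Fin (d i)) ℂ) :=
  {ρ | ∃ m : Fin N → ℕ, (∀ i, k i = m i + 1) ∧
    ∃ τ : Matrix (∀ i, Fin (m i + 1) → Fin (d i)) (∀ i, Fin (m i + 1) → Fin (d i)) ℂ,
      IsState τ ∧ (∀ v, τ *ᵥ v ∈ symTensor (fun i => m i + 1) d) ∧ ρ = partialTrace τ}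

end

/-! ### Algorithms: random access machine programs with logarithmic (bit) cost

The memory holds one integer at each integer address.  Every elementary operation is charged
for the bit lengths of all the integers it handles, addresses included, so running times are
polynomially related to those of Turing machines. -/

/-- Memory contents. -/
abbrev Mem := ℤ → ℤ

/-- Number of binary digits, plus one for the sign. -/
def bits (z : ℤ) : ℕ := z.natAbs.size + 1

/-- Integer expressions; `load a` is the memory cell with address `a` (indirect addressing). -/
inductive Expr
  | lit (z : ℤ)
  | load (a : Expr)
  | add (a b : Expr)
  | sub (a b : Expr)
  | mul (a b : Expr)
  | div (a b : Expr)

/-- Value of an expression (`div` is integer division with remainder, and `0` for divisor `0`). -/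
def Expr.eval (s : Mem) : Expr → ℤ
  | lit z => z
  | load a => s (a.eval s)
  | add a b => a.eval s + b.eval s
  | sub a b => a.eval s - b.eval s
  | mul a b => a.eval s * b.eval s
  | div a b => a.eval s / b.eval s

/-- Bit cost of evaluating an expression (schoolbook multiplication and division). -/
def Expr.cost (s : Mem) : Expr → ℕ
  | lit z => bits z
  | load a => a.cost s + bits (a.eval s) + bits (s (a.eval s))
  | add a b => a.cost s + b.cost s + bits (a.eval s) + bits (b.eval s)
  | sub a b => a.cost s + b.cost s + bits (a.eval s) + bits (b.eval s)
  | mul a b => a.cost s + b.cost s + bits (a.eval s) * bits (b.eval s)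
  | div a b => a.cost s + b.cost s + bits (a.eval s) * bits (b.eval s)

/-- Programs: `store a e` writes `e` to address `a`; `cond e c c'` runs `c` if `e > 0` and `c'`
otherwise; `loop e c` repeats `c` as long as `e > 0`. -/
inductive Program
  | skip
  | store (a e : Expr)
  | seq (c c' : Program)
  | cond (e : Expr) (c c' : Program)
  | loop (e : Expr) (c : Program)

/-- `Exec c s t s'`: started with memory `s`, the program `c` halts after time `t` with
memory `s'`. -/
inductive Exec : Program → Mem → ℕ → Mem → Prop
  | skip (s : Mem) : Exec .skip s 1 s
  | store (a e : Expr) (s : Mem) :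
      Exec (.store a e) s (a.cost s + e.cost s + bits (a.eval s) + bits (e.eval s))
        (Function.update s (a.eval s) (e.eval s))
  | seq {c c' : Program} {s s' s'' : Mem} {t t' : ℕ} :
      Exec c s t s' → Exec c' s' t' s'' → Exec (.seq c c') s (t + t') s''
  | cond_pos {e : Expr} {c c' : Program} {s s' : Mem} {t : ℕ} :
      0 < e.eval s → Exec c s t s' → Exec (.cond e c c') s (e.cost s + t) s'
  | cond_neg {e : Expr} {c c' : Program} {s s' : Mem} {t : ℕ} :
      ¬ 0 < e.eval s → Exec c' s t s' → Exec (.cond e c c') s (e.cost s + t) s'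
  | loop_pos {e : Expr} {c : Program} {s s' s'' : Mem} {t t' : ℕ} :
      0 < e.eval s → Exec c s t s' → Exec (.loop e c) s' t' s'' →
        Exec (.loop e c) s (e.cost s + t + t') s''
  | loop_neg {e : Expr} {c : Program} {s : Mem} :
      ¬ 0 < e.eval s → Exec (.loop e c) s (e.cost s) s

/-! ### Input format -/

/-- The matrix on `(ℂ^d)^{⊗ N}` with entries `(R x y + i J x y) / q`. -/
noncomputable def rationalMatrix {N d : ℕ} (q : ℕ)
    (R J : Matrix (Fin N → Fin d) (Fin N → Fin d) ℤ) :
    Matrix (Fin N → Fin d) (Fin N → Fin d) ℂ :=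
  Matrix.of fun x y => ((R x y : ℂ) + (J x y : ℂ) * Complex.I) / (q : ℂ)

/-- Number of the basis vector `x`: its digits in base `d` are the `x i`. -/
def basisNumber {N d : ℕ} (x : Fin N → Fin d) : ℤ := ∑ i, (x i : ℤ) * (d : ℤ) ^ (i : ℕ)

/-- The initial memory for the input consisting of `N`, `d`, the rational number `ε = p / r` and
the matrix with entries `(R x y + i J x y) / q`: the five numbers `N, d, p, r, q`, followed by the
`d ^ N * d ^ N` pairs `R x y, J x y`, row by row; all other cells are `0`. -/
structure IsInput (N d p r q : ℕ) (R J : Matrix (Fin N → Fin d) (Fin N → Fin d) ℤ)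
    (s : Mem) : Prop where
  parties : s 0 = N
  dim : s 1 = d
  errorNum : s 2 = p
  errorDen : s 3 = r
  entryDen : s 4 = q
  entryRe : ∀ x y, s (5 + 2 * (basisNumber x * (d : ℤ) ^ N + basisNumber y)) = R x y
  entryIm : ∀ x y, s (5 + 2 * (basisNumber x * (d : ℤ) ^ N + basisNumber y) + 1) = J x y
  below : ∀ a, a < 0 → s a = 0
  above : ∀ a, 5 + 2 * ((d : ℤ) ^ N * (d : ℤ) ^ N) ≤ a → s a = 0

end SymExt

namespace SymExt

/-! ### The trace norm of Hermitian matrices -/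

section TraceNorm

variable {n : Type*} [Fintype n] [DecidableEq n]

/-! Part (1) is a finite de Finetti argument. Let ρ be the marginal of τ. Measure all k copies of
one party in the coherent states of a complex Gaussian vector z and prepare |z⟩⟨z|. By Wick's
formula the kernel of this map counts permutations, and on symmetric operators it can be evaluated
(`sum_card_perm_mul`): ρ becomes (kρ + ρ')/(k + d), where ρ' is ρ with that party traced out and
replaced by the identity (`contract_update_prepareKernel`). This moves ρ by at most 2d/(k + d) ≤
2d/k in trace norm. Once all parties but the last are treated, every outcome leaves pure states of
these parties next to a positive operator on the last one, so the result is separable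
(`contract_mem_sepCone`); the last party costs nothing, and the constant obtained is 2 instead of 4.
Integrals over z are replaced by finite sums with the same moments (`exists_gaussian_quadrature`).

Part (2) does not use extensions; it is a perceptron over pairs of product vectors. For a matrix S
put f = ⟨S, ·⟩, with minimum a and maximum b over product states. If ρ is separable, then f(ρ) ≥ a,
so for product states P, Q near a minimiser and a maximiser (h + 1)f(P) − f(Q) − h f(ρ) is at most
−(b − a) plus rounding errors. A quadratic form with values in [a, b] on the unit sphere has a
Lipschitz constant proportional to b − a (`abs_sub_update_le`), so a resolution of order 1/(Nh),
independent of S and d, makes the expression nonpositive (`exists_gaussVec_pair`). The program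
sweeps through the codes of all such pairs of integral vectors and adds (h + 1)P − Q − hρ, scaled to
be integral, to S whenever its inner product with S is nonpositive.

The squared norm of S then grows at most linearly in the accumulated weight W (`Run.dot_le`), while
for separable ρ every sweep raises W by at least one (`Run.le_of_mem_separable`); after enough
sweeps √D‖S‖ < qW with D = d^N. Conversely, S/(qhW) = (1 + 1/h)σ − σ'/h − ρ for separable σ, σ', so
√D‖S‖ < qW forces ‖ρ − σ‖₁ < 3/h ≤ ε (`Run.exists_near`). The final test is therefore correct in
both directions.

For the running time, the integral vectors have mean squared coordinates bounded in terms of Nh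
alone. The self-delimiting code and the inequality of the means bound the number of codes by M =
(128Nh)^(8dN), without a factor log d in the exponent (`encode_coordinates_lt`). The program is
verified by counting steps and bounding the stored numbers; `Steps.exists_exec` turns this into bit
cost, and `cost_le_add` splits off the dependence on the input length as a summand. -/

lemma sum_eigenvalues_conjTranspose_mul_self {X : Matrix n n ℂ} (hX : X.IsHermitian) (f : ℝ → ℝ) :
    ∑ i, f ((Matrix.isHermitian_conjTranspose_mul_self X).eigenvalues i) =
      ∑ i, f (hX.eigenvalues i ^ 2) := by
  -- Comparing characteristic polynomials gives equality of the multisets of eigenvalues, so the two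
  -- orderings need not be matched.
  have hc : (Xᴴ * X).charpoly =
      ∏ i, (Polynomial.X - Polynomial.C ((hX.eigenvalues i ^ 2 : ℝ) : ℂ)) := by
    set U : Matrix n n ℂ := (hX.eigenvectorUnitary).1 with hU
    set D : Matrix n n ℂ := Matrix.diagonal (RCLike.ofReal ∘ hX.eigenvalues) with hD
    have hUU : star U * U = 1 := Unitary.coe_star_mul_self _
    have h1 : X = U * D * star U := by
      have := hX.spectral_theorem
      rwa [Unitary.conjStarAlgAut_apply] at this
    have h2 : Xᴴ * X = U * (D * D * star U) := by
      rw [hX.eq]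
      calc X * X = (U * D * star U) * (U * D * star U) := by rw [← h1]
        _ = U * (D * (star U * U) * D * star U) := by simp only [Matrix.mul_assoc]
        _ = _ := by rw [hUU, Matrix.mul_one]
    rw [h2, Matrix.charpoly_mul_comm, Matrix.mul_assoc, hUU, Matrix.mul_one, hD,
      Matrix.diagonal_mul_diagonal, Matrix.charpoly_diagonal]
    refine Finset.prod_congr rfl fun i _ => ?_
    simp [sq]
  have hr := (Matrix.isHermitian_conjTranspose_mul_self X).roots_charpoly_eq_eigenvalues
  rw [hc, Polynomial.roots_prod _ _
    (Finset.prod_ne_zero_iff.2 fun i _ => Polynomial.X_sub_C_ne_zero _)] at hr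
  simp only [Polynomial.roots_X_sub_C, Multiset.bind_singleton] at hr
  have := congrArg (fun m => (m.map (fun z : ℂ => f z.re)).sum) hr
  simp only [Multiset.map_map, Function.comp_def] at this
  exact this.symm

lemma traceNorm_eq_sum_abs_eigenvalues {X : Matrix n n ℂ} (hX : X.IsHermitian) :
    traceNorm X = ∑ i, |hX.eigenvalues i| := by
  simp only [traceNorm, sum_eigenvalues_conjTranspose_mul_self hX, Real.sqrt_sq_eq_abs]

lemma sum_eigenvalues_sq {X : Matrix n n ℂ} (hX : X.IsHermitian) :
    ∑ i, hX.eigenvalues i ^ 2 = ∑ i, ∑ j, ‖X i j‖ ^ 2 := by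
  rw [← sum_eigenvalues_conjTranspose_mul_self hX (fun x => x)]
  have h := (Matrix.isHermitian_conjTranspose_mul_self X).trace_eq_sum_eigenvalues
  have h2 : ((∑ i, (Matrix.isHermitian_conjTranspose_mul_self X).eigenvalues i : ℝ) : ℂ) =
      ((∑ i, ∑ j, ‖X i j‖ ^ 2 : ℝ) : ℂ) := by
    push_cast
    rw [← RCLike.ofReal_eq_complex_ofReal, ← h, Finset.sum_comm]
    simp only [Matrix.trace, Matrix.diag_apply, Matrix.mul_apply, Matrix.conjTranspose_apply]
    refine Finset.sum_congr rfl fun i _ => Finset.sum_congr rfl fun j _ => ?_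
    exact Complex.conj_mul' (X j i)
  exact_mod_cast h2

/-- Cauchy–Schwarz over the eigenvalues. The dimension that it costs is the factor d^N in the final
test of the algorithm. -/
lemma traceNorm_le_sqrt_mul {X : Matrix n n ℂ} (hX : X.IsHermitian) :
    traceNorm X ≤ √(Fintype.card n * ∑ i, ∑ j, ‖X i j‖ ^ 2) := by
  apply Real.le_sqrt_of_sq_le
  rw [traceNorm_eq_sum_abs_eigenvalues hX, ← sum_eigenvalues_sq hX]
  have := sq_sum_le_card_mul_sum_sq (s := Finset.univ) (f := fun i => |hX.eigenvalues i|)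
  simpa [sq_abs] using this

/-- The trace norm of a difference of positive semidefinite matrices. -/
lemma traceNorm_sub_le {A B : Matrix n n ℂ} (hA : A.PosSemidef) (hB : B.PosSemidef) :
    traceNorm (A - B) ≤ A.trace.re + B.trace.re := by
  have hX : (A - B).IsHermitian := hA.1.sub hB.1
  rw [traceNorm_eq_sum_abs_eigenvalues hX]
  set U : Matrix n n ℂ := (hX.eigenvectorUnitary).1 with hU
  have hUU : U * star U = 1 := Unitary.coe_mul_star_self _
  have hd : star U * (A - B) * U = Matrix.diagonal (RCLike.ofReal ∘ hX.eigenvalues) := by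
    have := hX.conjStarAlgAut_star_eigenvectorUnitary
    rwa [Unitary.conjStarAlgAut_star_apply] at this
  have hA' : (star U * A * U).PosSemidef := hA.conjTranspose_mul_mul_same U
  -- In an eigenbasis of A − B each eigenvalue is the difference of the nonnegative diagonal entries
  -- of A and B, so its modulus is at most their sum.
  have hB' : (star U * B * U).PosSemidef := hB.conjTranspose_mul_mul_same U
  have htr : ∀ C : Matrix n n ℂ, C.trace = (star U * C * U).trace := fun C => by
    rw [Matrix.mul_assoc, Matrix.trace_mul_comm, Matrix.mul_assoc, hUU, Matrix.mul_one]
  rw [htr A, htr B]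
  simp only [Matrix.trace, Matrix.diag_apply, Complex.re_sum, ← Finset.sum_add_distrib]
  refine Finset.sum_le_sum fun i _ => ?_
  have h1 := congrFun (congrFun hd i) i
  rw [Matrix.mul_sub, Matrix.sub_mul, Matrix.sub_apply, Matrix.diagonal_apply_eq] at h1
  have h2 := congrArg Complex.re h1
  simp only [Complex.sub_re, Function.comp_apply] at h2
  have h3 : (RCLike.ofReal (hX.eigenvalues i) : ℂ).re = hX.eigenvalues i := Complex.ofReal_re _
  rw [h3] at h2
  have h4 := (Complex.le_def.1 (hA'.diag_nonneg (i := i))).1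
  have h5 := (Complex.le_def.1 (hB'.diag_nonneg (i := i))).1
  simp only [Complex.zero_re] at h4 h5
  rw [← h2, abs_le]
  constructor <;> linarith

/-- Positive and negative parts. Together with `traceNorm_sub_le` this says that the trace norm is
the least total trace of such a decomposition, which yields the triangle inequality. -/
lemma exists_posSemidef_sub {X : Matrix n n ℂ} (hX : X.IsHermitian) :
    ∃ A B : Matrix n n ℂ, A.PosSemidef ∧ B.PosSemidef ∧ X = A - B ∧
      A.trace.re + B.trace.re = traceNorm X := by
  set U : Matrix n n ℂ := (hX.eigenvectorUnitary).1 with hU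
  have hUU : star U * U = 1 := Unitary.coe_star_mul_self _
  have hX1 : X = U * Matrix.diagonal (RCLike.ofReal ∘ hX.eigenvalues) * star U := by
    have := hX.spectral_theorem
    rwa [Unitary.conjStarAlgAut_apply] at this
  have hpsd : ∀ f : n → ℝ, (∀ i, 0 ≤ f i) →
      (U * Matrix.diagonal (fun i => (f i : ℂ)) * star U).PosSemidef := fun f hf =>
    (Matrix.PosSemidef.diagonal (fun i => by
      simpa using (hf i))).mul_mul_conjTranspose_same U
  have htr : ∀ f : n → ℝ,
      (U * Matrix.diagonal (fun i => (f i : ℂ)) * star U).trace.re = ∑ i, f i := fun f => by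
    rw [Matrix.trace_mul_comm, ← Matrix.mul_assoc, hUU, Matrix.one_mul, Matrix.trace_diagonal]
    simp
  refine ⟨_, _, hpsd (fun i => max (hX.eigenvalues i) 0) (fun i => le_max_right _ _),
    hpsd (fun i => max (-hX.eigenvalues i) 0) (fun i => le_max_right _ _), ?_, ?_⟩
  · rw [← Matrix.sub_mul, ← Matrix.mul_sub, Matrix.diagonal_sub]
    conv_lhs => rw [hX1]
    congr 3
    ext i
    have : max (hX.eigenvalues i) 0 - max (-hX.eigenvalues i) 0 = hX.eigenvalues i := by
      rcases le_total 0 (hX.eigenvalues i) with h | h <;> simp [h]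
    rw [← Complex.ofReal_sub, this]
    rfl
  · rw [htr, htr, traceNorm_eq_sum_abs_eigenvalues hX, ← Finset.sum_add_distrib]
    refine Finset.sum_congr rfl fun i _ => ?_
    rcases le_total 0 (hX.eigenvalues i) with h | h <;> simp [h, abs_of_nonneg, abs_of_nonpos]

lemma traceNorm_add_le {X Y : Matrix n n ℂ} (hX : X.IsHermitian) (hY : Y.IsHermitian) :
    traceNorm (X + Y) ≤ traceNorm X + traceNorm Y := by
  obtain ⟨A, B, hA, hB, rfl, h⟩ := exists_posSemidef_sub hX
  obtain ⟨A', B', hA', hB', rfl, h'⟩ := exists_posSemidef_sub hY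
  rw [sub_add_sub_comm, ← h, ← h']
  refine (traceNorm_sub_le (hA.add hA') (hB.add hB')).trans_eq ?_
  simp only [Matrix.trace_add, Complex.add_re]
  ring

end TraceNorm

/-! ### A quadrature for the complex Gaussian measure -/

section Quadrature

open MeasureTheory Set

/-- Along the moment curve f − c is a polynomial whose nonconstant coefficients are the values of f
on the basis; it has infinitely many roots. -/
lemma linearMap_eq_zero_of_infinite {K : ℕ} (f : (Fin K → ℝ) →ₗ[ℝ] ℝ) (c : ℝ)
    (h : Set.Infinite {t : ℝ | f (fun n => t ^ (n.val + 1)) = c}) : f = 0 := by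
  classical
  have hf : ∀ x : Fin K → ℝ, f x = ∑ n, x n * f (Pi.single n 1) := fun x => by
    rw [LinearMap.pi_apply_eq_sum_univ f x]
    refine Finset.sum_congr rfl fun n _ => ?_
    rw [smul_eq_mul]
    congr 2
    ext j
    simp [Pi.single_apply, eq_comm]
  set P : Polynomial ℝ := ∑ n : Fin K, Polynomial.C (f (Pi.single n 1)) *
    Polynomial.X ^ (n.val + 1) - Polynomial.C c with hP
  have hP0 : P = 0 := by
    refine Polynomial.eq_zero_of_infinite_isRoot P (h.mono fun t ht => ?_)
    have ht' : f (fun n => t ^ (n.val + 1)) = c := ht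
    rw [hf] at ht'
    simp only [mem_ofPred_eq, Polynomial.IsRoot, hP, Polynomial.eval_sub, Polynomial.eval_finsetSum,
      Polynomial.eval_mul, Polynomial.eval_C, Polynomial.eval_pow, Polynomial.eval_X, ← ht']
    simp [mul_comm]
  ext n
  have := congrArg (fun p => Polynomial.coeff p (n.val + 1)) hP0
  simp only [hP, Polynomial.coeff_sub, Polynomial.finsetSum_coeff, Polynomial.coeff_C_mul,
    Polynomial.coeff_X_pow, Polynomial.coeff_C, Polynomial.coeff_zero] at this
  rw [Finset.sum_eq_single n (fun b _ hb => by
    simp [Fin.val_inj, Ne.symm hb]) (by simp)] at this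
  simpa using this

lemma integrableOn_pow_mul_exp (n : ℕ) :
    IntegrableOn (fun t : ℝ => t ^ n * Real.exp (-t)) (Ioi 0) := by
  refine (Real.GammaIntegral_convergent (s := n + 1) (by positivity)).congr_fun
    (fun t _ => ?_) measurableSet_Ioi
  simp [mul_comm, Real.rpow_natCast]

lemma integral_pow_mul_exp (n : ℕ) :
    ∫ t in Ioi (0 : ℝ), t ^ n * Real.exp (-t) = (n.factorial : ℝ) := by
  rw [← Real.Gamma_nat_eq_factorial, Real.Gamma_eq_integral (by positivity)]
  refine setIntegral_congr_fun measurableSet_Ioi fun t _ => ?_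
  simp [mul_comm, Real.rpow_natCast]

/-- The factorials are the moments of the density exp(−t) on the half-line. If they were outside the
hull, a separating functional would give a nonnegative polynomial with integral 0 against this
density, hence the zero polynomial, contradicting strict separation at an interior point. -/
lemma factorial_mem_convexHull (K : ℕ) :
    (fun n : Fin K => ((n.val + 1).factorial : ℝ)) ∈
      convexHull ℝ ((fun (t : ℝ) (n : Fin K) => t ^ (n.val + 1)) '' Ici 0) := by
  set v : ℝ → Fin K → ℝ := fun t n => t ^ (n.val + 1) with hv
  set m : Fin K → ℝ := fun n => ((n.val + 1).factorial : ℝ) with hm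
  by_contra hmem
  -- The curve lies in no hyperplane. An interior point is needed because the hull need not be
  -- closed: only its interior is separated strictly.
  have hint : (interior (convexHull ℝ (v '' Ici 0))).Nonempty := by
    rw [interior_convexHull_nonempty_iff_affineSpan_eq_top]
    have hv0 : v 0 ∈ affineSpan ℝ (v '' Ici 0) :=
      subset_affineSpan _ _ ⟨0, by simp, rfl⟩
    rw [AffineSubspace.affineSpan_eq_top_iff_vectorSpan_eq_top_of_nonempty _ _ _
      (Set.Nonempty.image _ ⟨0, by simp⟩)]
    by_contra hne
    obtain ⟨f, hf0, hf⟩ := Submodule.exists_le_ker_of_lt_top _ (lt_top_iff_ne_top.2 hne)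
    refine hf0 (linearMap_eq_zero_of_infinite f (f (v 0)) ((Ici_infinite (0 : ℝ)).mono ?_))
    intro t ht
    have := hf (vsub_mem_vectorSpan ℝ (mem_image_of_mem v ht)
      (mem_image_of_mem v (mem_Ici.2 (le_refl (0 : ℝ)))))
    rw [LinearMap.mem_ker, vsub_eq_sub, map_sub, sub_eq_zero] at this
    exact this
  obtain ⟨f, hf⟩ := geometric_hahn_banach_open_point (convex_convexHull ℝ (v '' Ici 0)).interior
    isOpen_interior (fun h => hmem (interior_subset h))
  obtain ⟨a, ha⟩ := hint
  have hle : ∀ t ∈ Ici (0 : ℝ), f (v t) ≤ f m := by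
    intro t ht
    have h1 : v t ∈ closure (interior (convexHull ℝ (v '' Ici 0))) := by
      rw [(convex_convexHull ℝ (v '' Ici 0)).closure_interior_eq_closure_of_nonempty_interior
        ⟨a, ha⟩]
      exact subset_closure (subset_convexHull _ _ (mem_image_of_mem v ht))
    exact closure_minimal (fun x hx => (hf x hx).le)
      (isClosed_le f.continuous continuous_const) h1
  have hfs : ∀ x : Fin K → ℝ, f x = ∑ n, x n * f (Pi.single n 1) := fun x => by
    rw [← ContinuousLinearMap.coe_coe, LinearMap.pi_apply_eq_sum_univ (f : _ →ₗ[ℝ] ℝ) x]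
    refine Finset.sum_congr rfl fun n _ => ?_
    rw [smul_eq_mul]
    congr 2
    ext j
    simp [Pi.single_apply, eq_comm]
  have hexp := integrableOn_pow_mul_exp 0
  simp only [pow_zero] at hexp
  set g : ℝ → ℝ := fun t => f m * (1 * Real.exp (-t)) -
    ∑ n : Fin K, f (Pi.single n 1) * (t ^ (n.val + 1) * Real.exp (-t)) with hg
  have hgv : ∀ t, g t = (f m - f (v t)) * Real.exp (-t) := fun t => by
    rw [hfs (v t)]
    simp only [hg, sub_mul, Finset.sum_mul, one_mul]
    congr 1
    exact Finset.sum_congr rfl fun n _ => by ring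
  have hgi : IntegrableOn g (Ioi 0) :=
    (hexp.const_mul _).sub (integrable_finsetSum _ fun n _ =>
      (integrableOn_pow_mul_exp (n.val + 1)).const_mul _)
  have hg0 : ∫ t in Ioi (0 : ℝ), g t = 0 := by
    simp only [hg]
    rw [integral_sub (hexp.const_mul _) (integrable_finsetSum _ fun n _ =>
      (integrableOn_pow_mul_exp (n.val + 1)).const_mul _),
      integral_finsetSum _ (fun n _ => (integrableOn_pow_mul_exp (n.val + 1)).const_mul _)]
    have h1 := integral_pow_mul_exp 0
    simp only [pow_zero, Nat.factorial_zero, Nat.cast_one] at h1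
    simp only [integral_const_mul, integral_pow_mul_exp, h1]
    rw [hfs m]
    simp [hm, mul_comm]
  have hnn : 0 ≤ᵐ[volume.restrict (Ioi 0)] g := by
    refine (ae_restrict_iff' measurableSet_Ioi).2 (Filter.Eventually.of_forall fun t ht => ?_)
    rw [hgv]
    exact mul_nonneg (sub_nonneg.2 (hle t (mem_Ioi.1 ht).le)) (Real.exp_nonneg _)
  have hae := (setIntegral_eq_zero_iff_of_nonneg_ae hnn hgi).1 hg0
  have hf0 : (f : (Fin K → ℝ) →ₗ[ℝ] ℝ) = 0 := by
    refine linearMap_eq_zero_of_infinite _ (f m) fun hfin => ?_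
    have h1 : ∀ᵐ t ∂(volume.restrict (Ioi (0 : ℝ))), t ∈ {t : ℝ | f (v t) = f m} := by
      filter_upwards [hae] with t ht
      have : (f m - f (v t)) * Real.exp (-t) = 0 := by rw [← hgv]; exact ht
      rcases mul_eq_zero.1 this with h | h
      · exact (sub_eq_zero.1 h).symm
      · exact absurd h (Real.exp_pos _).ne'
    have h2 : ∀ᵐ t ∂(volume.restrict (Ioi (0 : ℝ))), t ∉ {t : ℝ | f (v t) = f m} :=
      (measure_eq_zero_iff_ae_notMem).1 (hfin.measure_zero _)
    have h3 : ∀ᵐ t ∂(volume.restrict (Ioi (0 : ℝ))), False := by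
      filter_upwards [h1, h2] with t a b using b a
    rw [Filter.eventually_false_iff_eq_bot, ae_eq_bot, Measure.restrict_eq_zero,
      Real.volume_Ioi] at h3
    exact ENNReal.top_ne_zero h3
  have := hf a ha
  rw [← ContinuousLinearMap.coe_coe, hf0] at this
  simp at this

/-- Here t stands for |z|², which is exponentially distributed for a standard complex Gaussian z.
The moment n = 0, absent from the curve, is the normalisation of the convex weights. -/
lemma exists_radial_quadrature (K : ℕ) :
    ∃ (ι : Type) (_ : Fintype ι) (w t : ι → ℝ), (∀ i, 0 ≤ w i) ∧ (∀ i, 0 ≤ t i) ∧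
      ∀ n ≤ K, ∑ i, w i * t i ^ n = (n.factorial : ℝ) := by
  obtain ⟨ι, _, w, z, hw, hw1, hz, hsum⟩ :=
    mem_convexHull_iff_exists_fintype.1 (factorial_mem_convexHull K)
  choose t ht hzt using hz
  refine ⟨ι, inferInstance, w, t, hw, ht, fun n hn => ?_⟩
  rcases n with _ | n
  · simpa using hw1
  · have := congrFun hsum ⟨n, hn⟩
    simpa [← hzt] using this

/-- Take radius √t and the K + 1 phases that are roots of unity. Averaging over the phases kills the
moments with a ≠ b, since exponents up to K are distinct modulo K + 1; for a = b the radial moment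
of order a remains. -/
lemma exists_complex_quadrature (K : ℕ) :
    ∃ (ι : Type) (_ : Fintype ι) (w : ι → ℝ) (z : ι → ℂ), (∀ i, 0 ≤ w i) ∧
      ∀ a ≤ K, ∀ b ≤ K, ∑ i, (w i : ℂ) * (z i ^ a * star (z i) ^ b) =
        if a = b then (a.factorial : ℂ) else 0 := by
  obtain ⟨ι, _, w, t, hw, ht, hq⟩ := exists_radial_quadrature K
  have hζ := Complex.isPrimitiveRoot_exp (K + 1) (by omega)
  set ζ := Complex.exp (2 * Real.pi * Complex.I / ((K + 1 : ℕ) : ℂ)) with hζd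
  have hζ1 : star ζ * ζ = 1 := by
    have : ‖ζ‖ = 1 := Complex.norm_eq_one_of_pow_eq_one hζ.pow_eq_one (by omega)
    have h := Complex.conj_mul' ζ
    rw [this] at h
    simpa using h
  refine ⟨ι × Fin (K + 1), inferInstance, fun p => w p.1 / (K + 1 : ℕ),
    fun p => (√(t p.1) : ℂ) * ζ ^ p.2.val, fun p => div_nonneg (hw _) (Nat.cast_nonneg _),
    fun a ha b hb => ?_⟩
  rw [Fintype.sum_prod_type]
  have h1 : ∀ (i : ι) (j : Fin (K + 1)), ((w i / (K + 1 : ℕ) : ℝ) : ℂ) *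
      (((√(t i) : ℂ) * ζ ^ j.val) ^ a * star ((√(t i) : ℂ) * ζ ^ j.val) ^ b) =
      ((w i * √(t i) ^ (a + b) : ℝ) : ℂ) / (K + 1 : ℕ) * (ζ ^ a * star ζ ^ b) ^ j.val := by
    intro i j
    have : star (√(t i) : ℂ) = (√(t i) : ℂ) := Complex.conj_ofReal _
    rw [star_mul, star_pow, this]
    push_cast
    ring
  simp only [h1, ← Finset.mul_sum]
  rw [Fin.sum_univ_eq_sum_range (fun j => (ζ ^ a * star ζ ^ b) ^ j) (K + 1)]
  split_ifs with hab
  · subst hab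
    have h2 : ζ ^ a * star ζ ^ a = 1 := by rw [← mul_pow, mul_comm ζ, hζ1, one_pow]
    rw [h2]
    simp only [one_pow, Finset.sum_const, Finset.card_range, nsmul_eq_mul, mul_one]
    have h3 : ((K + 1 : ℕ) : ℂ) ≠ 0 := Nat.cast_ne_zero.2 (by omega)
    simp only [div_mul_cancel₀ _ h3]
    rw [← Complex.ofReal_sum, ← Complex.ofReal_natCast a.factorial, ← hq a ha]
    congr 1
    refine Finset.sum_congr rfl fun i _ => ?_
    rw [← two_mul, pow_mul, Real.sq_sqrt (ht i)]
  · have hx1 : ζ ^ a * star ζ ^ b ≠ 1 := by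
      intro h
      apply hab
      refine hζ.pow_inj (by omega) (by omega) ?_
      calc ζ ^ a = ζ ^ a * (star ζ * ζ) ^ b := by rw [hζ1]; simp
        _ = (ζ ^ a * star ζ ^ b) * ζ ^ b := by rw [mul_pow]; ring
        _ = _ := by rw [h, one_mul]
    have hxM : (ζ ^ a * star ζ ^ b) ^ (K + 1) = 1 := by
      have h4 : ζ ^ (K + 1) = 1 := hζ.pow_eq_one
      have h5 : star ζ ^ (K + 1) = 1 := by rw [← star_pow, h4, star_one]
      calc _ = (ζ ^ (K + 1)) ^ a * (star ζ ^ (K + 1)) ^ b := by ring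
        _ = 1 := by rw [h4, h5]; simp
    have hs : ∑ j ∈ Finset.range (K + 1), (ζ ^ a * star ζ ^ b) ^ j = 0 := by
      rw [geom_sum_eq hx1, hxM, sub_self, zero_div]
    simp only [hs, mul_zero, Finset.sum_const_zero]

/-- If the fibres of v and u have equal sizes, the permutations in question form a coset of the
stabiliser of v, whose order is the product of the factorials of the fibre sizes; otherwise there
are none. This matches Wick's permutation count with the coordinatewise moments a!. -/
lemma card_perm_comp_eq {α β : Type*} [Fintype α] [DecidableEq α] [Fintype β] [DecidableEq β]
    (v u : α → β) :
    Fintype.card {π : Equiv.Perm α // v ∘ π = u} =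
      ∏ b, if Fintype.card {l // v l = b} = Fintype.card {l // u l = b}
        then (Fintype.card {l // v l = b}).factorial else 0 := by
  by_cases h : ∀ b, Fintype.card {l // v l = b} = Fintype.card {l // u l = b}
  · have e : ∀ b, {l // u l = b} ≃ {l // v l = b} := fun b =>
      Fintype.equivOfCardEq (h b).symm
    set π₀ : Equiv.Perm α := (Equiv.sigmaFiberEquiv u).symm.trans
      ((Equiv.sigmaCongrRight e).trans (Equiv.sigmaFiberEquiv v)) with hπ
    have hv : v ∘ π₀ = u := by
      ext l
      exact (e (u l) ⟨l, rfl⟩).2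
    simp only [h, if_true]
    simp only [← h]
    rw [← DomMulAct.stabilizer_card v]
    refine Fintype.card_congr ((Equiv.mulRight π₀⁻¹).subtypeEquiv fun π => ?_)
    rw [← hv]
    simp only [Equiv.coe_mulRight, Equiv.Perm.coe_mul]
    constructor
    · intro h
      rw [← Function.comp_assoc, h]
      ext; simp
    · intro h
      conv_rhs => rw [← h]
      ext; simp
  · push Not at h
    obtain ⟨b, hb⟩ := h
    rw [Finset.prod_eq_zero (Finset.mem_univ b) (by rw [if_neg hb]), Fintype.card_eq_zero_iff]
    refine ⟨fun ⟨π, hπ⟩ => hb ?_⟩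
    refine (Fintype.card_congr (π.subtypeEquiv fun l => ?_)).symm
    rw [← hπ]
    rfl

lemma prod_comp_eq_prod_pow {α β M : Type*} [Fintype α] [Fintype β] [DecidableEq β]
    [CommMonoid M] (v : α → β) (f : β → M) :
    ∏ l, f (v l) = ∏ b, f b ^ Fintype.card {l // v l = b} := by
  rw [← Finset.prod_fiberwise Finset.univ v (fun l => f (v l))]
  refine Finset.prod_congr rfl fun b _ => ?_
  rw [Fintype.card_subtype, ← Finset.prod_const]
  exact Finset.prod_congr rfl fun l hl => by rw [(Finset.mem_filter.1 hl).2]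

/-- Finitely many vectors in `ℂ^d` whose moments up to a given order are the ones of the standard
complex Gaussian measure, in the form of Wick's formula. -/
lemma exists_gaussian_quadrature (K d : ℕ) :
    ∃ (ι : Type) (_ : Fintype ι) (w : ι → ℝ) (z : ι → Fin d → ℂ), (∀ i, 0 ≤ w i) ∧
      ∀ k ≤ K, ∀ v u : Fin k → Fin d,
        ∑ i, (w i : ℂ) * ∏ l, (z i (v l) * star (z i (u l))) =
          (Fintype.card {π : Equiv.Perm (Fin k) // v ∘ π = u} : ℂ) := by
  obtain ⟨ι, _, w, z, hw, hq⟩ := exists_complex_quadrature K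
  classical
  refine ⟨Fin d → ι, inferInstance, fun s => ∏ a, w (s a), fun s a => z (s a),
    fun s => Finset.prod_nonneg fun a _ => hw _, fun k hk v u => ?_⟩
  have hcard : ∀ (v : Fin k → Fin d) b, Fintype.card {l // v l = b} ≤ K := fun v b =>
    ((Fintype.card_subtype_le _).trans_eq (Fintype.card_fin k)).trans hk
  rw [card_perm_comp_eq, Nat.cast_prod]
  simp only [Finset.prod_mul_distrib]
  have : ∀ s : Fin d → ι, ((∏ a, w (s a) : ℝ) : ℂ) *
      ((∏ l, z (s (v l))) * ∏ l, star (z (s (u l)))) =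
      ∏ a, ((w (s a) : ℂ) * (z (s a) ^ Fintype.card {l // v l = a} *
        star (z (s a)) ^ Fintype.card {l // u l = a})) := fun s => by
    rw [prod_comp_eq_prod_pow v (fun a => z (s a)),
      prod_comp_eq_prod_pow u (fun a => star (z (s a))), ← Finset.prod_mul_distrib]
    push_cast
    rw [← Finset.prod_mul_distrib]
  simp only [this]
  rw [← Fintype.piFinset_univ, ← Finset.prod_univ_sum (fun _ => Finset.univ)
    (fun a i => (w i : ℂ) * (z i ^ Fintype.card {l // v l = a} *
        star (z i) ^ Fintype.card {l // u l = a}))]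
  refine Finset.prod_congr rfl fun a _ => ?_
  rw [hq _ (hcard v a) _ (hcard u a)]
  split_ifs <;> simp

end Quadrature

/-! ### Measuring and preparing one party -/

/-- The contraction with the Wick kernel of a kernel that is symmetric in both arguments. -/
lemma sum_card_perm_mul {m d : ℕ} (f : (Fin (m + 1) → Fin d) → (Fin (m + 1) → Fin d) → ℂ)
    (hl : ∀ (π : Equiv.Perm (Fin (m + 1))) u v, f (u ∘ π) v = f u v)
    (hr : ∀ (π : Equiv.Perm (Fin (m + 1))) u v, f u (v ∘ π) = f u v) (x y : Fin d) :
    ∑ u, ∑ v, (Fintype.card {π : Equiv.Perm (Fin (m + 2)) //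
        (Fin.cons x v : Fin (m + 2) → Fin d) ∘ π = Fin.cons y u} : ℂ) * f u v =
      ((m + 1).factorial : ℂ) * ((if x = y then ∑ u, f u u else 0) +
        (m + 1) * ∑ z : Fin m → Fin d, f (Fin.cons x z) (Fin.cons y z)) := by
  -- A permutation is split into the image q of 0 and a permutation e of the other slots. By
  -- symmetry of f all e contribute equally, which gives (m + 1)!; q = 0 produces the trace term,
  -- and each of the m + 1 other values of q one copy of the partial trace.
  have hcond : ∀ (q : Fin (m + 2)) (e : Equiv.Perm (Fin (m + 1))) (u v : Fin (m + 1) → Fin d),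
      ((Fin.cons x v : Fin (m + 2) → Fin d) ∘ (Equiv.Perm.decomposeFin.symm (q, e)) =
        Fin.cons y u) ↔ (Fin.cons x v : Fin (m + 2) → Fin d) q = y ∧
          u = (fun i => (Fin.cons x v : Fin (m + 2) → Fin d) (Equiv.swap 0 q i.succ)) ∘ e := by
    intro q e u v
    rw [funext_iff, Fin.forall_fin_succ, funext_iff]
    simp only [Function.comp_apply, Equiv.Perm.decomposeFin_symm_apply_zero,
      Equiv.Perm.decomposeFin_symm_apply_succ, Fin.cons_zero, Fin.cons_succ, eq_comm]
  have hcard : ∀ u v : Fin (m + 1) → Fin d, (Fintype.card {π : Equiv.Perm (Fin (m + 2)) //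
      (Fin.cons x v : Fin (m + 2) → Fin d) ∘ π = Fin.cons y u} : ℂ) =
      ∑ q : Fin (m + 2), ∑ e : Equiv.Perm (Fin (m + 1)),
        if (Fin.cons x v : Fin (m + 2) → Fin d) q = y ∧
          u = (fun i => (Fin.cons x v : Fin (m + 2) → Fin d) (Equiv.swap 0 q i.succ)) ∘ e
        then (1 : ℂ) else 0 := by
    intro u v
    rw [Fintype.card_subtype, Finset.card_filter, Nat.cast_sum,
      ← Equiv.Perm.decomposeFin.symm.sum_comp, Fintype.sum_prod_type]
    refine Finset.sum_congr rfl fun q _ => Finset.sum_congr rfl fun e _ => ?_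
    simp only [hcond]
    split_ifs <;> simp
  have hq : ∀ (q : Fin (m + 2)) (e : Equiv.Perm (Fin (m + 1))),
      ∑ u, ∑ v, (if (Fin.cons x v : Fin (m + 2) → Fin d) q = y ∧
          u = (fun i => (Fin.cons x v : Fin (m + 2) → Fin d) (Equiv.swap 0 q i.succ)) ∘ e
        then (1 : ℂ) else 0) * f u v =
      ∑ v, if (Fin.cons x v : Fin (m + 2) → Fin d) q = y then
        f (fun i => (Fin.cons x v : Fin (m + 2) → Fin d) (Equiv.swap 0 q i.succ)) v else 0 := by
    intro q e
    rw [Finset.sum_comm]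
    refine Finset.sum_congr rfl fun v _ => ?_
    by_cases h : (Fin.cons x v : Fin (m + 2) → Fin d) q = y
    · simp only [h, true_and, if_true, ite_mul, one_mul, zero_mul, Finset.sum_ite_eq',
        Finset.mem_univ, hl]
    · simp [h]
  -- For q = l.succ the constraint says that v has entry y in slot l and that, up to e, u is v with
  -- this entry changed to x. Symmetry of f moves slot l to the front.
  have hsucc : ∀ l : Fin (m + 1),
      (∑ v : Fin (m + 1) → Fin d, if (Fin.cons x v : Fin (m + 2) → Fin d) l.succ = y then
        f (fun i => (Fin.cons x v : Fin (m + 2) → Fin d) (Equiv.swap 0 l.succ i.succ)) v else 0) =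
      ∑ z : Fin m → Fin d, f (Fin.cons x z) (Fin.cons y z) := by
    intro l
    have h1 : ∀ v : Fin (m + 1) → Fin d,
        (fun i : Fin (m + 1) => (Fin.cons x v : Fin (m + 2) → Fin d)
          (Equiv.swap 0 l.succ i.succ)) = Function.update v l x := by
      intro v
      ext i
      rcases eq_or_ne i l with rfl | h
      · simp
      · rw [Equiv.swap_apply_of_ne_of_ne (Fin.succ_ne_zero i) (by simpa using h)]
        simp [h]
    simp only [h1, Fin.cons_succ]
    rw [← (Equiv.arrowCongr (Equiv.swap 0 l) (Equiv.refl (Fin d))).sum_comp,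
      ← (Fin.consEquiv fun _ => Fin d).sum_comp, Fintype.sum_prod_type, Finset.sum_comm]
    refine Finset.sum_congr rfl fun z _ => ?_
    rw [Finset.sum_eq_single y]
    · have h2 : (Equiv.arrowCongr (Equiv.swap 0 l) (Equiv.refl (Fin d)))
          (Fin.cons y z : Fin (m + 1) → Fin d) = (Fin.cons y z) ∘ Equiv.swap 0 l := by
        ext i; simp [Equiv.arrowCongr]
      have h3 : Function.update ((Fin.cons y z : Fin (m + 1) → Fin d) ∘ Equiv.swap 0 l) l x =
          (Fin.cons x z : Fin (m + 1) → Fin d) ∘ Equiv.swap 0 l := by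
        ext i
        rcases eq_or_ne i l with rfl | h
        · simp
        · rcases eq_or_ne i 0 with rfl | h0
          · obtain ⟨l', rfl⟩ := Fin.exists_succ_eq.2 h.symm
            simp [h]
          · obtain ⟨i', rfl⟩ := Fin.exists_succ_eq.2 h0
            simp [h, Equiv.swap_apply_of_ne_of_ne h0 h]
      have hc : (Fin.consEquiv fun _ => Fin d) (y, z) = (Fin.cons y z : Fin (m + 1) → Fin d) := rfl
      rw [hc, h2, h3, hl, hr]
      simp
    · intro b _ hb
      simp [Fin.consEquiv, Equiv.arrowCongr, hb]
    · simp
  simp only [hcard, Finset.sum_mul]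
  have hswap : ∀ F : (Fin (m + 1) → Fin d) → (Fin (m + 1) → Fin d) → Fin (m + 2) →
      Equiv.Perm (Fin (m + 1)) → ℂ,
      ∑ u, ∑ v, ∑ q, ∑ e, F u v q e = ∑ q, ∑ e, ∑ u, ∑ v, F u v q e := by
    intro F
    calc _ = ∑ u, ∑ q, ∑ v, ∑ e, F u v q e :=
          Finset.sum_congr rfl fun u _ => Finset.sum_comm
      _ = ∑ q, ∑ u, ∑ v, ∑ e, F u v q e := Finset.sum_comm
      _ = ∑ q, ∑ u, ∑ e, ∑ v, F u v q e :=
          Finset.sum_congr rfl fun q _ => Finset.sum_congr rfl fun u _ => Finset.sum_comm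
      _ = _ := Finset.sum_congr rfl fun q _ => Finset.sum_comm
  rw [hswap]
  simp only [hq, Finset.sum_const, Finset.card_univ, Fintype.card_perm, Fintype.card_fin,
    nsmul_eq_mul, ← Finset.mul_sum]
  congr 1
  rw [Fin.sum_univ_succ]
  simp only [hsucc]
  congr 1
  · by_cases h : x = y <;> simp [h]
  · simp

/-- Contraction of all parties with kernels. -/
noncomputable def contract {N : ℕ} {d : Fin N → ℕ} {U : Fin N → Type} [∀ i, Fintype (U i)]
    (K : ∀ i, Fin (d i) → Fin (d i) → U i → U i → ℂ) (τ : Matrix (∀ i, U i) (∀ i, U i) ℂ) :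
    Matrix (∀ i, Fin (d i)) (∀ i, Fin (d i)) ℂ :=
  Matrix.of fun x y => ∑ u, ∑ v, (∏ i, K i (x i) (y i) (u i) (v i)) * τ u v

/-- Contraction of all parties but one with kernels. -/
noncomputable def contractOthers {N : ℕ} {d : Fin N → ℕ} {U : Fin N → Type}
    [∀ i, Fintype (U i)] (j : Fin N) (K : ∀ i, Fin (d i) → Fin (d i) → U i → U i → ℂ)
    (τ : Matrix (∀ i, U i) (∀ i, U i) ℂ) (x y : ∀ i, Fin (d i)) (a b : U j) : ℂ :=
  ∑ u : ∀ i : {i // i ≠ j}, U i, ∑ v : ∀ i : {i // i ≠ j}, U i,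
    (∏ i : {i // i ≠ j}, K i (x i) (y i) (u i) (v i)) *
      τ ((Equiv.piSplitAt j U).symm (a, u)) ((Equiv.piSplitAt j U).symm (b, v))

section

variable {N : ℕ} {d : Fin N → ℕ} {U : Fin N → Type} [∀ i, Fintype (U i)]

/-- With the other parties contracted first, what remains is a kernel in the copies of party j
alone, so one-party identities apply inside the N-party contraction. -/
lemma contract_eq (j : Fin N) (K : ∀ i, Fin (d i) → Fin (d i) → U i → U i → ℂ)
    (τ : Matrix (∀ i, U i) (∀ i, U i) ℂ) (x y : ∀ i, Fin (d i)) :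
    contract K τ x y = ∑ a, ∑ b, K j (x j) (y j) a b * contractOthers j K τ x y a b := by
  have hprod : ∀ (a b : U j) (u v : ∀ i : {i // i ≠ j}, U i),
      ∏ i, K i (x i) (y i) ((Equiv.piSplitAt j U).symm (a, u) i)
        ((Equiv.piSplitAt j U).symm (b, v) i) =
      K j (x j) (y j) a b * ∏ i : {i // i ≠ j}, K i (x i) (y i) (u i) (v i) := by
    intro a b u v
    rw [← Finset.mul_prod_erase _ _ (Finset.mem_univ j)]
    congr 1
    · simp [Equiv.piSplitAt]
    · rw [Finset.prod_subtype (Finset.univ.erase j) (p := fun i => i ≠ j) (by simp)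
        (fun i => K i (x i) (y i) ((Equiv.piSplitAt j U).symm (a, u) i)
        ((Equiv.piSplitAt j U).symm (b, v) i))]
      refine Finset.prod_congr rfl fun i _ => ?_
      simp [Equiv.piSplitAt, i.2]
  simp only [contract, Matrix.of_apply]
  rw [← (Equiv.piSplitAt j U).symm.sum_comp, Fintype.sum_prod_type]
  refine Finset.sum_congr rfl fun a _ => ?_
  simp only [← (Equiv.piSplitAt j U).symm.sum_comp
    (fun v => (∏ i, K i (x i) (y i) ((Equiv.piSplitAt j U).symm (a, _) i) (v i)) * τ _ v),
    Fintype.sum_prod_type, hprod]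
  rw [Finset.sum_comm]
  refine Finset.sum_congr rfl fun b _ => ?_
  simp only [contractOthers, Finset.mul_sum, mul_assoc]

lemma contractOthers_congr (j : Fin N) {K K' : ∀ i, Fin (d i) → Fin (d i) → U i → U i → ℂ}
    (hK : ∀ i, i ≠ j → K i = K' i) (τ : Matrix (∀ i, U i) (∀ i, U i) ℂ)
    {x x' y y' : ∀ i, Fin (d i)} (hx : ∀ i, i ≠ j → x i = x' i) (hy : ∀ i, i ≠ j → y i = y' i)
    (a b : U j) : contractOthers j K τ x y a b = contractOthers j K' τ x' y' a b := by
  simp only [contractOthers]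
  refine Finset.sum_congr rfl fun u _ => Finset.sum_congr rfl fun v _ => ?_
  congr 1
  exact Finset.prod_congr rfl fun i _ => by rw [hK i i.2, hx i i.2, hy i i.2]

end

/-- Invariance under the permutations of the copies of each party. -/
def IsCopySymmetric {N : ℕ} {d m : Fin N → ℕ}
    (τ : Matrix (∀ i, Fin (m i + 1) → Fin (d i)) (∀ i, Fin (m i + 1) → Fin (d i)) ℂ) : Prop :=
  (∀ (π : ∀ i, Equiv.Perm (Fin (m i + 1))) u v, τ (fun i => u i ∘ π i) v = τ u v) ∧
    ∀ (π : ∀ i, Equiv.Perm (Fin (m i + 1))) u v, τ u (fun i => v i ∘ π i) = τ u v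

/-- The kernel of the partial trace over all copies of a party but the first. -/
noncomputable def traceKernel (m d : ℕ) (x y : Fin d) (u v : Fin (m + 1) → Fin d) : ℂ :=
  ∑ z : Fin m → Fin d, (if u = Fin.cons x z then 1 else 0) * if v = Fin.cons y z then 1 else 0

/-- The kernel of measuring all copies of a party in coherent states and preparing one copy. -/
noncomputable def prepareKernel (m d : ℕ) (x y : Fin d) (u v : Fin (m + 1) → Fin d) : ℂ :=
  ((((m + 1).factorial * (m + 1 + d) : ℕ) : ℂ))⁻¹ *
    (Fintype.card {π : Equiv.Perm (Fin (m + 2)) //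
        (Fin.cons x v : Fin (m + 2) → Fin d) ∘ π = Fin.cons y u} : ℂ)

lemma sum_traceKernel_mul {m d : ℕ} (x y : Fin d)
    (f : (Fin (m + 1) → Fin d) → (Fin (m + 1) → Fin d) → ℂ) :
    ∑ u, ∑ v, traceKernel m d x y u v * f u v =
      ∑ z : Fin m → Fin d, f (Fin.cons x z) (Fin.cons y z) := by
  simp only [traceKernel, Finset.sum_mul]
  calc _ = ∑ u, ∑ z : Fin m → Fin d, ∑ v, ((if u = Fin.cons x z then (1 : ℂ) else 0) *
        (if v = Fin.cons y z then 1 else 0) * f u v) :=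
        Finset.sum_congr rfl fun u _ => Finset.sum_comm
    _ = ∑ z : Fin m → Fin d, ∑ u, ∑ v, ((if u = Fin.cons x z then (1 : ℂ) else 0) *
        (if v = Fin.cons y z then 1 else 0) * f u v) := Finset.sum_comm
    _ = _ := Finset.sum_congr rfl fun z _ => by simp

/-- Replacing one party by a maximally mixed one, up to normalisation. -/
noncomputable def depolarize {N : ℕ} {d : Fin N → ℕ} (j : Fin N)
    (ρ : Matrix (∀ i, Fin (d i)) (∀ i, Fin (d i)) ℂ) :
    Matrix (∀ i, Fin (d i)) (∀ i, Fin (d i)) ℂ :=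
  Matrix.of fun x y => if x j = y j then
    ∑ a, ρ (Function.update x j a) (Function.update y j a) else 0

/-- This is `sum_card_perm_mul` applied to party j: measuring k = m j + 1 copies and preparing one
gives the mixture with weights k/(k + d) and d/(k + d) of the previous marginal and of that marginal
with party j made maximally mixed. -/
lemma contract_update_prepareKernel {N : ℕ} {d m : Fin N → ℕ}
    {τ : Matrix (∀ i, Fin (m i + 1) → Fin (d i)) (∀ i, Fin (m i + 1) → Fin (d i)) ℂ}
    (hτ : IsCopySymmetric τ) (j : Fin N)
    {K K' : ∀ i, Fin (d i) → Fin (d i) → (Fin (m i + 1) → Fin (d i)) →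
      (Fin (m i + 1) → Fin (d i)) → ℂ}
    (hKj : K j = traceKernel (m j) (d j)) (hKj' : K' j = prepareKernel (m j) (d j))
    (hK : ∀ i, i ≠ j → K' i = K i) :
    contract K' τ = ((m j + 1 + d j : ℕ) : ℂ)⁻¹ •
      (depolarize j (contract K τ) + ((m j + 1 : ℕ) : ℂ) • contract K τ) := by
  -- A permutation of the copies of party j is seen as a family of permutations that is trivial at
  -- the other parties, so that the symmetry of τ passes to the contracted kernel.
  have hperm : ∀ (π : Equiv.Perm (Fin (m j + 1))) (a : Fin (m j + 1) → Fin (d j))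
      (u : ∀ i : {i // i ≠ j}, Fin (m i + 1) → Fin (d i)),
      (Equiv.piSplitAt j fun i => Fin (m i + 1) → Fin (d i)).symm (a ∘ π, u) =
        fun i => (Equiv.piSplitAt j fun i => Fin (m i + 1) → Fin (d i)).symm (a, u) i ∘
          (Function.update (fun i => (1 : Equiv.Perm (Fin (m i + 1)))) j π) i := by
    intro π a u
    ext i : 1
    rcases eq_or_ne i j with rfl | h
    · simp [Equiv.piSplitAt]
    · simp [Equiv.piSplitAt, h]
  ext x y
  set f := contractOthers j K τ x y with hf
  have hl : ∀ (π : Equiv.Perm (Fin (m j + 1))) u v, f (u ∘ π) v = f u v := by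
    intro π u v
    simp only [hf, contractOthers, hperm, hτ.1]
  have hr : ∀ (π : Equiv.Perm (Fin (m j + 1))) u v, f u (v ∘ π) = f u v := by
    intro π u v
    simp only [hf, contractOthers, hperm, hτ.2]
  rw [contract_eq j, hKj']
  simp only [contractOthers_congr j hK τ (fun i _ => rfl) (fun i _ => rfl)]
  simp only [prepareKernel, mul_assoc, ← Finset.mul_sum]
  rw [← hf, sum_card_perm_mul f hl hr]
  have hup : ∀ a, contract K τ (Function.update x j a) (Function.update y j a) =
      ∑ z : Fin (m j) → Fin (d j), f (Fin.cons a z) (Fin.cons a z) := by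
    intro a
    rw [contract_eq j, hKj]
    simp only [Function.update_self]
    rw [sum_traceKernel_mul]
    refine Finset.sum_congr rfl fun z _ => ?_
    exact contractOthers_congr j (fun _ _ => rfl) τ (fun i h => by simp [h])
      (fun i h => by simp [h]) _ _
  have hxy : contract K τ x y = ∑ z : Fin (m j) → Fin (d j), f (Fin.cons (x j) z)
      (Fin.cons (y j) z) := by
    rw [contract_eq j, hKj, sum_traceKernel_mul]
  have htr : ∑ u, f u u = ∑ a, contract K τ (Function.update x j a) (Function.update y j a) := by
    simp only [hup]
    rw [← (Fin.consEquiv fun _ => Fin (d j)).sum_comp, Fintype.sum_prod_type]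
    rfl
  simp only [Matrix.smul_apply, Matrix.add_apply, depolarize, Matrix.of_apply, smul_eq_mul,
    ← hxy, ← htr]
  have hfac : (((m j + 1).factorial : ℕ) : ℂ) ≠ 0 := Nat.cast_ne_zero.2 (Nat.factorial_ne_zero _)
  push_cast
  field_simp

/-! ### The cone of separable operators -/

section Cone

variable {N : ℕ} {d : Fin N → ℕ}

lemma posSemidef_productProj (φ : ∀ i, EuclideanSpace ℂ (Fin (d i))) :
    (productProj φ).PosSemidef := by
  have : productProj φ = Matrix.vecMulVec (fun x : ∀ i, Fin (d i) => ∏ i, φ i (x i))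
      (star fun x : ∀ i, Fin (d i) => ∏ i, φ i (x i)) := by
    ext x y
    simp [productProj, Matrix.vecMulVec_apply, Finset.prod_mul_distrib]
  rw [this]
  exact Matrix.posSemidef_vecMulVec_self_star _

lemma trace_productProj (φ : ∀ i, EuclideanSpace ℂ (Fin (d i))) :
    (productProj φ).trace = ((∏ i, ‖φ i‖ ^ 2 : ℝ) : ℂ) := by
  simp only [Matrix.trace, Matrix.diag_apply, productProj, Matrix.of_apply,
    EuclideanSpace.norm_sq_eq]
  push_cast
  rw [Finset.prod_univ_sum, Fintype.piFinset_univ]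
  refine Finset.sum_congr rfl fun x _ => Finset.prod_congr rfl fun i _ => ?_
  exact Complex.mul_conj' _

lemma productProj_smul (c : Fin N → ℝ) (φ : ∀ i, EuclideanSpace ℂ (Fin (d i))) :
    productProj (fun i => c i • φ i) = (∏ i, c i ^ 2) • productProj φ := by
  ext x y
  simp only [productProj, Matrix.of_apply, Matrix.smul_apply, PiLp.smul_apply, Complex.real_smul]
  push_cast
  rw [← Finset.prod_mul_distrib]
  refine Finset.prod_congr rfl fun i _ => ?_
  have : star (c i : ℂ) = (c i : ℂ) := Complex.conj_ofReal _
  rw [star_mul, this]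
  ring

lemma isState_of_mem_separable {σ : Matrix (∀ i, Fin (d i)) (∀ i, Fin (d i)) ℂ}
    (hσ : σ ∈ separable d) : IsState σ := by
  have hc : Convex ℝ {σ : Matrix (∀ i, Fin (d i)) (∀ i, Fin (d i)) ℂ | IsState σ} := by
    intro A hA B hB a b ha hb hab
    refine ⟨(hA.1.smul ha).add (hB.1.smul hb), ?_⟩
    rw [Matrix.trace_add, Matrix.trace_smul, Matrix.trace_smul, hA.2, hB.2, ← add_smul, hab,
      one_smul]
  refine convexHull_min ?_ hc hσ
  rintro _ ⟨φ, hφ, rfl⟩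
  exact ⟨posSemidef_productProj φ, by simp [trace_productProj, hφ]⟩

/-- Nonnegative multiples of separable states. -/
def sepCone (d : Fin N → ℕ) : Set (Matrix (∀ i, Fin (d i)) (∀ i, Fin (d i)) ℂ) :=
  {X | X = 0 ∨ ∃ c : ℝ, 0 < c ∧ ∃ σ ∈ separable d, X = c • σ}

lemma sepCone_add {X Y : Matrix (∀ i, Fin (d i)) (∀ i, Fin (d i)) ℂ} (hX : X ∈ sepCone d)
    (hY : Y ∈ sepCone d) : X + Y ∈ sepCone d := by
  rcases hX with rfl | ⟨a, ha, σ, hσ, rfl⟩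
  · simpa using hY
  rcases hY with rfl | ⟨b, hb, σ', hσ', rfl⟩
  · exact Or.inr ⟨a, ha, σ, hσ, by simp⟩
  refine Or.inr ⟨a + b, by positivity, (a / (a + b)) • σ + (b / (a + b)) • σ',
    convex_convexHull ℝ _ hσ hσ' (by positivity) (by positivity) (by field_simp), ?_⟩
  rw [smul_add, smul_smul, smul_smul]
  congr 2 <;> field_simp

lemma sepCone_smul {X : Matrix (∀ i, Fin (d i)) (∀ i, Fin (d i)) ℂ} (hX : X ∈ sepCone d)
    {c : ℝ} (hc : 0 ≤ c) : c • X ∈ sepCone d := by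
  rcases hc.eq_or_lt with rfl | hc
  · exact Or.inl (by simp)
  rcases hX with rfl | ⟨a, ha, σ, hσ, rfl⟩
  · exact Or.inl (by simp)
  · exact Or.inr ⟨c * a, by positivity, σ, hσ, by rw [smul_smul]⟩

lemma sepCone_sum {ι : Type*} (s : Finset ι)
    {X : ι → Matrix (∀ i, Fin (d i)) (∀ i, Fin (d i)) ℂ} (hX : ∀ i ∈ s, X i ∈ sepCone d) :
    ∑ i ∈ s, X i ∈ sepCone d :=
  Finset.sum_induction _ (· ∈ sepCone d) (fun _ _ => sepCone_add) (Or.inl rfl) hX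

lemma productProj_mem_sepCone (φ : ∀ i, EuclideanSpace ℂ (Fin (d i))) :
    productProj φ ∈ sepCone d := by
  by_cases h : ∀ i, φ i ≠ 0
  · have h0 : ∀ i, ‖φ i‖ ≠ 0 := fun i => norm_ne_zero_iff.2 (h i)
    refine Or.inr ⟨∏ i, ‖φ i‖ ^ 2, Finset.prod_pos fun i _ => by have := h0 i; positivity,
      productProj (fun i => ‖φ i‖⁻¹ • φ i), subset_convexHull _ _ ⟨_, fun i => ?_, rfl⟩, ?_⟩
    · rw [norm_smul, norm_inv, norm_norm, inv_mul_cancel₀ (h0 i)]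
    · rw [← productProj_smul]
      congr 1
      ext1 i
      rw [smul_smul, mul_inv_cancel₀ (h0 i), one_smul]
  · push Not at h
    obtain ⟨i, hi⟩ := h
    left
    ext x y
    simp only [productProj, Matrix.of_apply, Matrix.zero_apply]
    exact Finset.prod_eq_zero (Finset.mem_univ i) (by simp [hi])

/-- Separable states have trace one, so the scale of an element of the cone is its trace. -/
lemma inv_trace_smul_mem_separable {X : Matrix (∀ i, Fin (d i)) (∀ i, Fin (d i)) ℂ}
    (hX : X ∈ sepCone d) {t : ℝ} (ht : X.trace = t) (ht0 : t ≠ 0) : t⁻¹ • X ∈ separable d := by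
  rcases hX with rfl | ⟨c, hc, σ, hσ, rfl⟩
  · simp only [Matrix.trace_zero] at ht
    exact absurd (by exact_mod_cast ht.symm) ht0
  · rw [Matrix.trace_smul, (isState_of_mem_separable hσ).2, Complex.real_smul, mul_one] at ht
    have hct : c = t := by exact_mod_cast ht
    rw [← hct, smul_smul, inv_mul_cancel₀ hc.ne', one_smul]
    exact hσ

end Cone

/-! ### Symmetrically extendible states are close to separable ones -/

section Extendible

variable {N : ℕ} {d : Fin N → ℕ}

/-- If every kernel is a sum over outcomes of its party, the contraction is a sum over joint
outcomes s. -/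
lemma contract_sum {U S : Fin N → Type} [∀ i, Fintype (U i)] [∀ i, Fintype (S i)]
    (F : ∀ i, S i → Fin (d i) → Fin (d i) → U i → U i → ℂ)
    (τ : Matrix (∀ i, U i) (∀ i, U i) ℂ) (x y : ∀ i, Fin (d i)) :
    contract (fun i x y u v => ∑ s, F i s x y u v) τ x y =
      ∑ s : ∀ i, S i, ∑ u, ∑ v, (∏ i, F i (s i) (x i) (y i) (u i) (v i)) * τ u v := by
  classical
  simp only [contract, Matrix.of_apply, Finset.prod_univ_sum, Fintype.piFinset_univ,
    Finset.sum_mul]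
  calc _ = ∑ u, ∑ s : ∀ i, S i, ∑ v, (∏ i, F i (s i) (x i) (y i) (u i) (v i)) * τ u v :=
        Finset.sum_congr rfl fun u _ => Finset.sum_comm
    _ = _ := Finset.sum_comm

lemma partialTrace_eq_contract {m : Fin N → ℕ}
    (τ : Matrix (∀ i, Fin (m i + 1) → Fin (d i)) (∀ i, Fin (m i + 1) → Fin (d i)) ℂ) :
    partialTrace τ = contract (fun i => traceKernel (m i) (d i)) τ := by
  ext x y
  have := contract_sum (S := fun i => Fin (m i) → Fin (d i)) (fun i z x y u v =>
    (if u = Fin.cons x z then (1 : ℂ) else 0) * if v = Fin.cons y z then 1 else 0) τ x y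
  refine Eq.trans ?_ this.symm
  simp only [partialTrace, Matrix.of_apply]
  refine Finset.sum_congr rfl fun z _ => ?_
  simp only [Finset.prod_mul_distrib, Finset.prod_boole, Finset.mem_univ, true_imp_iff,
    ← funext_iff (f := (_ : ∀ i, Fin (m i + 1) → Fin (d i)))
      (g := fun i => Fin.cons _ (z i))]
  simp only [ite_mul, one_mul, zero_mul, Finset.sum_ite_irrel, Finset.sum_const_zero,
    Finset.sum_ite_eq', Finset.mem_univ, if_true]

/-- Kernels of completely positive maps. -/
def IsPositiveKernel {X U : Type} (K : X → X → U → U → ℂ) : Prop :=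
  ∃ (S : Type) (_ : Fintype S) (A : S → X → U → ℂ),
    K = fun x y u v => ∑ s, A s x u * star (A s y v)

lemma isPositiveKernel_traceKernel (m d : ℕ) : IsPositiveKernel (traceKernel m d) :=
  ⟨Fin m → Fin d, inferInstance, fun z x u => if u = Fin.cons x z then 1 else 0, by
    ext x y u v
    simp only [traceKernel]
    refine Finset.sum_congr rfl fun z _ => ?_
    congr 1
    split_ifs <;> simp⟩

/-- Wick's count is the Gaussian moment with m + 2 factors z and as many conjugates. One of each is
the prepared state; the others, with the square root of the weight, form the measurement functional
c. Each Kraus operator thus has rank one, and this makes the output separable. -/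
lemma exists_prepareKernel_eq (m d : ℕ) : ∃ (S : Type) (_ : Fintype S) (z : S → Fin d → ℂ)
    (c : S → (Fin (m + 1) → Fin d) → ℂ),
    prepareKernel m d = fun x y u v => ∑ s, z s x * c s u * star (z s y * c s v) := by
  obtain ⟨S, hS, w, z, hw, hq⟩ := exists_gaussian_quadrature (m + 2) d
  set r : ℝ := (((m + 1).factorial * (m + 1 + d) : ℕ) : ℝ)⁻¹ with hr
  have hr0 : 0 ≤ r := by positivity
  refine ⟨S, hS, z, fun s u => (√(r * w s) : ℂ) * ∏ l, star (z s (u l)), ?_⟩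
  ext x y u v
  rw [prepareKernel, ← hq _ le_rfl, Finset.mul_sum]
  refine Finset.sum_congr rfl fun s _ => ?_
  rw [Fin.prod_univ_succ]
  simp only [Fin.cons_zero, Fin.cons_succ, Finset.prod_mul_distrib, star_mul, star_prod, star_star]
  have h1 : star (√(r * w s) : ℂ) = (√(r * w s) : ℂ) := Complex.conj_ofReal _
  have h2 : (√(r * w s) : ℂ) * (√(r * w s) : ℂ) = (r : ℂ) * w s := by
    rw [← Complex.ofReal_mul, Real.mul_self_sqrt (mul_nonneg hr0 (hw s)), Complex.ofReal_mul]
  rw [h1]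
  have h3 : ((((m + 1).factorial * (m + 1 + d) : ℕ) : ℂ))⁻¹ = (r : ℂ) := by
    rw [hr]; push_cast; rfl
  rw [h3]
  calc _ = ((r : ℂ) * w s) * (z s x * star (z s y) * ((∏ l, z s (v l)) *
      ∏ l, star (z s (u l)))) := by ring
    _ = _ := by rw [← h2]; ring

lemma isPositiveKernel_prepareKernel (m d : ℕ) : IsPositiveKernel (prepareKernel m d) := by
  obtain ⟨S, hS, z, c, h⟩ := exists_prepareKernel_eq m d
  exact ⟨S, hS, fun s x u => z s x * c s u, h⟩

/-- Kernels in Kraus form give a sum of congruences A τ Aᴴ with A a tensor product of Kraus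
operators. -/
lemma posSemidef_contract {U : Fin N → Type} [∀ i, Fintype (U i)]
    {K : ∀ i, Fin (d i) → Fin (d i) → U i → U i → ℂ} (hK : ∀ i, IsPositiveKernel (K i))
    {τ : Matrix (∀ i, U i) (∀ i, U i) ℂ} (hτ : τ.PosSemidef) : (contract K τ).PosSemidef := by
  choose S hS A hA using hK
  have hK' : K = fun i x y u v => ∑ s, A i s x u * star (A i s y v) := funext hA
  have : contract K τ = ∑ s : ∀ i, S i,
      (Matrix.of fun (x : ∀ i, Fin (d i)) (u : ∀ i, U i) => ∏ i, A i (s i) (x i) (u i)) * τ *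
      (Matrix.of fun (x : ∀ i, Fin (d i)) (u : ∀ i, U i) => ∏ i, A i (s i) (x i) (u i))ᴴ := by
    ext x y
    rw [hK', contract_sum, Matrix.sum_apply]
    refine Finset.sum_congr rfl fun s _ => ?_
    simp only [Matrix.mul_apply, Matrix.of_apply, Matrix.conjTranspose_apply, Finset.sum_mul]
    rw [Finset.sum_comm]
    refine Finset.sum_congr rfl fun v _ => Finset.sum_congr rfl fun u _ => ?_
    rw [Finset.prod_mul_distrib, star_prod]
    ring
  rw [this]
  exact Matrix.posSemidef_sum _ fun s _ => hτ.mul_mul_conjTranspose_same _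

lemma posSemidef_depolarize {ρ : Matrix (∀ i, Fin (d i)) (∀ i, Fin (d i)) ℂ}
    (hρ : ρ.PosSemidef) (j : Fin N) : (depolarize j ρ).PosSemidef := by
  have : depolarize j ρ = ∑ b : Fin (d j), ∑ a : Fin (d j),
      Matrix.diagonal (fun x : ∀ i, Fin (d i) => if x j = b then (1 : ℂ) else 0) *
        ρ.submatrix (fun x => Function.update x j a) (fun x => Function.update x j a) *
      (Matrix.diagonal (fun x : ∀ i, Fin (d i) => if x j = b then (1 : ℂ) else 0))ᴴ := by
    ext x y
    simp only [Matrix.sum_apply, depolarize, Matrix.of_apply, Matrix.diagonal_conjTranspose,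
      Matrix.mul_diagonal, Matrix.diagonal_mul, Matrix.submatrix_apply]
    refine Eq.trans ?_ (Finset.sum_eq_single (x j)
      (fun b _ hb => Finset.sum_eq_zero fun a _ => ?_) (by simp)).symm
    · by_cases h : x j = y j
      · simp [h]
      · simp [h, Ne.symm h]
    · rw [if_neg (Ne.symm hb), zero_mul, zero_mul]
  rw [this]
  exact Matrix.posSemidef_sum _ fun b _ => Matrix.posSemidef_sum _ fun a _ =>
    (hρ.submatrix _).mul_mul_conjTranspose_same _

lemma trace_depolarize (ρ : Matrix (∀ i, Fin (d i)) (∀ i, Fin (d i)) ℂ) (j : Fin N) :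
    (depolarize j ρ).trace = d j * ρ.trace := by
  simp only [Matrix.trace, Matrix.diag_apply, depolarize, Matrix.of_apply, if_true]
  rw [← (Equiv.piSplitAt j fun i => Fin (d i)).symm.sum_comp,
    ← (Equiv.piSplitAt j fun i => Fin (d i)).symm.sum_comp (fun x => ρ x x),
    Fintype.sum_prod_type, Fintype.sum_prod_type]
  have h : ∀ (b a : Fin (d j)) (x : ∀ i : {i // i ≠ j}, Fin (d i)),
      Function.update ((Equiv.piSplitAt j fun i => Fin (d i)).symm (b, x)) j a =
        (Equiv.piSplitAt j fun i => Fin (d i)).symm (a, x) := by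
    intro b a x
    ext i
    rcases eq_or_ne i j with rfl | h
    · simp [Equiv.piSplitAt]
    · simp [Equiv.piSplitAt, h]
  simp only [h, Finset.sum_const, Finset.card_univ, Fintype.card_fin, nsmul_eq_mul]
  rw [Finset.sum_comm]

lemma trace_partialTrace {m : Fin N → ℕ}
    (τ : Matrix (∀ i, Fin (m i + 1) → Fin (d i)) (∀ i, Fin (m i + 1) → Fin (d i)) ℂ) :
    (partialTrace τ).trace = τ.trace := by
  simp only [Matrix.trace, Matrix.diag_apply, partialTrace, Matrix.of_apply]
  rw [← Fintype.sum_prod_type']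
  let e : (∀ i, Fin (d i)) × (∀ i, Fin (m i) → Fin (d i)) ≃ (∀ i, Fin (m i + 1) → Fin (d i)) :=
    { toFun := fun p i => Fin.cons (p.1 i) (p.2 i)
      invFun := fun u => (fun i => u i 0, fun i => Fin.tail (u i))
      left_inv := fun p => by simp
      right_inv := fun u => by simp }
  exact e.sum_comp (fun u => τ u u)

/-- Every column of τ is the image of a basis vector and hence symmetric; Hermiticity carries this
over to the rows. -/
lemma isCopySymmetric_of_mulVec_mem {m : Fin N → ℕ}
    {τ : Matrix (∀ i, Fin (m i + 1) → Fin (d i)) (∀ i, Fin (m i + 1) → Fin (d i)) ℂ}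
    (hτ : τ.IsHermitian) (h : ∀ v, τ *ᵥ v ∈ symTensor (fun i => m i + 1) d) :
    IsCopySymmetric τ := by
  have h1 : ∀ Ψ ∈ symTensor (fun i => m i + 1) d, ∀ (π : ∀ i, Equiv.Perm (Fin (m i + 1))) u,
      Ψ (fun i => u i ∘ π i) = Ψ u := by
    intro Ψ hΨ π u
    induction hΨ using Submodule.span_induction with
    | mem x hx =>
      obtain ⟨ψ, hψ, rfl⟩ := hx
      exact Finset.prod_congr rfl fun i _ => hψ i (π i) (u i)
    | zero => rfl
    | add x y _ _ hx hy => simp [hx, hy]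
    | smul a x _ hx => simp [hx]
  have h2 : ∀ (π : ∀ i, Equiv.Perm (Fin (m i + 1))) u v, τ (fun i => u i ∘ π i) v = τ u v := by
    intro π u v
    have := h1 _ (h (Pi.single v 1)) π u
    simpa using this
  refine ⟨h2, fun π u v => ?_⟩
  rw [← hτ.apply, ← hτ.apply u v, h2]

/-- Separability after all parties but the last have been measured. -/
lemma contract_mem_sepCone {n : ℕ} {d m : Fin (n + 1) → ℕ}
    {τ : Matrix (∀ i, Fin (m i + 1) → Fin (d i)) (∀ i, Fin (m i + 1) → Fin (d i)) ℂ}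
    (hτ : τ.PosSemidef) :
    contract (fun i => if i.val < n then prepareKernel (m i) (d i) else
      traceKernel (m i) (d i)) τ ∈ sepCone d := by
  have hK : ∀ i : Fin (n + 1), ∃ (S : Type) (_ : Fintype S) (z : S → Fin (d i) → ℂ)
      (c : S → (Fin (m i + 1) → Fin (d i)) → ℂ) (A : S → Fin (d i) →
        (Fin (m i + 1) → Fin (d i)) → ℂ),
      ((if i.val < n then prepareKernel (m i) (d i) else traceKernel (m i) (d i)) =
        fun x y u v => ∑ s, A s x u * star (A s y v)) ∧
      (i.val < n → A = fun s x u => z s x * c s u) := by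
    intro i
    by_cases h : i.val < n
    · obtain ⟨S, hS, z, c, hz⟩ := exists_prepareKernel_eq (m i) (d i)
      exact ⟨S, hS, z, c, _, by rw [if_pos h, hz], fun _ => rfl⟩
    · obtain ⟨S, hS, A, hA⟩ := isPositiveKernel_traceKernel (m i) (d i)
      -- The last party has no factorised Kraus operators; z and c are dummies for it and are never
      -- used.
      exact ⟨S, hS, fun _ _ => 0, fun _ _ => 0, A, by rw [if_neg h, hA], fun h' => absurd h' h⟩
  choose S hS z c A hA hz using hK
  have hKeq : (fun i : Fin (n + 1) => if i.val < n then prepareKernel (m i) (d i) else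
      traceKernel (m i) (d i)) = fun i x y u v => ∑ s, A i s x u * star (A i s y v) := funext hA
  have hsum : contract (fun i : Fin (n + 1) => if i.val < n then prepareKernel (m i) (d i) else
      traceKernel (m i) (d i)) τ = ∑ s : ∀ i, S i, Matrix.of fun x y : ∀ i, Fin (d i) =>
        ∑ u, ∑ v, (∏ i, A i (s i) (x i) (u i) * star (A i (s i) (y i) (v i))) * τ u v := by
    ext x y
    rw [hKeq, contract_sum, Matrix.sum_apply]
    rfl
  rw [hsum]
  refine sepCone_sum _ fun s _ => ?_
  -- For a fixed joint outcome the first n parties contribute fixed vectors z and scalars c(u). The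
  -- scalars go into B, so that B τ Bᴴ is the unnormalised conditional operator of the last party;
  -- splitting it into rank-one terms yields product vectors.
  set B : Matrix (Fin (d (Fin.last n))) (∀ i, Fin (m i + 1) → Fin (d i)) ℂ :=
    Matrix.of fun a u => (∏ i : Fin n, c i.castSucc (s i.castSucc) (u i.castSucc)) *
      A (Fin.last n) (s (Fin.last n)) a (u (Fin.last n)) with hB
  obtain ⟨r, Q, hQ⟩ := Matrix.posSemidef_iff_eq_sum_vecMulVec.1
    (hτ.mul_mul_conjTranspose_same B)
  have key : (Matrix.of fun x y : ∀ i, Fin (d i) =>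
      ∑ u, ∑ v, (∏ i, A i (s i) (x i) (u i) * star (A i (s i) (y i) (v i))) * τ u v) =
      ∑ t, productProj (d := d) (Fin.snoc (α := fun i => EuclideanSpace ℂ (Fin (d i)))
        (fun i : Fin n => WithLp.toLp 2 (z i.castSucc (s i.castSucc)))
        (WithLp.toLp 2 (Q t))) := by
    ext x y
    have h1 : ∀ (i : Fin n) (a : Fin (d i.castSucc)) u, A i.castSucc (s i.castSucc) a u =
        z i.castSucc (s i.castSucc) a * c i.castSucc (s i.castSucc) u := fun i a u =>
      congrFun (congrFun (congrFun (hz i.castSucc (by simp)) _) a) u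
    have h2 := congrFun (congrFun hQ (x (Fin.last n))) (y (Fin.last n))
    simp only [Matrix.sum_apply, productProj, Matrix.of_apply, Fin.prod_univ_castSucc,
      Fin.snoc_castSucc, Fin.snoc_last, h1, ← Finset.mul_sum]
    simp only [Matrix.sum_apply, Matrix.vecMulVec_apply, Pi.star_apply] at h2
    rw [← h2]
    simp only [Matrix.mul_apply, Matrix.conjTranspose_apply, Finset.sum_mul, Finset.mul_sum]
    rw [Finset.sum_comm]
    refine Finset.sum_congr rfl fun v _ => Finset.sum_congr rfl fun u _ => ?_
    simp only [hB, Matrix.of_apply, star_mul, star_prod, Finset.prod_mul_distrib]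
    ring
  rw [key]
  exact sepCone_sum _ fun t _ => productProj_mem_sepCone _

/-- The first j parties are replaced one at a time. The difference is carried as A − B with both
parts positive, so that the errors add as traces; each step contributes (dρ − ρ')/(k + d), whose two
parts have trace d/(k + d). -/
lemma exists_sub_contract {m : Fin N → ℕ}
    {τ : Matrix (∀ i, Fin (m i + 1) → Fin (d i)) (∀ i, Fin (m i + 1) → Fin (d i)) ℂ}
    (hτ : IsState τ) (hs : IsCopySymmetric τ) (j : ℕ) (hj : j ≤ N) :
    (contract (fun i => if i.val < j then prepareKernel (m i) (d i) else
        traceKernel (m i) (d i)) τ).trace = 1 ∧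
      ∃ A B : Matrix (∀ i, Fin (d i)) (∀ i, Fin (d i)) ℂ, A.PosSemidef ∧ B.PosSemidef ∧
        partialTrace τ - contract (fun i => if i.val < j then prepareKernel (m i) (d i) else
          traceKernel (m i) (d i)) τ = A - B ∧
        A.trace.re + B.trace.re ≤
          2 * ∑ i : Fin N with i.val < j, (d i : ℝ) / ((m i + 1 : ℕ) : ℝ) := by
  induction j with
  | zero =>
    have h0 : contract (fun i : Fin N => if i.val < 0 then prepareKernel (m i) (d i) else
        traceKernel (m i) (d i)) τ = partialTrace τ := by
      rw [partialTrace_eq_contract]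
      simp
    refine ⟨by rw [h0, trace_partialTrace, hτ.2], 0, 0, Matrix.PosSemidef.zero,
      Matrix.PosSemidef.zero, by rw [h0, sub_self, sub_self], by simp⟩
  | succ j ih =>
    obtain ⟨htr, A, B, hA, hB, hAB, hle⟩ := ih (by omega)
    set ρ := contract (fun i : Fin N => if i.val < j then prepareKernel (m i) (d i) else
        traceKernel (m i) (d i)) τ with hρ
    set j' : Fin N := ⟨j, hj⟩ with hj'
    have hjv : j'.val = j := rfl
    have hρp : ρ.PosSemidef := posSemidef_contract (fun i => by
      split_ifs
      · exact isPositiveKernel_prepareKernel _ _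
      · exact isPositiveKernel_traceKernel _ _) hτ.1
    have hstep := contract_update_prepareKernel hs j'
      (K := fun i : Fin N => if i.val < j then prepareKernel (m i) (d i) else
        traceKernel (m i) (d i))
      (K' := fun i : Fin N => if i.val < j + 1 then prepareKernel (m i) (d i) else
        traceKernel (m i) (d i)) (by simp [hj']) (by simp [hj']) (fun i hi => by
          have : i.val ≠ j := fun h => hi (Fin.ext h)
          have h2 : i.val < j + 1 ↔ i.val < j := by omega
          simp only [h2])
    rw [hstep, ← hρ]
    set r : ℝ := ((m j' + 1 + d j' : ℕ) : ℝ)⁻¹ with hr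
    have hr0 : 0 ≤ r := by positivity
    have hrc : ((m j' + 1 + d j' : ℕ) : ℂ)⁻¹ = (r : ℂ) := by rw [hr]; push_cast; rfl
    have hne : ((m j' + 1 + d j' : ℕ) : ℂ) ≠ 0 := Nat.cast_ne_zero.2 (by omega)
    have htρ : (depolarize j' ρ).trace = d j' := by rw [trace_depolarize, htr, mul_one]
    refine ⟨?_, A + (r * d j') • ρ, B + r • depolarize j' ρ,
      hA.add (hρp.smul (by positivity)), hB.add ((posSemidef_depolarize hρp j').smul hr0), ?_, ?_⟩
    · rw [Matrix.trace_smul, Matrix.trace_add, Matrix.trace_smul, htr, htρ, smul_eq_mul,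
        smul_eq_mul, mul_one, inv_mul_eq_one₀ hne]
      push_cast
      ring
    · have h1 : ρ - ((m j' + 1 + d j' : ℕ) : ℂ)⁻¹ • (depolarize j' ρ + ((m j' + 1 : ℕ) : ℂ) • ρ) =
          (r * d j') • ρ - r • depolarize j' ρ := by
        ext x y
        simp only [Matrix.sub_apply, Matrix.smul_apply, Matrix.add_apply, smul_eq_mul,
          Complex.real_smul, Complex.ofReal_mul, Complex.ofReal_natCast, ← hrc]
        push_cast at hne ⊢
        field_simp
        ring
      rw [← sub_add_sub_cancel _ ρ, hAB, h1]
      abel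
    · have hins : (Finset.univ.filter fun i : Fin N => i.val < j + 1) =
          insert j' (Finset.univ.filter fun i : Fin N => i.val < j) := by
        ext i
        simp only [Finset.mem_filter, Finset.mem_univ, true_and, Finset.mem_insert, Fin.ext_iff, hjv]
        omega
      rw [hins, Finset.sum_insert (by simp [hj']), Matrix.trace_add, Matrix.trace_add,
        Matrix.trace_smul, Matrix.trace_smul, htr, htρ]
      simp only [Complex.add_re, Complex.real_smul, mul_one, Complex.ofReal_re]
      have h3 : ((r : ℂ) * (d j' : ℂ)).re = r * d j' := by
        rw [← Complex.ofReal_natCast, ← Complex.ofReal_mul, Complex.ofReal_re]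
      rw [h3]
      have h2 : r * d j' ≤ (d j' : ℝ) / ((m j' + 1 : ℕ) : ℝ) := by
        rw [hr, inv_mul_eq_div]
        exact div_le_div_of_nonneg_left (by positivity) (by positivity)
          (by exact_mod_cast Nat.le_add_right _ _)
      linarith

lemma exists_separable_near {d k : Fin N → ℕ} {ρ : Matrix (∀ i, Fin (d i)) (∀ i, Fin (d i)) ℂ}
    (hρ : ρ ∈ extendible d k) :
    ∃ σ ∈ separable d, traceNorm (ρ - σ) ≤
      2 * ∑ i : Fin N with i.val + 1 < N, (d i : ℝ) / (k i : ℝ) := by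
  obtain ⟨m, hk, τ, hτ, hsym, rfl⟩ := hρ
  have hs := isCopySymmetric_of_mulVec_mem hτ.1.1 hsym
  rcases N with _ | n
  -- Without parties the only state is the number 1, an empty product.
  · refine ⟨partialTrace τ, ?_, ?_⟩
    · have h := productProj_mem_sepCone (d := d) (fun i => i.elim0)
      have h1 : partialTrace τ = productProj (d := d) (fun i => i.elim0) := by
        have ht := (trace_partialTrace τ).trans hτ.2
        ext x y
        rw [Matrix.trace, Fintype.sum_unique, Matrix.diag_apply] at ht
        rw [Subsingleton.elim x default, Subsingleton.elim y default, ht]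
        simp [productProj]
      have := inv_trace_smul_mem_separable (h1 ▸ h) (t := 1)
        (by rw [trace_partialTrace, hτ.2]; simp) one_ne_zero
      simpa using this
    · have := traceNorm_sub_le (Matrix.PosSemidef.zero (n := ∀ i, Fin (d i)) (R := ℂ))
        (Matrix.PosSemidef.zero)
      simpa using this
  -- Of the n + 1 parties only n are measured, so the last one is missing from the sum.
  · obtain ⟨htr, A, B, hA, hB, hAB, hle⟩ := exists_sub_contract hτ hs n (Nat.le_succ n)
    refine ⟨_, ?_, (hAB ▸ traceNorm_sub_le hA hB).trans (hle.trans_eq ?_)⟩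
    · have := inv_trace_smul_mem_separable (contract_mem_sepCone hτ.1) (t := 1)
        (by rw [htr]; simp) one_ne_zero
      simpa using this
    · simp only [hk, Nat.add_lt_add_iff_right]

/-- The decomposition of a positive matrix into rank-one terms. One party has to be treated apart,
since log(N/ε) vanishes for N = 1 and ε = 1. -/
lemma mem_separable_of_one_party {d : Fin 1 → ℕ}
    {ρ : Matrix (∀ i, Fin (d i)) (∀ i, Fin (d i)) ℂ} (hρ : IsState ρ) : ρ ∈ separable d := by
  obtain ⟨r, Q, hQ⟩ := Matrix.posSemidef_iff_eq_sum_vecMulVec.1 hρ.1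
  have key : ρ = ∑ t, productProj (d := d) (fun i => WithLp.toLp 2 fun a =>
      Q t (fun j => Fin.cast (by rw [Subsingleton.elim i j]) a)) := by
    ext x y
    rw [hQ]
    simp only [Matrix.sum_apply, productProj, Matrix.of_apply, Matrix.vecMulVec_apply,
      Pi.star_apply, Finset.univ_unique, Finset.prod_singleton]
    refine Finset.sum_congr rfl fun t _ => ?_
    congr 2 <;> congr 1 <;> ext i <;> rw [Subsingleton.elim i default] <;> simp
  have h : ρ ∈ sepCone d := by
    rw [key]
    exact sepCone_sum _ fun t _ => productProj_mem_sepCone _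
  simpa using inv_trace_smul_mem_separable h (t := 1) (by rw [hρ.2]; simp) one_ne_zero

end Extendible

/-! ### Linear functionals on product states -/

section Net

variable {N : ℕ} {d : Fin N → ℕ}

lemma productProj_update_apply (φ : ∀ i, EuclideanSpace ℂ (Fin (d i))) (j : Fin N)
    (v : EuclideanSpace ℂ (Fin (d j))) (x y : ∀ i, Fin (d i)) :
    productProj (Function.update φ j v) x y = (v (x j) * star (v (y j))) *
      ∏ i ∈ Finset.univ.erase j, (φ i (x i) * star (φ i (y i))) := by
  rw [productProj, Matrix.of_apply, ← Finset.mul_prod_erase _ _ (Finset.mem_univ j)]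
  congr 1
  · simp
  · refine Finset.prod_congr rfl fun i hi => ?_
    rw [Function.update_of_ne (Finset.ne_of_mem_erase hi)]

lemma productProj_update_smul (φ : ∀ i, EuclideanSpace ℂ (Fin (d i))) (j : Fin N) (c : ℝ)
    (v : EuclideanSpace ℂ (Fin (d j))) :
    productProj (Function.update φ j (c • v)) = c ^ 2 • productProj (Function.update φ j v) := by
  ext x y
  rw [Matrix.smul_apply, productProj_update_apply, productProj_update_apply]
  simp only [PiLp.smul_apply, Complex.real_smul]
  have : star (c : ℂ) = (c : ℂ) := Complex.conj_ofReal _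
  rw [star_mul, this]
  push_cast
  ring

/-- In the vector of party j the projection is a quadratic form q, and q(x + y) − q(x − y) is four
times the real part of its polar form. With x = (a − b)/c and y = c(a + b) the scaling by c cancels.
-/
lemma productProj_polarization (φ : ∀ i, EuclideanSpace ℂ (Fin (d i))) (j : Fin N) {c : ℝ}
    (hc : c ≠ 0) (a b : EuclideanSpace ℂ (Fin (d j))) :
    productProj (Function.update φ j (c⁻¹ • (a - b) + c • (a + b))) -
      productProj (Function.update φ j (c⁻¹ • (a - b) - c • (a + b))) =
    (4 : ℝ) • (productProj (Function.update φ j a) - productProj (Function.update φ j b)) := by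
  ext x y
  simp only [Matrix.sub_apply, Matrix.smul_apply, productProj_update_apply, PiLp.add_apply,
    PiLp.sub_apply, PiLp.smul_apply, Complex.real_smul, star_add, star_sub, star_mul]
  have h1 : star (c : ℂ) = (c : ℂ) := Complex.conj_ofReal _
  have h2 : star ((c⁻¹ : ℝ) : ℂ) = (c : ℂ)⁻¹ := by
    rw [← Complex.ofReal_inv]; exact Complex.conj_ofReal _
  rw [h1, h2]
  have hc' : (c : ℂ) ≠ 0 := Complex.ofReal_ne_zero.2 hc
  push_cast
  field_simp
  ring

/-- Vectors a, b of equal length have a − b and a + b orthogonal for the real inner product. -/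
lemma norm_sq_polarization {E : Type*} [NormedAddCommGroup E] [InnerProductSpace ℂ E] {a b : E}
    (h : ‖a‖ = ‖b‖) (c : ℝ) :
    ‖c⁻¹ • (a - b) + c • (a + b)‖ ^ 2 = (c ^ 2)⁻¹ * ‖a - b‖ ^ 2 + c ^ 2 * ‖a + b‖ ^ 2 ∧
    ‖c⁻¹ • (a - b) - c • (a + b)‖ ^ 2 = (c ^ 2)⁻¹ * ‖a - b‖ ^ 2 + c ^ 2 * ‖a + b‖ ^ 2 := by
  let _ : InnerProductSpace ℝ E := InnerProductSpace.rclikeToReal ℂ E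
  have h0 : inner ℝ (c⁻¹ • (a - b)) (c • (a + b)) = 0 := by
    rw [inner_smul_left, inner_smul_right, real_inner_comm,
      (real_inner_add_sub_eq_zero_iff a b).2 h]
    simp
  rw [norm_add_sq_real, norm_sub_sq_real (c⁻¹ • (a - b)), h0, norm_smul, norm_smul, mul_pow, mul_pow,
    Real.norm_eq_abs, Real.norm_eq_abs, sq_abs, sq_abs, inv_pow]
  constructor <;> ring

/-- By polarization 4(q(a) − q(b)) = q(u) − q(w), where u and w have the same squared length δ⁻¹‖a −
b‖² + δ‖a + b‖² ≤ 5δ for c = √δ. The form q lies between m‖·‖² and M‖·‖², so the difference is at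
most 5δ(M − m). What matters is that the Lipschitz constant involves only the range M − m. -/
lemma abs_sub_update_le (f : Matrix (∀ i, Fin (d i)) (∀ i, Fin (d i)) ℂ →ₗ[ℝ] ℝ) {m M δ : ℝ}
    (hδ : 0 < δ) (hm : ∀ φ : ∀ i, EuclideanSpace ℂ (Fin (d i)), (∀ i, ‖φ i‖ = 1) →
      m ≤ f (productProj φ))
    (hM : ∀ φ : ∀ i, EuclideanSpace ℂ (Fin (d i)), (∀ i, ‖φ i‖ = 1) → f (productProj φ) ≤ M)
    {φ : ∀ i, EuclideanSpace ℂ (Fin (d i))} (hφ : ∀ i, ‖φ i‖ = 1) (j : Fin N)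
    {a b : EuclideanSpace ℂ (Fin (d j))} (ha : ‖a‖ = 1) (hb : ‖b‖ = 1) (hab : ‖a - b‖ ≤ δ) :
    f (productProj (Function.update φ j a)) - f (productProj (Function.update φ j b)) ≤
      5 / 4 * δ * (M - m) := by
  have hunit : ∀ v : EuclideanSpace ℂ (Fin (d j)), ‖v‖ = 1 →
      ∀ i, ‖Function.update φ j v i‖ = 1 := by
    intro v hv i
    rcases eq_or_ne i j with rfl | h
    · simpa using hv
    · simpa [h] using hφ i
  have hQ : ∀ v : EuclideanSpace ℂ (Fin (d j)), m * ‖v‖ ^ 2 ≤ f (productProj (Function.update φ j v))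
      ∧ f (productProj (Function.update φ j v)) ≤ M * ‖v‖ ^ 2 := by
    intro v
    rcases eq_or_ne v 0 with rfl | hv
    · have := productProj_update_smul φ j 0 (0 : EuclideanSpace ℂ (Fin (d j)))
      rw [zero_smul] at this
      rw [this]
      simp
    · have hv0 : ‖v‖ ≠ 0 := norm_ne_zero_iff.2 hv
      have h1 : ‖‖v‖⁻¹ • v‖ = 1 := by
        rw [norm_smul, norm_inv, norm_norm, inv_mul_cancel₀ hv0]
      have h2 : v = ‖v‖ • (‖v‖⁻¹ • v) := by rw [smul_smul, mul_inv_cancel₀ hv0, one_smul]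
      have h3 := productProj_update_smul φ j ‖v‖ (‖v‖⁻¹ • v)
      rw [← h2] at h3
      rw [h3, map_smul, smul_eq_mul, mul_comm m, mul_comm M]
      exact ⟨mul_le_mul_of_nonneg_left (hm _ (hunit _ h1)) (by positivity),
        mul_le_mul_of_nonneg_left (hM _ (hunit _ h1)) (by positivity)⟩
  have hc : √δ ≠ 0 := (Real.sqrt_pos.2 hδ).ne'
  have hp := congrArg f (productProj_polarization φ j hc a b)
  rw [map_sub, map_smul, map_sub, smul_eq_mul] at hp
  obtain ⟨n1, n2⟩ := norm_sq_polarization (ha.trans hb.symm) (√δ)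
  rw [Real.sq_sqrt hδ.le] at n1 n2
  have q1 := (hQ ((√δ)⁻¹ • (a - b) + √δ • (a + b))).2
  have q2 := (hQ ((√δ)⁻¹ • (a - b) - √δ • (a + b))).1
  rw [n1] at q1
  rw [n2] at q2
  have hmM : m ≤ M := (hm φ hφ).trans (hM φ hφ)
  have hs : δ⁻¹ * ‖a - b‖ ^ 2 + δ * ‖a + b‖ ^ 2 ≤ 5 * δ := by
    have h1 : δ⁻¹ * ‖a - b‖ ^ 2 ≤ δ⁻¹ * δ ^ 2 := by gcongr
    have h2 : ‖a + b‖ ≤ 2 := (norm_add_le a b).trans (by rw [ha, hb]; norm_num)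
    have h3 : δ * ‖a + b‖ ^ 2 ≤ δ * 2 ^ 2 := by gcongr
    have h4 : δ⁻¹ * δ ^ 2 = δ := by field_simp
    linarith
  nlinarith [mul_le_mul_of_nonneg_right hs (sub_nonneg.2 hmM)]

/-- Hybrid argument: the vectors are exchanged party by party. -/
lemma sub_productProj_le (f : Matrix (∀ i, Fin (d i)) (∀ i, Fin (d i)) ℂ →ₗ[ℝ] ℝ) {m M δ : ℝ}
    (hδ : 0 < δ) (hm : ∀ φ : ∀ i, EuclideanSpace ℂ (Fin (d i)), (∀ i, ‖φ i‖ = 1) →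
      m ≤ f (productProj φ))
    (hM : ∀ φ : ∀ i, EuclideanSpace ℂ (Fin (d i)), (∀ i, ‖φ i‖ = 1) → f (productProj φ) ≤ M)
    {φ ψ : ∀ i, EuclideanSpace ℂ (Fin (d i))} (hφ : ∀ i, ‖φ i‖ = 1) (hψ : ∀ i, ‖ψ i‖ = 1)
    (h : ∀ i, ‖φ i - ψ i‖ ≤ δ) :
    f (productProj φ) - f (productProj ψ) ≤ N * (5 / 4 * δ * (M - m)) := by
  have key : ∀ k ≤ N, f (productProj φ) -
      f (productProj fun i => if i.val < k then ψ i else φ i) ≤ k * (5 / 4 * δ * (M - m)) := by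
    intro k hk
    induction k with
    | zero => simp
    | succ k ih =>
      have h1 := ih (by omega)
      set χ : ∀ i, EuclideanSpace ℂ (Fin (d i)) := fun i => if i.val < k then ψ i else φ i with hχ
      set j : Fin N := ⟨k, hk⟩ with hj
      have hjv : j.val = k := rfl
      have hχ1 : ∀ i, ‖χ i‖ = 1 := fun i => by
        simp only [hχ]; split_ifs <;> simp [hφ, hψ]
      have h2 : (fun i : Fin N => if i.val < k + 1 then ψ i else φ i) =
          Function.update χ j (ψ j) := by
        ext1 i
        rcases eq_or_ne i j with rfl | hij
        · simp [hjv]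
        · have : i.val ≠ k := fun h => hij (Fin.ext h)
          have h3 : i.val < k + 1 ↔ i.val < k := by omega
          simp [hij, hχ, h3]
      have h4 : χ = Function.update χ j (φ j) := by
        rw [eq_comm, Function.update_eq_self_iff]
        simp [hχ, hjv]
      have h5 := abs_sub_update_le f hδ hm hM hχ1 j (hφ j) (hψ j) (h j)
      rw [← h4, ← h2] at h5
      push_cast
      linarith
  have := key N le_rfl
  simpa using this

/-- The vectors with the given Gaussian integers as coordinates. -/
noncomputable def gaussVec {N d : ℕ} (g : Fin N → Fin d → GaussianInt) :
    ∀ _ : Fin N, EuclideanSpace ℂ (Fin d) :=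
  fun i => WithLp.toLp 2 fun a => GaussianInt.toComplex (g i a)

/-- Scale by K = κ√d and round every real coordinate. The error is at most √(d/2) ≤ (3/4)√d, and
normalising adds at most as much again, so the relative error is below 2/κ. The factor √d is what
makes the precision independent of the dimension. -/
lemma exists_round {d : ℕ} (hd : 0 < d) {κ : ℕ} (hκ : 0 < κ) {v : EuclideanSpace ℂ (Fin d)}
    (hv : ‖v‖ = 1) : ∃ g : Fin d → GaussianInt,
      (WithLp.toLp 2 fun a => GaussianInt.toComplex (g a) : EuclideanSpace ℂ (Fin d)) ≠ 0 ∧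
      ‖v - ‖(WithLp.toLp 2 fun a => GaussianInt.toComplex (g a) :
          EuclideanSpace ℂ (Fin d))‖⁻¹ •
        (WithLp.toLp 2 fun a => GaussianInt.toComplex (g a) : EuclideanSpace ℂ (Fin d))‖ ≤ 2 / κ ∧
      ‖(WithLp.toLp 2 fun a => GaussianInt.toComplex (g a) : EuclideanSpace ℂ (Fin d))‖ ^ 2 ≤
        (κ + 1) ^ 2 * d := by
  set K : ℝ := κ * √d with hK
  set g : Fin d → GaussianInt := fun a => ⟨round (K * (v a).re), round (K * (v a).im)⟩ with hg
  set G : EuclideanSpace ℂ (Fin d) := WithLp.toLp 2 fun a => GaussianInt.toComplex (g a) with hG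
  have hκ1 : (1 : ℝ) ≤ κ := by exact_mod_cast hκ
  have hd1 : (1 : ℝ) ≤ d := by exact_mod_cast hd
  have hsd : 0 < √(d : ℝ) := Real.sqrt_pos.2 (by linarith)
  have hsq : √(d : ℝ) ^ 2 = d := Real.sq_sqrt (by linarith)
  have hK0 : 0 < K := by positivity
  have hdist : ‖G - K • v‖ ^ 2 ≤ d / 2 := by
    rw [EuclideanSpace.norm_sq_eq]
    calc _ ≤ ∑ _a : Fin d, (1 / 2 : ℝ) := by
          refine Finset.sum_le_sum fun a _ => ?_
          rw [← Complex.normSq_eq_norm_sq, Complex.normSq_apply]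
          simp only [PiLp.sub_apply, PiLp.smul_apply, Complex.real_smul, hG, Complex.sub_re,
            Complex.sub_im, Complex.re_ofReal_mul, Complex.im_ofReal_mul,
            GaussianInt.re_toComplex, GaussianInt.im_toComplex, hg]
          have h1 := abs_sub_round (K * (v a).re)
          have h2 := abs_sub_round (K * (v a).im)
          rw [abs_le] at h1 h2
          nlinarith
      _ = d / 2 := by simp; ring
  have hdist2 : ‖G - K • v‖ ≤ 3 / 4 * √d := by
    refine abs_le_of_sq_le_sq' ?_ (by positivity) |>.2
    rw [mul_pow, hsq]
    linarith
  have hKv : ‖K • v‖ = K := by rw [norm_smul, hv, mul_one, Real.norm_of_nonneg hK0.le]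
  have hn1 : ‖G‖ ≤ K + 3 / 4 * √d := by
    have := norm_add_le (G - K • v) (K • v)
    rw [sub_add_cancel, hKv] at this
    linarith
  have hn2 : K - 3 / 4 * √d ≤ ‖G‖ := by
    have := norm_sub_norm_le (K • v) G
    rw [hKv, norm_sub_rev] at this
    linarith
  have hKd : √d ≤ K := le_mul_of_one_le_left hsd.le hκ1
  have hG0 : 0 < ‖G‖ := by linarith
  refine ⟨g, norm_pos_iff.1 hG0, ?_, ?_⟩
  · have h1 : v - ‖G‖⁻¹ • G = K⁻¹ • ((K • v - G) + (1 - K * ‖G‖⁻¹) • G) := by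
      rw [smul_add, smul_sub, smul_smul, smul_smul, inv_mul_cancel₀ hK0.ne', one_smul, mul_sub,
        mul_one, ← mul_assoc, inv_mul_cancel₀ hK0.ne', one_mul, sub_smul]
      abel
    have h2 : ‖(1 - K * ‖G‖⁻¹) • G‖ ≤ 3 / 4 * √d := by
      rw [norm_smul, Real.norm_eq_abs]
      have : |1 - K * ‖G‖⁻¹| * ‖G‖ = |‖G‖ - K| := by
        rw [← abs_of_pos hG0, ← abs_mul, abs_of_pos hG0, sub_mul, mul_assoc,
          inv_mul_cancel₀ hG0.ne', one_mul, mul_one]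
      rw [this, abs_le]
      constructor <;> linarith
    rw [h1, norm_smul, norm_inv, Real.norm_of_nonneg hK0.le, inv_mul_le_iff₀ hK0]
    have h3 : K * (2 / κ) = 2 * √d := by rw [hK]; field_simp
    rw [h3]
    have h4 := norm_add_le (K • v - G) ((1 - K * ‖G‖⁻¹) • G)
    rw [norm_sub_rev] at h4
    linarith
  · have : ‖G‖ ≤ (κ + 1) * √d := by rw [add_mul, one_mul, ← hK]; linarith
    calc ‖G‖ ^ 2 ≤ ((κ + 1) * √d) ^ 2 := by gcongr
      _ = _ := by rw [mul_pow, hsq]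

/-- Near every unit product vector there is the direction of one with small integral
coordinates, on which a linear functional has nearly the same value. -/
lemma exists_gaussVec_near {N d : ℕ} (hN : 0 < N) (hd : 0 < d) {h : ℕ} (hh : 0 < h)
    (f : Matrix (Fin N → Fin d) (Fin N → Fin d) ℂ →ₗ[ℝ] ℝ) {m M : ℝ}
    (hm : ∀ φ : ∀ _ : Fin N, EuclideanSpace ℂ (Fin d), (∀ i, ‖φ i‖ = 1) →
      m ≤ f (productProj φ))
    (hM : ∀ φ : ∀ _ : Fin N, EuclideanSpace ℂ (Fin d), (∀ i, ‖φ i‖ = 1) →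
      f (productProj φ) ≤ M)
    {φ : ∀ _ : Fin N, EuclideanSpace ℂ (Fin d)} (hφ : ∀ i, ‖φ i‖ = 1) :
    ∃ g : Fin N → Fin d → GaussianInt, 0 < ∏ i, ‖gaussVec g i‖ ^ 2 ∧
      (∀ i, ‖gaussVec g i‖ ^ 2 ≤ ((8 * N * h : ℕ) + 1) ^ 2 * d) ∧
      |(∏ i, ‖gaussVec g i‖ ^ 2) * f (productProj φ) - f (productProj (gaussVec g))| ≤
        (∏ i, ‖gaussVec g i‖ ^ 2) * (5 / (16 * h) * (M - m)) := by
  -- With κ = 8Nh the deviation is N · (5/4) · (2/κ) = 5/(16h) times the range.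
  choose g hg0 hg1 hg2 using fun i => exists_round hd (κ := 8 * N * h) (by positivity) (hφ i)
  have hne : ∀ i, gaussVec g i ≠ 0 := hg0
  have hn0 : ∀ i, ‖gaussVec g i‖ ≠ 0 := fun i => norm_ne_zero_iff.2 (hne i)
  have hpos : 0 < ∏ i, ‖gaussVec g i‖ ^ 2 := Finset.prod_pos fun i _ => by
    have := hn0 i; positivity
  set ψ : ∀ _ : Fin N, EuclideanSpace ℂ (Fin d) :=
    fun i => ‖gaussVec g i‖⁻¹ • gaussVec g i with hψ
  have hψ1 : ∀ i, ‖ψ i‖ = 1 := fun i => by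
    rw [hψ, norm_smul, norm_inv, norm_norm, inv_mul_cancel₀ (hn0 i)]
  have hG : productProj (gaussVec g) = (∏ i, ‖gaussVec g i‖ ^ 2) • productProj ψ := by
    rw [← productProj_smul]
    congr 1
    ext1 i
    rw [hψ, smul_smul, mul_inv_cancel₀ (hn0 i), one_smul]
  have hδ : (0 : ℝ) < 2 / (8 * N * h : ℕ) := by positivity
  have e1 := sub_productProj_le f hδ hm hM hφ hψ1 hg1
  have e2 := sub_productProj_le f hδ hm hM hψ1 hφ (fun i => by
    rw [norm_sub_rev]; exact hg1 i)
  have e3 : (N : ℝ) * (5 / 4 * (2 / (8 * N * h : ℕ)) * (M - m)) = 5 / (16 * h) * (M - m) := by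
    push_cast
    have : (N : ℝ) ≠ 0 := by positivity
    field_simp
    ring
  rw [e3] at e1 e2
  refine ⟨g, hpos, hg2, ?_⟩
  rw [hG, map_smul, smul_eq_mul, ← mul_sub, abs_mul, abs_of_pos hpos]
  refine mul_le_mul_of_nonneg_left (abs_le.2 ⟨?_, ?_⟩) hpos.le <;> linarith

lemma continuous_productProj : Continuous (productProj (d := d)) := by
  refine continuous_matrix fun x y => ?_
  simp only [productProj, Matrix.of_apply]
  fun_prop

/-- For every linear functional there are two product vectors with small integral coordinates
whose signed combination separates no separable state from below. -/
lemma exists_gaussVec_pair {N d : ℕ} (hN : 0 < N) (hd : 0 < d) {h : ℕ} (hh : 0 < h)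
    {ρ : Matrix (Fin N → Fin d) (Fin N → Fin d) ℂ} (hρ : ρ ∈ separable (fun _ : Fin N => d))
    (f : Matrix (Fin N → Fin d) (Fin N → Fin d) ℂ →ₗ[ℝ] ℝ) :
    ∃ g : Fin 2 → Fin N → Fin d → GaussianInt,
      (∀ c, 0 < ∏ i, ‖gaussVec (g c) i‖ ^ 2) ∧
      (∀ c i, ‖gaussVec (g c) i‖ ^ 2 ≤ ((8 * N * h : ℕ) + 1) ^ 2 * d) ∧
      (h + 1) * (∏ i, ‖gaussVec (g 1) i‖ ^ 2) * f (productProj (gaussVec (g 0))) -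
        (∏ i, ‖gaussVec (g 0) i‖ ^ 2) * f (productProj (gaussVec (g 1))) ≤
        h * (∏ i, ‖gaussVec (g 0) i‖ ^ 2) * (∏ i, ‖gaussVec (g 1) i‖ ^ 2) * f ρ := by
  have : Nonempty (Fin d) := ⟨⟨0, hd⟩⟩
  set S : Set (∀ _ : Fin N, EuclideanSpace ℂ (Fin d)) :=
    Set.univ.pi fun _ => Metric.sphere 0 1 with hS
  have hSc : IsCompact S := isCompact_univ_pi fun _ => isCompact_sphere 0 1
  have hSne : S.Nonempty :=
    ⟨fun _ => EuclideanSpace.single ⟨0, hd⟩ 1, by simp [hS]⟩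
  have hmem : ∀ φ : ∀ _ : Fin N, EuclideanSpace ℂ (Fin d), φ ∈ S ↔ ∀ i, ‖φ i‖ = 1 := fun φ => by
    simp [hS]
  have hcont : Continuous fun φ : ∀ _ : Fin N, EuclideanSpace ℂ (Fin d) => f (productProj φ) :=
    f.continuous_of_finiteDimensional.comp continuous_productProj
  obtain ⟨φ, hφS, hφ⟩ := hSc.exists_isMinOn hSne hcont.continuousOn
  obtain ⟨ψ, hψS, hψ⟩ := hSc.exists_isMaxOn hSne hcont.continuousOn
  have hm : ∀ χ : ∀ _ : Fin N, EuclideanSpace ℂ (Fin d), (∀ i, ‖χ i‖ = 1) →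
      f (productProj φ) ≤ f (productProj χ) := fun χ hχ => hφ ((hmem χ).2 hχ)
  have hM : ∀ χ : ∀ _ : Fin N, EuclideanSpace ℂ (Fin d), (∀ i, ‖χ i‖ = 1) →
      f (productProj χ) ≤ f (productProj ψ) := fun χ hχ => hψ ((hmem χ).2 hχ)
  have hρm : f (productProj φ) ≤ f ρ := by
    have hc : Convex ℝ {σ : Matrix (Fin N → Fin d) (Fin N → Fin d) ℂ |
        f (productProj φ) ≤ f σ} := convex_halfSpace_ge f.isLinear _
    refine convexHull_min ?_ hc hρ
    rintro _ ⟨χ, hχ, rfl⟩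
    exact hm χ hχ
  obtain ⟨g0, p0, b0, e0⟩ := exists_gaussVec_near hN hd hh f hm hM ((hmem φ).1 hφS)
  obtain ⟨g1, p1, b1, e1⟩ := exists_gaussVec_near hN hd hh f hm hM ((hmem ψ).1 hψS)
  refine ⟨![g0, g1], fun c => by fin_cases c <;> assumption,
    fun c => by fin_cases c <;> assumption, ?_⟩
  simp only [Matrix.cons_val_zero, Matrix.cons_val_one]
  have hh1 : (1 : ℝ) ≤ h := by exact_mod_cast hh
  have hO : 0 ≤ f (productProj ψ) - f (productProj φ) :=
    sub_nonneg.2 (hm ψ ((hmem ψ).1 hψS))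
  generalize hn0 : ∏ i, ‖gaussVec g0 i‖ ^ 2 = n0 at *
  generalize hn1 : ∏ i, ‖gaussVec g1 i‖ ^ 2 = n1 at *
  generalize f (productProj φ) = m at *
  generalize f (productProj ψ) = M at *
  have a0 := (abs_le.1 e0).1
  have a1 := (abs_le.1 e1).2
  set η : ℝ := 5 / (16 * h) with hη
  have hηh : η * h = 5 / 16 := by rw [hη]; field_simp
  have hη1 : η ≤ 5 / 16 := by
    rw [hη, div_le_div_iff₀ (by positivity) (by norm_num)]; nlinarith
  have s0 : (h + 1) * n1 * f (productProj (gaussVec g0)) ≤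
      (h + 1) * n1 * (n0 * m + n0 * (η * (M - m))) := by
    refine mul_le_mul_of_nonneg_left ?_ (by positivity)
    linarith
  have s1 : n0 * (n1 * M - n1 * (η * (M - m))) ≤ n0 * f (productProj (gaussVec g1)) := by
    refine mul_le_mul_of_nonneg_left ?_ p0.le
    linarith
  have s2 : h * n0 * n1 * m ≤ h * n0 * n1 * f ρ :=
    mul_le_mul_of_nonneg_left hρm (by positivity)
  -- The two rounding errors sum to (h + 2)η(M − m) with (h + 2)η ≤ 15/16; they are paid for by the
  -- gain M − m from subtracting the maximiser.
  have s3 : 0 ≤ (n0 * n1) * ((1 - η * h - 2 * η) * (M - m)) :=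
    mul_nonneg (by positivity) (mul_nonneg (by rw [hηh]; linarith) hO)
  nlinarith

end Net

/-! ### Counting steps instead of bit operations -/

/-- A size of expressions that controls the bit length of their values. -/
def Expr.size : Expr → ℕ
  | lit z => bits z
  | load a => a.size + 1
  | add a b => a.size + b.size
  | sub a b => a.size + b.size
  | mul a b => a.size + b.size
  | div a b => a.size + b.size

/-- The largest size of the expressions of an elementary step of a program. -/
def Program.width : Program → ℕ
  | skip => 1
  | store a e => a.size + e.size
  | seq c c' => max c.width c'.width
  | cond e c c' => max e.size (max c.width c'.width)
  | loop e c => max e.size c.width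

lemma bits_pos (z : ℤ) : 0 < bits z := Nat.succ_pos _

lemma Expr.size_pos : ∀ e : Expr, 0 < e.size
  | lit z => bits_pos z
  | load _ => Nat.succ_pos _
  | add a _ => Nat.add_pos_left a.size_pos _
  | sub a _ => Nat.add_pos_left a.size_pos _
  | mul a _ => Nat.add_pos_left a.size_pos _
  | div a _ => Nat.add_pos_left a.size_pos _

lemma bits_le {z : ℤ} {L n : ℕ} (hL : 0 < L) (hn : 0 < n) (h : z.natAbs ≤ 2 ^ (L * n)) :
    bits z ≤ 3 * L * n := by
  have h1 : z.natAbs.size ≤ L * n + 1 :=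
    Nat.size_le.2 (h.trans_lt (Nat.pow_lt_pow_right (by norm_num) (by omega)))
  have h2 : 1 ≤ L * n := Nat.mul_pos hL hn
  unfold bits
  nlinarith

/-- Arithmetic at most adds bit lengths, and a load falls back to the bound L for cells. -/
lemma Expr.natAbs_eval_le {s : Mem} {L : ℕ} (hL : 0 < L) (hs : ∀ a, (s a).natAbs ≤ 2 ^ L) :
    ∀ e : Expr, (e.eval s).natAbs ≤ 2 ^ (L * e.size) := by
  have hadd : ∀ {x y a b : ℕ}, x ≤ 2 ^ (L * a) → y ≤ 2 ^ (L * b) → 0 < a → 0 < b →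
      x + y ≤ 2 ^ (L * (a + b)) := by
    intro x y a b hx hy ha hb
    rw [mul_add, pow_add]
    have h1 : 2 ≤ 2 ^ (L * a) := Nat.le_self_pow (Nat.mul_pos hL ha).ne' 2
    have h2 : 2 ≤ 2 ^ (L * b) := Nat.le_self_pow (Nat.mul_pos hL hb).ne' 2
    nlinarith
  intro e
  induction e with
  | lit z =>
    have h1 : z.natAbs < 2 ^ z.natAbs.size := Nat.lt_size_self _
    refine h1.le.trans (Nat.pow_le_pow_right (by norm_num) ?_)
    have : z.natAbs.size ≤ bits z := Nat.le_succ _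
    simp only [Expr.size]
    nlinarith
  | load a _ =>
    refine (hs _).trans (Nat.pow_le_pow_right (by norm_num) ?_)
    simp only [Expr.size]
    nlinarith
  | add a b iha ihb =>
    exact (Int.natAbs_add_le _ _).trans (hadd iha ihb a.size_pos b.size_pos)
  | sub a b iha ihb =>
    exact (Int.natAbs_sub_le _ _).trans (hadd iha ihb a.size_pos b.size_pos)
  | mul a b iha ihb =>
    simp only [Expr.eval, Expr.size, Int.natAbs_mul, mul_add, pow_add]
    exact Nat.mul_le_mul iha ihb
  | div a b iha _ =>
    have h1 : (a.eval s / b.eval s).natAbs ≤ (a.eval s).natAbs := by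
      rcases Int.eq_nat_or_neg (b.eval s) with ⟨n, hn | hn⟩
      · rw [hn]; exact Int.natAbs_ediv_le_natAbs _ _
      · rw [hn]; exact Int.natAbs_ediv_le_natAbs _ _
    refine h1.trans (iha.trans (Nat.pow_le_pow_right (by norm_num) ?_))
    simp only [Expr.size]
    nlinarith

/-- Schoolbook multiplication is quadratic in the bit lengths, and (a + b)² absorbs the costs of
both subexpressions together with the product term. -/
lemma Expr.cost_le {s : Mem} {L : ℕ} (hL : 0 < L) (hs : ∀ a, (s a).natAbs ≤ 2 ^ L) :
    ∀ e : Expr, e.cost s ≤ 9 * L ^ 2 * e.size ^ 2 := by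
  have hb : ∀ e : Expr, bits (e.eval s) ≤ 3 * L * e.size := fun e =>
    bits_le hL e.size_pos (e.natAbs_eval_le hL hs)
  have hadd : ∀ {a b x y u v : ℕ}, x ≤ 9 * L ^ 2 * a ^ 2 → y ≤ 9 * L ^ 2 * b ^ 2 →
      u ≤ 3 * L * a → v ≤ 3 * L * b → 0 < a → 0 < b →
      x + y + u + v ≤ 9 * L ^ 2 * (a + b) ^ 2 := by
    intro a b x y u v hx hy hu hv ha hb
    have h1 : L * a ≤ L * L * (a * b) := by
      calc L * a = L * a * 1 := by ring
        _ ≤ L * a * (L * b) := Nat.mul_le_mul_left _ (Nat.mul_pos hL hb)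
        _ = _ := by ring
    have h2 : L * b ≤ L * L * (a * b) := by
      calc L * b = L * b * 1 := by ring
        _ ≤ L * b * (L * a) := Nat.mul_le_mul_left _ (Nat.mul_pos hL ha)
        _ = _ := by ring
    nlinarith
  have hmul : ∀ {a b x y u v : ℕ}, x ≤ 9 * L ^ 2 * a ^ 2 → y ≤ 9 * L ^ 2 * b ^ 2 →
      u ≤ 3 * L * a → v ≤ 3 * L * b → x + y + u * v ≤ 9 * L ^ 2 * (a + b) ^ 2 := by
    intro a b x y u v hx hy hu hv
    have h1 : u * v ≤ (3 * L * a) * (3 * L * b) := Nat.mul_le_mul hu hv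
    nlinarith [Nat.zero_le (L ^ 2 * (a * b))]
  intro e
  induction e with
  | lit z =>
    simp only [Expr.cost, Expr.size]
    have := bits_pos z
    have : 1 ≤ L ^ 2 := Nat.one_le_pow _ _ hL
    nlinarith [Nat.mul_le_mul this (Nat.le_self_pow two_ne_zero (bits z))]
  | load a iha =>
    have h1 : bits (s (a.eval s)) ≤ 3 * L * 1 := bits_le hL one_pos (by simpa using hs _)
    have h2 := hb a
    simp only [Expr.cost, Expr.size]
    nlinarith [Nat.mul_le_mul hL (Nat.le_refl (L * (a.size + 1))), a.size_pos]
  | add a b iha ihb => exact hadd iha ihb (hb a) (hb b) a.size_pos b.size_pos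
  | sub a b iha ihb => exact hadd iha ihb (hb a) (hb b) a.size_pos b.size_pos
  | mul a b iha ihb => exact hmul iha ihb (hb a) (hb b)
  | div a b iha ihb => exact hmul iha ihb (hb a) (hb b)

/-- `Steps V c s n s'`: started with memory `s`, the program `c` halts after `n` elementary steps
with memory `s'`, and all numbers that it stores are bounded by `V`. -/
inductive Steps (V : ℤ) : Program → Mem → ℕ → Mem → Prop
  | skip (s : Mem) : Steps V .skip s 1 s
  | store (a e : Expr) (s : Mem) : |e.eval s| ≤ V →
      Steps V (.store a e) s 1 (Function.update s (a.eval s) (e.eval s))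
  | seq {c c' : Program} {s s' s'' : Mem} {t t' : ℕ} :
      Steps V c s t s' → Steps V c' s' t' s'' → Steps V (.seq c c') s (t + t') s''
  | cond_pos {e : Expr} {c c' : Program} {s s' : Mem} {t : ℕ} :
      0 < e.eval s → Steps V c s t s' → Steps V (.cond e c c') s (1 + t) s'
  | cond_neg {e : Expr} {c c' : Program} {s s' : Mem} {t : ℕ} :
      ¬ 0 < e.eval s → Steps V c' s t s' → Steps V (.cond e c c') s (1 + t) s'
  | loop_pos {e : Expr} {c : Program} {s s' s'' : Mem} {t t' : ℕ} :
      0 < e.eval s → Steps V c s t s' → Steps V (.loop e c) s' t' s'' →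
        Steps V (.loop e c) s (1 + t + t') s''
  | loop_neg {e : Expr} {c : Program} {s : Mem} :
      ¬ 0 < e.eval s → Steps V (.loop e c) s 1 s

/-- All cells stay bounded by V ≤ 2^L, so every elementary step costs at most 9L²w², where w depends
only on the program. The program can thus be analysed by step counts and bounds on stored numbers.
-/
lemma Steps.exists_exec {V : ℤ} {L w : ℕ} (hL : 0 < L) (hV : V ≤ 2 ^ L) {c : Program}
    {s s' : Mem} {n : ℕ} (h : Steps V c s n s') (hs : ∀ a, |s a| ≤ V) (hw : c.width ≤ w) :
    (∀ a, |s' a| ≤ V) ∧ ∃ t, Exec c s t s' ∧ t ≤ n * (9 * L ^ 2 * w ^ 2) := by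
  have hb : ∀ {s : Mem}, (∀ a, |s a| ≤ V) → ∀ a, (s a).natAbs ≤ 2 ^ L := by
    intro s hs a
    have := (hs a).trans hV
    rw [Int.abs_eq_natAbs] at this
    exact_mod_cast this
  have hcost : ∀ {s : Mem}, (∀ a, |s a| ≤ V) → ∀ e : Expr, e.size ≤ w →
      e.cost s ≤ 9 * L ^ 2 * w ^ 2 := fun hs e he =>
    (e.cost_le hL (hb hs)).trans (Nat.mul_le_mul_left _ (Nat.pow_le_pow_left he 2))
  induction h with
  | skip s =>
    refine ⟨hs, 1, .skip s, ?_⟩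
    have h1 : 1 ≤ L ^ 2 * w ^ 2 := Nat.mul_pos (pow_pos hL 2) (pow_pos hw 2)
    nlinarith
  | store a e s he =>
    refine ⟨fun b => ?_, _, .store a e s, ?_⟩
    · rcases eq_or_ne b (a.eval s) with rfl | h
      · simpa using he
      · simpa [h] using hs b
    · have ha := a.cost_le hL (hb hs)
      have he := e.cost_le hL (hb hs)
      have ha' := bits_le hL a.size_pos (a.natAbs_eval_le hL (hb hs))
      have he' := bits_le hL e.size_pos (e.natAbs_eval_le hL (hb hs))
      have h1 : L * a.size ≤ L * L * (a.size * e.size) := by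
        calc L * a.size = L * a.size * 1 := by ring
          _ ≤ L * a.size * (L * e.size) := Nat.mul_le_mul_left _ (Nat.mul_pos hL e.size_pos)
          _ = _ := by ring
      have h2 : L * e.size ≤ L * L * (a.size * e.size) := by
        calc L * e.size = L * e.size * 1 := by ring
          _ ≤ L * e.size * (L * a.size) := Nat.mul_le_mul_left _ (Nat.mul_pos hL a.size_pos)
          _ = _ := by ring
      have h3 : 9 * L ^ 2 * (a.size + e.size) ^ 2 ≤ 9 * L ^ 2 * w ^ 2 :=
        Nat.mul_le_mul_left _ (Nat.pow_le_pow_left hw 2)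
      nlinarith
  | seq _ _ ih ih' =>
    simp only [Program.width] at hw
    obtain ⟨h1, t, e, ht⟩ := ih hs (by omega)
    obtain ⟨h2, t', e', ht'⟩ := ih' h1 (by omega)
    exact ⟨h2, _, .seq e e', by rw [add_mul]; omega⟩
  | cond_pos hp _ ih =>
    simp only [Program.width] at hw
    obtain ⟨h1, t, e, ht⟩ := ih hs (by omega)
    have := hcost hs _ (le_trans (le_max_left _ _) hw)
    exact ⟨h1, _, .cond_pos hp e, by rw [add_mul]; omega⟩
  | cond_neg hp _ ih =>
    simp only [Program.width] at hw
    obtain ⟨h1, t, e, ht⟩ := ih hs (by omega)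
    have := hcost hs _ (le_trans (le_max_left _ _) hw)
    exact ⟨h1, _, .cond_neg hp e, by rw [add_mul]; omega⟩
  | loop_pos hp _ _ ih ih' =>
    have hw' := hw
    simp only [Program.width] at hw'
    obtain ⟨h1, t, e, ht⟩ := ih hs (by omega)
    obtain ⟨h2, t', e', ht'⟩ := ih' h1 hw
    have := hcost hs _ (le_trans (le_max_left _ _) hw')
    exact ⟨h2, _, .loop_pos hp e e', by rw [add_mul, add_mul]; omega⟩
  | loop_neg hp =>
    simp only [Program.width] at hw
    have := hcost hs _ (le_trans (le_max_left _ _) hw)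
    exact ⟨hs, _, .loop_neg hp, by omega⟩

/-- The program halts after at most `n` steps in a state with the property `Q`. -/
def Reaches (V : ℤ) (c : Program) (n : ℕ) (s : Mem) (Q : Mem → Prop) : Prop :=
  ∃ m ≤ n, ∃ s', Steps V c s m s' ∧ Q s'

section Rules

variable {V : ℤ} {c c' : Program} {n n' : ℕ} {s : Mem} {Q Q' : Mem → Prop}

lemma Reaches.mono (h : Reaches V c n s Q) (hn : n ≤ n') (hQ : ∀ s', Q s' → Q' s') :
    Reaches V c n' s Q' := by
  obtain ⟨m, hm, s', hs, hq⟩ := h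
  exact ⟨m, hm.trans hn, s', hs, hQ _ hq⟩

lemma reaches_skip (h : Q s) : Reaches V .skip 1 s Q := ⟨1, le_rfl, s, .skip s, h⟩

lemma reaches_store {a e : Expr} (he : |e.eval s| ≤ V)
    (h : Q (Function.update s (a.eval s) (e.eval s))) : Reaches V (.store a e) 1 s Q :=
  ⟨1, le_rfl, _, .store a e s he, h⟩

lemma reaches_seq (h : Reaches V c n s fun s' => Reaches V c' n' s' Q) :
    Reaches V (.seq c c') (n + n') s Q := by
  obtain ⟨m, hm, s', hs, m', hm', s'', hs', hq⟩ := h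
  exact ⟨_, add_le_add hm hm', s'', .seq hs hs', hq⟩

lemma reaches_cond {e : Expr} (h : 0 < e.eval s → Reaches V c n s Q)
    (h' : ¬ 0 < e.eval s → Reaches V c' n s Q) : Reaches V (.cond e c c') (1 + n) s Q := by
  by_cases hp : 0 < e.eval s
  · obtain ⟨m, hm, s', hs, hq⟩ := h hp
    exact ⟨_, add_le_add le_rfl hm, s', .cond_pos hp hs, hq⟩
  · obtain ⟨m, hm, s', hs, hq⟩ := h' hp
    exact ⟨_, add_le_add le_rfl hm, s', .cond_neg hp hs, hq⟩

/-- The index k of the invariant is a variant: it drops in every round and so bounds the number of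
rounds. -/
lemma reaches_loop {e : Expr} (I : ℕ → Mem → Prop)
    (hpos : ∀ k s, I k s → 0 < e.eval s → ∃ k' < k, Reaches V c n s (I k'))
    (hneg : ∀ k s, I k s → ¬ 0 < e.eval s → Q s) (k : ℕ) (hI : I k s) :
    Reaches V (.loop e c) (k * (1 + n) + 1) s Q := by
  induction k using Nat.strong_induction_on generalizing s with
  | _ k ih =>
    by_cases hp : 0 < e.eval s
    · obtain ⟨k', hk, m, hm, s', hs, hI'⟩ := hpos k s hI hp
      obtain ⟨m', hm', s'', hs', hq⟩ := ih k' hk hI'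
      refine ⟨_, ?_, s'', .loop_pos hp hs hs', hq⟩
      have : (k' + 1) * (1 + n) ≤ k * (1 + n) := Nat.mul_le_mul_right _ hk
      rw [add_mul] at this
      omega
    · exact ⟨1, by omega, s, .loop_neg hp, hneg k s hI hp⟩

end Rules

/-! ### Variables and arrays -/

/-- Addresses of the variables. -/
def var (k : ℕ) : ℤ := -(k + 1)

/-- Addresses of the array cells. -/
def arr (r k : ℕ) : ℤ := -(32 + 16 * k + r)

/-- Addresses of the input cells. -/
def inp (k : ℕ) : ℤ := k

@[simp] lemma var_eq_var {i j : ℕ} : var i = var j ↔ i = j := by unfold var; omega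

@[simp] lemma inp_ne_var {i j : ℕ} : inp i ≠ var j := by unfold inp var; omega

@[simp] lemma inp_ne_arr {i r k : ℕ} : inp i ≠ arr r k := by unfold inp arr; omega

@[simp] lemma var_ne_arr {i r k : ℕ} (h : i < 31) : var i ≠ arr r k := by unfold var arr; omega

@[simp] lemma arr_ne_var {i r k : ℕ} (h : i < 31) : arr r k ≠ var i := by unfold var arr; omega

@[simp] lemma arr_eq_arr {r r' k k' : ℕ} (h : r < 16) (h' : r' < 16) :
    arr r k = arr r' k' ↔ r = r' ∧ k = k' := by unfold arr; omega

/-- The value of a variable. -/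
def getVar (k : ℕ) : Expr := .load (.lit (var k))

/-- The value of an input cell. -/
def getInp (k : ℕ) : Expr := .load (.lit (inp k))

/-- The address of an array cell. -/
def arrAddr (r : ℕ) (e : Expr) : Expr := .sub (.lit (-(32 + r))) (.mul (.lit 16) e)

/-- The value of an array cell. -/
def getArr (r : ℕ) (e : Expr) : Expr := .load (arrAddr r e)

/-- Assignment to a variable. -/
def setVar (k : ℕ) (e : Expr) : Program := .store (.lit (var k)) e

/-- Assignment to an array cell. -/
def setArr (r : ℕ) (i e : Expr) : Program := .store (arrAddr r i) e

@[simp] lemma eval_lit (s : Mem) (z : ℤ) : (Expr.lit z).eval s = z := rfl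

@[simp] lemma eval_add (s : Mem) (a b : Expr) : (Expr.add a b).eval s = a.eval s + b.eval s := rfl

@[simp] lemma eval_sub (s : Mem) (a b : Expr) : (Expr.sub a b).eval s = a.eval s - b.eval s := rfl

@[simp] lemma eval_mul (s : Mem) (a b : Expr) : (Expr.mul a b).eval s = a.eval s * b.eval s := rfl

@[simp] lemma eval_getVar (s : Mem) (k : ℕ) : (getVar k).eval s = s (var k) := rfl

@[simp] lemma eval_getInp (s : Mem) (k : ℕ) : (getInp k).eval s = s (inp k) := rfl

lemma eval_arrAddr {s : Mem} {r k : ℕ} {e : Expr} (h : e.eval s = k) :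
    (arrAddr r e).eval s = arr r k := by
  simp only [arrAddr, eval_sub, eval_mul, eval_lit, h, arr]
  ring

lemma eval_getArr {s : Mem} {r k : ℕ} {e : Expr} (h : e.eval s = k) :
    (getArr r e).eval s = s (arr r k) := by
  rw [← eval_arrAddr h]; rfl

/-- `s'` agrees with `s` outside the variables `vs` and the arrays `as`. -/
def Frame (vs as : List ℕ) (s s' : Mem) : Prop :=
  ∀ a, (∀ k ∈ vs, a ≠ var k) → (∀ r ∈ as, ∀ k, a ≠ arr r k) → s' a = s a

namespace Frame

variable {vs as vs' as' : List ℕ} {s s' s'' : Mem}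

lemma refl (vs as : List ℕ) (s : Mem) : Frame vs as s s := fun _ _ _ => rfl

lemma trans (h : Frame vs as s s') (h' : Frame vs' as' s' s'') (hv : vs' ⊆ vs) (ha : as' ⊆ as) :
    Frame vs as s s'' := fun a h1 h2 =>
  (h' a (fun k hk => h1 k (hv hk)) fun r hr => h2 r (ha hr)).trans (h a h1 h2)

lemma set_var (h : Frame vs as s s') {k : ℕ} (hk : k ∈ vs) (x : ℤ) :
    Frame vs as s (Function.update s' (var k) x) := fun a h1 h2 => by
  rw [Function.update_of_ne (h1 k hk), h a h1 h2]

lemma set_arr (h : Frame vs as s s') {r : ℕ} (hr : r ∈ as) (k : ℕ) (x : ℤ) :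
    Frame vs as s (Function.update s' (arr r k) x) := fun a h1 h2 => by
  rw [Function.update_of_ne (h2 r hr k), h a h1 h2]

lemma inp (h : Frame vs as s s') (k : ℕ) : s' (SymExt.inp k) = s (SymExt.inp k) :=
  h _ (fun _ _ => inp_ne_var) fun _ _ _ => inp_ne_arr

lemma var (h : Frame vs as s s') (k : ℕ) (hk : k ∉ vs) (hk' : k < 31) :
    s' (SymExt.var k) = s (SymExt.var k) :=
  h _ (fun j hj h => hk (by rwa [var_eq_var.1 h])) fun _ _ _ => var_ne_arr hk'

lemma arr (h : Frame vs as s s') (r k : ℕ) (hr : r ∉ as) (hr' : r < 16)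
    (hv : ∀ j ∈ vs, j < 31) (ha : ∀ j ∈ as, j < 16) :
    s' (SymExt.arr r k) = s (SymExt.arr r k) :=
  h _ (fun _ hj => arr_ne_var (hv _ hj)) fun _ hj _ h =>
    hr (by rwa [((arr_eq_arr hr' (ha _ hj)).1 h).1])

end Frame

/-- `for` loops: the variable `v` runs through the numbers from `0` up to the value of `e`. -/
def forLoop (v : ℕ) (e : Expr) (c : Program) : Program :=
  .seq (setVar v (.lit 0))
    (.loop (.sub e (getVar v)) (.seq c (setVar v (.add (getVar v) (.lit 1)))))

/-- The invariant is stated with the counter already set, hence the updates of `v` in the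
hypotheses. The bound `e` is evaluated anew in each round, so the invariant has to fix its value;
the body must leave the counter alone. -/
lemma reaches_forLoop {V : ℤ} {v m n : ℕ} {e : Expr} {c : Program} {s : Mem}
    (I : ℕ → Mem → Prop) (hV : (n : ℤ) ≤ V) (h0 : I 0 (Function.update s (var v) 0))
    (hv : ∀ i s, I i s → i ≤ n → s (var v) = i ∧ e.eval s = n)
    (hc : ∀ i s, I i s → i < n → Reaches V c m s fun s' => s' (var v) = i ∧
      I (i + 1) (Function.update s' (var v) ((i + 1 : ℕ) : ℤ))) :
    Reaches V (forLoop v e c) (n * (m + 2) + 2) s (I n) := by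
  have hV0 : (0 : ℤ) ≤ V := (Int.natCast_nonneg n).trans hV
  refine Reaches.mono (n := 1 + (n * (1 + (m + 1)) + 1)) (reaches_seq (reaches_store
    (by simpa using hV0) ?_)) (by ring_nf; omega) (fun _ h => h)
  refine reaches_loop (fun k s' => ∃ i, i + k = n ∧ I i s') ?_ ?_ n ⟨0, by omega, h0⟩
  · rintro k s' ⟨i, hik, hI⟩ hp
    obtain ⟨h1, h2⟩ := hv i s' hI (by omega)
    simp only [eval_sub, eval_getVar, h1, h2] at hp
    refine ⟨k - 1, by omega, reaches_seq ((hc i s' hI (by omega)).mono le_rfl ?_)⟩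
    rintro s'' ⟨h3, h4⟩
    refine reaches_store ?_ ⟨i + 1, by omega, ?_⟩
    · simp only [eval_add, eval_getVar, eval_lit, h3]
      rw [abs_of_nonneg (by omega)]
      omega
    · simp only [eval_add, eval_getVar, eval_lit, h3]
      exact_mod_cast h4
  · rintro k s' ⟨i, hik, hI⟩ hp
    obtain ⟨h1, h2⟩ := hv i s' hI (by omega)
    simp only [eval_sub, eval_getVar, h1, h2] at hp
    have : i = n := by omega
    rwa [← this]

/-! ### Self-delimiting codes of lists of integers -/

/-- Division that truncates towards zero gives signed digits −1, 0, 1 and halves the absolute value,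
so negative integers need no separate sign. -/
lemma tdiv_two_spec (g : ℤ) : 2 * g.tdiv 2 + g.tmod 2 = g ∧ -1 ≤ g.tmod 2 ∧ g.tmod 2 ≤ 1 ∧
    (g.tdiv 2).natAbs = g.natAbs / 2 := by
  have h1 := Int.natAbs_tmod g 2
  have h2 : (g.tmod 2).natAbs < 2 := by
    rw [h1]; exact Nat.mod_lt _ (by norm_num)
  refine ⟨Int.mul_tdiv_add_tmod g 2, by omega, by omega, ?_⟩
  exact Int.natAbs_tdiv g 2

/-- Puts the signed binary digits of an integer, in base `4`, in front of a code. -/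
def encodeInt (g : ℤ) (R : ℕ) : ℕ :=
  if g = 0 then R else encodeInt (g.tdiv 2) (4 * R + (1 + g.tmod 2).toNat)
termination_by g.natAbs
decreasing_by
  have := (tdiv_two_spec g).2.2.2
  omega

/-- The code of a list of integers. -/
def encode : List ℤ → ℕ
  | [] => 0
  | g :: l => encodeInt g (4 * encode l + 3)

/-- Decoding: the base `4` digit `3` moves to the next integer, the others are signed binary
digits. -/
def decode (z k : ℕ) (G : ℕ → ℤ) : ℕ → ℤ :=
  if z = 0 then G else
    if z % 4 = 3 then decode (z / 4) (k + 1) (Function.update G (k + 1) 0)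
    else decode (z / 4) k (Function.update G k (2 * G k + (z % 4 : ℕ) - 1))
termination_by z
decreasing_by all_goals omega

/-- Encoding pushes the lowest digit first, so decoding meets the highest digit first and rebuilds g
by Horner's rule. The tail R must be nonzero, since a code 0 means the end and the digit −1 is
stored as 0. -/
lemma decode_encodeInt (g : ℤ) {R : ℕ} (hR : 0 < R) (k : ℕ) {G : ℕ → ℤ} (hG : G k = 0) :
    decode (encodeInt g R) k G = decode R k (Function.update G k g) := by
  induction hn : g.natAbs using Nat.strong_induction_on generalizing g R with
  | _ n ih =>
    obtain ⟨s1, s2, s3, s4⟩ := tdiv_two_spec g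
    rw [encodeInt]
    split_ifs with hg
    · rw [hg, ← hG, Function.update_eq_self]
    · subst hn
      rw [ih _ (by omega) _ (by omega) rfl, decode, if_neg (by omega),
        if_neg (by omega)]
      have h1 : (4 * R + (1 + g.tmod 2).toNat) / 4 = R := by omega
      have h2 : (((4 * R + (1 + g.tmod 2).toNat) % 4 : ℕ) : ℤ) = 1 + g.tmod 2 := by omega
      rw [h1, h2]
      simp only [Function.update_self, Function.update_idem]
      congr 2
      omega

lemma decode_encode (l : List ℤ) (k : ℕ) {G : ℕ → ℤ} (hG : G k = 0) :
    (∀ i (hi : i < l.length), decode (encode l) k G (k + i) = l[i]) ∧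
      ∀ i < k, decode (encode l) k G i = G i := by
  induction l generalizing k G with
  | nil => exact ⟨fun i hi => absurd hi (by simp), fun i _ => by simp [encode, decode]⟩
  | cons g l ih =>
    have h1 : decode (encode (g :: l)) k G = decode (encode l) (k + 1)
        (Function.update (Function.update G k g) (k + 1) 0) := by
      rw [encode, decode_encodeInt g (by omega) k hG, decode, if_neg (by omega),
        if_pos (by omega)]
      congr 1
      omega
    obtain ⟨h2, h3⟩ := ih (k + 1) (G := Function.update (Function.update G k g) (k + 1) 0)
      (by simp)
    rw [h1]
    refine ⟨fun i hi => ?_, fun i hi => ?_⟩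
    · rcases i with _ | i
      · rw [add_zero, h3 k (by omega), Function.update_of_ne (by omega)]
        simp
      · have := h2 i (by simpa using hi)
        rw [show k + (i + 1) = k + 1 + i by ring, this]
        simp
    · rw [h3 i (by omega), Function.update_of_ne (by omega), Function.update_of_ne (by omega)]

/-- Each binary digit multiplies R + 1 by at most 4, and there are about log₂|g| + 1 digits. -/
lemma encodeInt_lt (g : ℤ) (R : ℕ) :
    encodeInt g R + 1 ≤ (R + 1) * max 1 (4 * g.natAbs ^ 2) := by
  induction hn : g.natAbs using Nat.strong_induction_on generalizing g R with
  | _ n ih =>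
    obtain ⟨s1, s2, s3, s4⟩ := tdiv_two_spec g
    rw [encodeInt]
    split_ifs with hg
    · exact Nat.le_mul_of_pos_right _ (by omega)
    · subst hn
      refine (ih _ (by omega) _ (4 * R + (1 + g.tmod 2).toNat) rfl).trans ?_
      have h0 : 0 < g.natAbs := by omega
      have h1 : 4 * R + (1 + g.tmod 2).toNat + 1 ≤ (R + 1) * 4 := by omega
      have h2 : 4 * max 1 (4 * (g.tdiv 2).natAbs ^ 2) ≤ max 1 (4 * g.natAbs ^ 2) := by
        have h3 : 2 * (g.tdiv 2).natAbs ≤ g.natAbs := by omega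
        rcases Nat.eq_zero_or_pos (g.tdiv 2).natAbs with h | h
        · rw [h]
          refine le_max_of_le_right ?_
          have : 1 ≤ g.natAbs ^ 2 := Nat.one_le_pow _ _ h0
          simp
          omega
        · rw [max_eq_right (by nlinarith)]
          refine le_max_of_le_right ?_
          nlinarith
      calc _ ≤ ((R + 1) * 4) * max 1 (4 * (g.tdiv 2).natAbs ^ 2) := Nat.mul_le_mul_right _ h1
        _ = (R + 1) * (4 * max 1 (4 * (g.tdiv 2).natAbs ^ 2)) := by ring
        _ ≤ _ := Nat.mul_le_mul_left _ h2

lemma encode_lt (l : List ℤ) :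
    encode l + 1 ≤ (l.map fun g => 16 * (g.natAbs + 1) ^ 2).prod := by
  induction l with
  | nil => simp [encode]
  | cons g l ih =>
    rw [encode, List.map_cons, List.prod_cons]
    refine (encodeInt_lt g _).trans ?_
    have h1 : max 1 (4 * g.natAbs ^ 2) ≤ 4 * (g.natAbs + 1) ^ 2 :=
      max_le (Nat.mul_pos (by norm_num) (pow_pos (Nat.succ_pos _) 2))
        (Nat.mul_le_mul_left _ (Nat.pow_le_pow_left (Nat.le_succ _) 2))
    calc _ ≤ (4 * encode l + 3 + 1) * (4 * (g.natAbs + 1) ^ 2) := Nat.mul_le_mul_left _ h1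
      _ = 16 * (g.natAbs + 1) ^ 2 * (encode l + 1) := by ring
      _ ≤ _ := Nat.mul_le_mul_left _ ih

/-- Bounds for the decoding procedure. -/
lemma abs_decode_step {z k Z : ℕ} {G : ℕ → ℤ} (hz : 0 < z)
    (hk : ((G k).natAbs + 1) * (z + 1) ≤ Z) (h3 : z % 4 ≠ 3) :
    ((2 * G k + (z % 4 : ℕ) - 1).natAbs + 1) * (z / 4 + 1) ≤ Z := by
  have h1 : (2 * G k + (z % 4 : ℕ) - 1).natAbs + 1 ≤ 2 * ((G k).natAbs + 1) := by omega
  have h2 : 2 * (z / 4 + 1) ≤ z + 1 := by omega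
  calc _ ≤ 2 * ((G k).natAbs + 1) * (z / 4 + 1) := Nat.mul_le_mul_right _ h1
    _ = ((G k).natAbs + 1) * (2 * (z / 4 + 1)) := by ring
    _ ≤ _ := (Nat.mul_le_mul_left _ h2).trans hk

lemma sum_range_mul {α : Type*} [AddCommMonoid α] (f : ℕ → α) (a b : ℕ) :
    ∑ t ∈ Finset.range (a * b), f t =
      ∑ i ∈ Finset.range a, ∑ j ∈ Finset.range b, f (i * b + j) := by
  induction a with
  | zero => simp
  | succ a ih => rw [add_mul, one_mul, Finset.sum_range_add, ih, Finset.sum_range_succ]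

/-- The inequality of the means with a lossy constant, from x ≤ A exp(x/A) and e < 3. It makes the
size of a code depend on the average coordinate instead of the largest one, which may be of order
√d. -/
lemma prod_le_pow_of_sum_le {n : ℕ} {A : ℝ} (hA : 0 < A) (a : ℕ → ℝ) (ha : ∀ t, 0 ≤ a t)
    (h : ∑ t ∈ Finset.range n, a t ≤ n * A) : ∏ t ∈ Finset.range n, a t ≤ (3 * A) ^ n := by
  have h1 : ∀ t, a t ≤ A * Real.exp (a t / A) := fun t => by
    have := Real.add_one_le_exp (a t / A)
    have h2 : a t = A * (a t / A) := by field_simp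
    nlinarith
  calc _ ≤ ∏ t ∈ Finset.range n, A * Real.exp (a t / A) :=
        Finset.prod_le_prod (fun t _ => ha t) fun t _ => h1 t
    _ = A ^ n * Real.exp ((∑ t ∈ Finset.range n, a t) / A) := by
        rw [Finset.prod_mul_distrib, ← Real.exp_sum, Finset.sum_div]
        simp
    _ ≤ A ^ n * Real.exp n := by
        gcongr
        rwa [div_le_iff₀ hA]
    _ = (Real.exp 1 * A) ^ n := by
        rw [mul_pow, ← Real.exp_nat_mul, mul_one, mul_comm]
    _ ≤ _ := by
        have := Real.exp_one_lt_d9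
        gcongr
        linarith

/-! ### The vectors of the perceptron -/

section Vectors

/-- Coordinates of the vectors that are listed by `G`. -/
def family (d N : ℕ) (G : ℕ → ℤ) (c i a : ℕ) : GaussianInt :=
  ⟨G (2 * (d * (i + c * N) + a)), G (2 * (d * (i + c * N) + a) + 1)⟩

/-- Coordinates of the tensor product of the vectors that are listed by `G`. -/
def psi (d N : ℕ) (G : ℕ → ℤ) (c x : ℕ) : GaussianInt :=
  ∏ i ∈ Finset.range N, family d N G c i (x / d ^ i % d)

/-- Squared norm of the tensor product of the vectors that are listed by `G`. -/
def normSq (d N : ℕ) (G : ℕ → ℤ) (c : ℕ) : ℤ :=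
  ∑ x ∈ Finset.range (d ^ N), ((psi d N G c x).re * (psi d N G c x).re +
    (psi d N G c x).im * (psi d N G c x).im)

/-- The update vector of the perceptron. -/
def update (d N h q : ℕ) (E : ℕ → GaussianInt) (G : ℕ → ℤ) (m : ℕ) : GaussianInt :=
  (((h + 1) * normSq d N G 1 * q : ℤ) : GaussianInt) *
      (psi d N G 0 (m / d ^ N) * star (psi d N G 0 (m % d ^ N))) -
    ((normSq d N G 0 * q : ℤ) : GaussianInt) *
      (psi d N G 1 (m / d ^ N) * star (psi d N G 1 (m % d ^ N))) -
    ((h * (normSq d N G 0 * normSq d N G 1) : ℤ) : GaussianInt) * E m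

/-- Real inner product. -/
def dot (n : ℕ) (S T : ℕ → GaussianInt) : ℤ :=
  ∑ m ∈ Finset.range n, ((S m).re * (T m).re + (S m).im * (T m).im)

variable {d N : ℕ}

/-- The number of a basis vector. -/
def num (x : Fin N → Fin d) : ℕ := finFunctionFinEquiv x

lemma num_lt (x : Fin N → Fin d) : num x < d ^ N := (finFunctionFinEquiv x).2

lemma basisNumber_eq (x : Fin N → Fin d) : basisNumber x = num x := by
  rw [num, finFunctionFinEquiv_apply, basisNumber]
  push_cast
  rfl

lemma digit_num (x : Fin N → Fin d) (i : Fin N) : num x / d ^ (i : ℕ) % d = x i := by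
  have := congrFun (finFunctionFinEquiv.symm_apply_apply x) i
  conv_rhs => rw [← this]
  rfl

lemma sum_num {α : Type*} [AddCommMonoid α] (f : ℕ → α) :
    ∑ x : Fin N → Fin d, f (num x) = ∑ x ∈ Finset.range (d ^ N), f x := by
  rw [← Fin.sum_univ_eq_sum_range, ← finFunctionFinEquiv.sum_comp]
  rfl

lemma sum_num_num {α : Type*} [AddCommMonoid α] (f : ℕ → α) :
    ∑ x : Fin N → Fin d, ∑ y : Fin N → Fin d, f (num x * d ^ N + num y) =
      ∑ m ∈ Finset.range (d ^ N * d ^ N), f m := by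
  rw [sum_range_mul, ← sum_num (N := N) (d := d)
    (fun i => ∑ j ∈ Finset.range (d ^ N), f (i * d ^ N + j))]
  exact Finset.sum_congr rfl fun x _ => sum_num (fun j => f (num x * d ^ N + j))

/-- The matrix with the entries `S`. -/
noncomputable def toMat (N d : ℕ) (S : ℕ → GaussianInt) :
    Matrix (Fin N → Fin d) (Fin N → Fin d) ℂ :=
  Matrix.of fun x y => GaussianInt.toComplex (S (num x * d ^ N + num y))

lemma toMat_add (S T : ℕ → GaussianInt) :
    toMat N d (fun m => S m + T m) = toMat N d S + toMat N d T := by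
  ext x y; simp [toMat]

/-- The vectors that are listed by `G`. -/
def familyFin (d N : ℕ) (G : ℕ → ℤ) (c : ℕ) (i : Fin N) (a : Fin d) : GaussianInt :=
  family d N G c i a

lemma toComplex_psi (G : ℕ → ℤ) (c : ℕ) (x : Fin N → Fin d) :
    GaussianInt.toComplex (psi d N G c (num x)) =
      ∏ i, gaussVec (familyFin d N G c) i (x i) := by
  rw [psi, ← Fin.prod_univ_eq_prod_range
    (fun i => family d N G c i (num x / d ^ i % d)), map_prod]
  refine Finset.prod_congr rfl fun i _ => ?_
  rw [digit_num]
  rfl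

lemma normSq_eq (G : ℕ → ℤ) (c : ℕ) :
    (normSq d N G c : ℝ) = ∏ i, ‖gaussVec (familyFin d N G c) i‖ ^ 2 := by
  have h := trace_productProj (gaussVec (familyFin d N G c))
  have h2 : (productProj (gaussVec (familyFin d N G c))).trace = ((normSq d N G c : ℝ) : ℂ) := by
    rw [normSq, ← sum_num (N := N) (d := d)]
    simp only [Matrix.trace, Matrix.diag_apply, productProj, Matrix.of_apply]
    push_cast
    refine Finset.sum_congr rfl fun x _ => ?_
    rw [Finset.prod_mul_distrib, ← star_prod, ← toComplex_psi]
    refine (Complex.mul_conj _).trans ?_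
    rw [Complex.normSq_apply, ← GaussianInt.intCast_re, ← GaussianInt.intCast_im]
    push_cast
    rfl
  rw [h] at h2
  exact_mod_cast h2.symm

lemma normSq_nonneg (G : ℕ → ℤ) (c : ℕ) : 0 ≤ normSq d N G c :=
  Finset.sum_nonneg fun _ _ => add_nonneg (mul_self_nonneg _) (mul_self_nonneg _)

variable {h q : ℕ} {E : ℕ → GaussianInt} {ρ : Matrix (Fin N → Fin d) (Fin N → Fin d) ℂ}

/-- The factors n₀, n₁ (the squared norms) and q clear the normalisation of the product vectors and
the denominator of ρ: up to the factor q n₀ n₁ this is (h + 1)P − Q − hρ with normalised P, Q. -/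
lemma toMat_update (hE : toMat N d E = (q : ℝ) • ρ) (G : ℕ → ℤ) :
    toMat N d (update d N h q E G) =
      (q : ℝ) • (((h + 1 : ℝ) * normSq d N G 1) • productProj (gaussVec (familyFin d N G 0)) -
        (normSq d N G 0 : ℝ) • productProj (gaussVec (familyFin d N G 1)) -
        (h * (normSq d N G 0 * normSq d N G 1) : ℝ) • ρ) := by
  ext x y
  have hE' := congrFun (congrFun hE x) y
  have h1 : (num x * d ^ N + num y) / d ^ N = num x := by
    rw [mul_comm, Nat.mul_add_div ((Nat.zero_le _).trans_lt (num_lt x)),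
      Nat.div_eq_of_lt (num_lt y), add_zero]
  have h2 : (num x * d ^ N + num y) % d ^ N = num y := by
    rw [mul_comm, Nat.mul_add_mod, Nat.mod_eq_of_lt (num_lt y)]
  simp only [toMat, Matrix.of_apply, Matrix.smul_apply, Complex.real_smul] at hE'
  simp only [toMat, Matrix.of_apply, update, h1, h2, map_sub, map_mul, GaussianInt.toComplex_star,
    toComplex_psi, hE', Matrix.smul_apply, Matrix.sub_apply, Complex.real_smul, productProj,
    Finset.prod_mul_distrib, map_intCast, map_prod]
  push_cast
  simp only [Complex.star_def]
  ring

/-- Frobenius norm and inner product of matrices of Gaussian integers. -/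
lemma dot_self_eq (S : ℕ → GaussianInt) :
    (dot (d ^ N * d ^ N) S S : ℝ) = ∑ x, ∑ y, ‖toMat N d S x y‖ ^ 2 := by
  rw [dot, ← sum_num_num (N := N) (d := d)]
  push_cast
  refine Finset.sum_congr rfl fun x _ => Finset.sum_congr rfl fun y _ => ?_
  rw [toMat, Matrix.of_apply, ← Complex.normSq_eq_norm_sq, Complex.normSq_apply,
    ← GaussianInt.intCast_re, ← GaussianInt.intCast_im]

/-- The real inner product with a matrix of Gaussian integers. -/
noncomputable def dotMat (N d : ℕ) (S : ℕ → GaussianInt) :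
    Matrix (Fin N → Fin d) (Fin N → Fin d) ℂ →ₗ[ℝ] ℝ where
  toFun X := ∑ x, ∑ y, ((toMat N d S x y).re * (X x y).re + (toMat N d S x y).im * (X x y).im)
  map_add' X Y := by
    simp only [← Finset.sum_add_distrib, Matrix.add_apply, Complex.add_re, Complex.add_im]
    refine Finset.sum_congr rfl fun x _ => Finset.sum_congr rfl fun y _ => ?_
    ring
  map_smul' c X := by
    simp only [Finset.mul_sum, Matrix.smul_apply, Complex.smul_re, Complex.smul_im, smul_eq_mul,
      RingHom.id_apply]
    refine Finset.sum_congr rfl fun x _ => Finset.sum_congr rfl fun y _ => ?_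
    ring

lemma dot_eq (S T : ℕ → GaussianInt) :
    (dot (d ^ N * d ^ N) S T : ℝ) = dotMat N d S (toMat N d T) := by
  rw [dot, ← sum_num_num (N := N) (d := d), dotMat]
  push_cast
  refine Finset.sum_congr rfl fun x _ => Finset.sum_congr rfl fun y _ => ?_
  simp only [toMat, Matrix.of_apply, ← GaussianInt.intCast_re, ← GaussianInt.intCast_im]

/-- For nonnegative eigenvalues the sum of the squares is at most the square of the sum. -/
lemma sum_norm_sq_le_trace_sq {n : Type*} [Fintype n] [DecidableEq n] {A : Matrix n n ℂ}
    (hA : A.PosSemidef) : ∑ i, ∑ j, ‖A i j‖ ^ 2 ≤ A.trace.re ^ 2 := by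
  rw [← sum_eigenvalues_sq hA.1, hA.1.trace_eq_sum_eigenvalues]
  have h : (∑ i, (hA.1.eigenvalues i : ℂ)).re = ∑ i, hA.1.eigenvalues i := by simp
  refine le_of_le_of_eq ?_ (congrArg (· ^ 2) h.symm)
  exact Finset.sum_sq_le_sq_sum_of_nonneg fun i _ => hA.eigenvalues_nonneg i

/-- Each of the three terms has Frobenius norm at most its trace, and ‖u − v − w‖² ≤ 3(‖u‖² + ‖v‖² +
‖w‖²). The constant is attained at h = 1, where 3((h + 1)² + 1 + h²) = 18h². -/
lemma dot_update_le (hE : toMat N d E = (q : ℝ) • ρ) (hρ : IsState ρ) (hh : 0 < h) (G : ℕ → ℤ) :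
    dot (d ^ N * d ^ N) (update d N h q E G) (update d N h q E G) ≤
      18 * (q * h * (normSq d N G 0 * normSq d N G 1)) ^ 2 := by
  have hb : ∀ c, ∑ x, ∑ y, ‖productProj (gaussVec (familyFin d N G c)) x y‖ ^ 2 ≤
      (normSq d N G c : ℝ) ^ 2 := fun c => by
    have := sum_norm_sq_le_trace_sq (posSemidef_productProj (gaussVec (familyFin d N G c)))
    rwa [trace_productProj, ← normSq_eq, Complex.ofReal_re] at this
  have hρ2 : ∑ x, ∑ y, ‖ρ x y‖ ^ 2 ≤ 1 := by
    have := sum_norm_sq_le_trace_sq hρ.1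
    rwa [hρ.2, Complex.one_re, one_pow] at this
  set n0 : ℝ := ((normSq d N G 0 : ℤ) : ℝ) with hn0
  set n1 : ℝ := ((normSq d N G 1 : ℤ) : ℝ) with hn1
  have h3 : ∀ u v w : ℂ, ‖u - v - w‖ ^ 2 ≤ 3 * (‖u‖ ^ 2 + ‖v‖ ^ 2 + ‖w‖ ^ 2) := by
    intro u v w
    have h1 : ‖u - v - w‖ ≤ ‖u‖ + ‖v‖ + ‖w‖ :=
      (norm_sub_le _ _).trans (by gcongr; exact norm_sub_le _ _)
    calc _ ≤ (‖u‖ + ‖v‖ + ‖w‖) ^ 2 := by gcongr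
      _ ≤ _ := by nlinarith [sq_nonneg (‖u‖ - ‖v‖), sq_nonneg (‖v‖ - ‖w‖), sq_nonneg (‖u‖ - ‖w‖)]
  have key : (dot (d ^ N * d ^ N) (update d N h q E G) (update d N h q E G) : ℝ) ≤
      18 * (q * h * (n0 * n1)) ^ 2 := by
    rw [dot_self_eq, toMat_update hE]
    set P := productProj (gaussVec (familyFin d N G 0))
    set Q := productProj (gaussVec (familyFin d N G 1))
    calc _ ≤ ∑ x, ∑ y, (q : ℝ) ^ 2 * (3 * (((h + 1) * n1) ^ 2 * ‖P x y‖ ^ 2 +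
          n0 ^ 2 * ‖Q x y‖ ^ 2 + (h * (n0 * n1)) ^ 2 * ‖ρ x y‖ ^ 2)) := by
          refine Finset.sum_le_sum fun x _ => Finset.sum_le_sum fun y _ => ?_
          simp only [Matrix.smul_apply, Matrix.sub_apply]
          rw [norm_smul, mul_pow, Real.norm_eq_abs, sq_abs]
          refine mul_le_mul_of_nonneg_left ((h3 _ _ _).trans_eq ?_) (by positivity)
          simp only [norm_smul, mul_pow, Real.norm_eq_abs, abs_mul, sq_abs, hn0, hn1]
      _ = (q : ℝ) ^ 2 * (3 * (((h + 1) * n1) ^ 2 * ∑ x, ∑ y, ‖P x y‖ ^ 2 +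
          n0 ^ 2 * ∑ x, ∑ y, ‖Q x y‖ ^ 2 +
          (h * (n0 * n1)) ^ 2 * ∑ x, ∑ y, ‖ρ x y‖ ^ 2)) := by
          simp only [Finset.mul_sum, ← Finset.sum_add_distrib]
      _ ≤ (q : ℝ) ^ 2 * (3 * (((h + 1) * n1) ^ 2 * n0 ^ 2 + n0 ^ 2 * n1 ^ 2 +
          (h * (n0 * n1)) ^ 2 * 1)) := by
          gcongr
          · exact hb 0
          · exact hb 1
      _ ≤ _ := by
          have hh1 : (1 : ℝ) ≤ h := by exact_mod_cast hh
          have h4 : 3 * ((h + 1 : ℝ) ^ 2 + 1 + h ^ 2) ≤ 18 * h ^ 2 := by nlinarith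
          have h5 : 0 ≤ (q : ℝ) ^ 2 * (n0 * n1) ^ 2 := by positivity
          nlinarith [mul_le_mul_of_nonneg_left h4 h5]
  rw [hn0, hn1] at key
  exact_mod_cast key

end Vectors

/-! ### The perceptron -/

section Perceptron

/-- One step of the perceptron from `(S, W)` to `(S', W')` when the code `z` is read. -/
def Step (d N h q M : ℕ) (E : ℕ → GaussianInt) (z : ℕ) (S : ℕ → GaussianInt) (W : ℤ)
    (S' : ℕ → GaussianInt) (W' : ℤ) : Prop :=
  ∃ G : ℕ → ℤ, (∀ l : List ℤ, encode l = z → ∀ i (hi : i < l.length), G i = l[i]) ∧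
    if normSq d N G 0 * normSq d N G 1 ≤ M ∧
      dot (d ^ N * d ^ N) S (update d N h q E G) ≤ 0
    then (∀ m < d ^ N * d ^ N, S' m = S m + update d N h q E G m) ∧
      W' = W + normSq d N G 0 * normSq d N G 1
    else (∀ m < d ^ N * d ^ N, S' m = S m) ∧ W' = W

/-- `Run … j S W`: the perceptron can be in the state `(S, W)` after `j` steps. -/
inductive Run (d N h q M : ℕ) (E : ℕ → GaussianInt) : ℕ → (ℕ → GaussianInt) → ℤ → Prop
  | zero {S : ℕ → GaussianInt} : (∀ m < d ^ N * d ^ N, S m = 0) → Run d N h q M E 0 S 0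
  | succ {j : ℕ} {S S' : ℕ → GaussianInt} {W W' : ℤ} : Run d N h q M E j S W →
      Step d N h q M E (j % M) S W S' W' → Run d N h q M E (j + 1) S' W'

lemma dot_congr {n : ℕ} {S S' T T' : ℕ → GaussianInt} (h : ∀ m < n, S m = S' m)
    (h' : ∀ m < n, T m = T' m) : dot n S T = dot n S' T' :=
  Finset.sum_congr rfl fun m hm => by
    rw [h m (Finset.mem_range.1 hm), h' m (Finset.mem_range.1 hm)]

lemma dot_add_self (n : ℕ) (S T : ℕ → GaussianInt) :
    dot n (fun m => S m + T m) (fun m => S m + T m) = dot n S S + 2 * dot n S T + dot n T T := by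
  simp only [dot, Finset.mul_sum, ← Finset.sum_add_distrib, Zsqrtd.re_add, Zsqrtd.im_add]
  exact Finset.sum_congr rfl fun m _ => by ring

variable {d N : ℕ}

lemma toMat_congr {S S' : ℕ → GaussianInt} (h : ∀ m < d ^ N * d ^ N, S m = S' m) :
    toMat N d S = toMat N d S' := by
  ext x y
  have h1 := num_lt x
  have h2 := num_lt y
  simp only [toMat, Matrix.of_apply]
  rw [h _ (by nlinarith)]

variable {h q M : ℕ} {E : ℕ → GaussianInt} {ρ : Matrix (Fin N → Fin d) (Fin N → Fin d) ℂ}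

/-- The perceptron estimate: with a nonpositive inner product, an update adds at most its own
squared norm, which is at most 18(qh)²ν² for ν the product of the two squared norms. Since ν ≤ M,
this is 18(qh)²M times the gain ν of W. -/
lemma Run.dot_le (hE : toMat N d E = (q : ℝ) • ρ) (hρ : IsState ρ) (hh : 0 < h) {j : ℕ}
    {S : ℕ → GaussianInt} {W : ℤ} (hr : Run d N h q M E j S W) :
    0 ≤ W ∧ W ≤ j * M ∧ dot (d ^ N * d ^ N) S S ≤ 18 * (q * h) ^ 2 * M * W := by
  induction hr with
  | zero h0 =>
    refine ⟨le_rfl, by simp, ?_⟩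
    rw [dot_congr h0 h0]
    simp [dot]
  | @succ j S S' W W' _ hs ih =>
    obtain ⟨h1, h1', h2⟩ := ih
    obtain ⟨G, -, hG⟩ := hs
    set ν := normSq d N G 0 * normSq d N G 1 with hν
    have hν0 : 0 ≤ ν := mul_nonneg (normSq_nonneg _ _) (normSq_nonneg _ _)
    have hM0 : (0 : ℤ) ≤ M := Int.natCast_nonneg M
    split_ifs at hG with hc
    · obtain ⟨hS, rfl⟩ := hG
      refine ⟨by omega, by push_cast; nlinarith [hc.1], ?_⟩
      rw [dot_congr hS hS, dot_add_self]
      have h3 := dot_update_le hE hρ hh G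
      rw [← hν] at h3
      have h4 : ν * ν ≤ M * ν := mul_le_mul_of_nonneg_right hc.1 hν0
      have h5 : (0 : ℤ) ≤ 18 * (q * h) ^ 2 := by positivity
      nlinarith [mul_le_mul_of_nonneg_left h4 h5, hc.2]
    · obtain ⟨hS, rfl⟩ := hG
      rw [dot_congr hS hS]
      refine ⟨h1, ?_, h2⟩
      push_cast
      nlinarith

/-- X and Y collect the minimising and maximising product vectors. Both have trace W because each
update adds the same weight ν to either. -/
lemma Run.exists_sepCone (hE : toMat N d E = (q : ℝ) • ρ) {j : ℕ} {S : ℕ → GaussianInt} {W : ℤ}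
    (hr : Run d N h q M E j S W) :
    ∃ X Y : Matrix (Fin N → Fin d) (Fin N → Fin d) ℂ, X ∈ sepCone (fun _ => d) ∧
      Y ∈ sepCone (fun _ => d) ∧ X.trace = ((W : ℝ) : ℂ) ∧ Y.trace = ((W : ℝ) : ℂ) ∧
      toMat N d S = (q : ℝ) • ((h + 1 : ℝ) • X - Y - (h * W : ℝ) • ρ) := by
  induction hr with
  | zero h0 =>
    refine ⟨0, 0, Or.inl rfl, Or.inl rfl, by simp, by simp, ?_⟩
    rw [toMat_congr h0]
    ext x y
    simp [toMat]
  | @succ j S S' W W' _ hs ih =>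
    obtain ⟨X, Y, hX, hY, tX, tY, hS⟩ := ih
    obtain ⟨G, -, hG⟩ := hs
    split_ifs at hG with hc
    · obtain ⟨hS', rfl⟩ := hG
      have n0 : (0 : ℝ) ≤ normSq d N G 0 := by exact_mod_cast normSq_nonneg G 0
      have n1 : (0 : ℝ) ≤ normSq d N G 1 := by exact_mod_cast normSq_nonneg G 1
      refine ⟨X + (normSq d N G 1 : ℝ) • productProj (gaussVec (familyFin d N G 0)),
        Y + (normSq d N G 0 : ℝ) • productProj (gaussVec (familyFin d N G 1)),
        sepCone_add hX (sepCone_smul (productProj_mem_sepCone _) n1),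
        sepCone_add hY (sepCone_smul (productProj_mem_sepCone _) n0), ?_, ?_, ?_⟩
      · rw [Matrix.trace_add, Matrix.trace_smul, tX, trace_productProj, ← normSq_eq,
          Complex.real_smul]
        push_cast
        ring
      · rw [Matrix.trace_add, Matrix.trace_smul, tY, trace_productProj, ← normSq_eq,
          Complex.real_smul]
        push_cast
        ring
      · rw [toMat_congr hS', toMat_add, hS, toMat_update hE]
        push_cast
        module
    · obtain ⟨hS', rfl⟩ := hG
      exact ⟨X, Y, hX, hY, tX, tY, by rw [toMat_congr hS', hS]⟩

/-- If the final test succeeds, then the state is close to a separable one. -/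
lemma Run.exists_near (hE : toMat N d E = (q : ℝ) • ρ) (hρ : IsState ρ) (hh : 0 < h) (hq : 0 < q)
    {j : ℕ} {S : ℕ → GaussianInt} {W : ℤ} (hr : Run d N h q M E j S W)
    (ht : (d ^ N : ℕ) * dot (d ^ N * d ^ N) S S < (q * W) ^ 2) :
    ∃ σ ∈ separable (fun _ : Fin N => d), traceNorm (ρ - σ) < 3 / h := by
  obtain ⟨X, Y, hX, hY, tX, tY, hS⟩ := hr.exists_sepCone hE
  have hW0 := (hr.dot_le hE hρ hh).1
  -- The strict inequality in the test excludes W = 0, where nothing has been learned.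
  have hW : 0 < W := by
    rcases hW0.eq_or_lt with h0 | h0
    · rw [← h0] at ht
      have : 0 ≤ dot (d ^ N * d ^ N) S S :=
        Finset.sum_nonneg fun _ _ => add_nonneg (mul_self_nonneg _) (mul_self_nonneg _)
      have : (0 : ℤ) ≤ (d ^ N : ℕ) * dot (d ^ N * d ^ N) S S := by positivity
      rw [mul_zero, zero_pow two_ne_zero] at ht
      omega
    · exact h0
  have hWr : (0 : ℝ) < W := by exact_mod_cast hW
  have hσ := inv_trace_smul_mem_separable hX tX hWr.ne'
  have hσ' := inv_trace_smul_mem_separable hY tY hWr.ne'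
  set σ := (W : ℝ)⁻¹ • X with hσd
  set σ' := (W : ℝ)⁻¹ • Y with hσd'
  have sσ := isState_of_mem_separable hσ
  have sσ' := isState_of_mem_separable hσ'
  have hhr : (0 : ℝ) < h := by exact_mod_cast hh
  have hqr : (0 : ℝ) < q := by exact_mod_cast hq
  set c : ℝ := (q * h * W)⁻¹ with hc
  have hc0 : 0 < c := by positivity
  -- The identity for S solved for ρ. The first term has trace norm at most 2/h, and the test bounds
  -- the second by 1/h.
  have hdec : ρ - σ = ((h : ℝ)⁻¹ • σ - (h : ℝ)⁻¹ • σ') + (-c) • toMat N d S := by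
    rw [hS, hσd, hσd']
    simp only [smul_sub, smul_smul]
    have e1 : -c * (q * (h * W)) = -1 := by rw [hc]; field_simp
    have e2 : -c * (q * (h + 1 : ℝ)) = -(W : ℝ)⁻¹ - (h : ℝ)⁻¹ * (W : ℝ)⁻¹ := by
      rw [hc]; field_simp; ring
    have e3 : -c * q = -((h : ℝ)⁻¹ * (W : ℝ)⁻¹) := by rw [hc]; field_simp
    rw [e1, e2, e3]
    module
  have hA : ((h : ℝ)⁻¹ • σ).PosSemidef := sσ.1.smul (by positivity)
  have hB : ((h : ℝ)⁻¹ • σ').PosSemidef := sσ'.1.smul (by positivity)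
  have hT : ((-c) • toMat N d S).IsHermitian := by
    have : (-c) • toMat N d S = (ρ - σ) - ((h : ℝ)⁻¹ • σ - (h : ℝ)⁻¹ • σ') := by
      rw [hdec]; abel
    rw [this]
    exact (hρ.1.1.sub sσ.1.1).sub (hA.1.sub hB.1)
  refine ⟨σ, hσ, ?_⟩
  have t1 : traceNorm ((h : ℝ)⁻¹ • σ - (h : ℝ)⁻¹ • σ') ≤ 2 / h := by
    refine (traceNorm_sub_le hA hB).trans_eq ?_
    have e1 : ∀ τ : Matrix (Fin N → Fin d) (Fin N → Fin d) ℂ, IsState τ →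
        ((h : ℝ)⁻¹ • τ).trace.re = (h : ℝ)⁻¹ := fun τ hτ => by
      rw [Matrix.trace_smul, hτ.2]
      simp
    rw [e1 σ sσ, e1 σ' sσ']
    ring
  have t2 : traceNorm ((-c) • toMat N d S) < 1 / h := by
    refine (traceNorm_le_sqrt_mul hT).trans_lt ?_
    have h1 : ∑ x, ∑ y, ‖((-c) • toMat N d S) x y‖ ^ 2 =
        c ^ 2 * (dot (d ^ N * d ^ N) S S : ℝ) := by
      rw [dot_self_eq, Finset.mul_sum]
      refine Finset.sum_congr rfl fun x _ => ?_
      rw [Finset.mul_sum]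
      refine Finset.sum_congr rfl fun y _ => ?_
      rw [Matrix.smul_apply, norm_smul, mul_pow, norm_neg, Real.norm_eq_abs, sq_abs]
    rw [h1, Real.sqrt_lt' (by positivity)]
    have h2 : ((d ^ N : ℕ) : ℝ) * (dot (d ^ N * d ^ N) S S : ℝ) < (q * W) ^ 2 := by
      exact_mod_cast ht
    have h3 : (Fintype.card (Fin N → Fin d) : ℝ) = ((d ^ N : ℕ) : ℝ) := by simp
    rw [h3]
    calc _ = c ^ 2 * (((d ^ N : ℕ) : ℝ) * (dot (d ^ N * d ^ N) S S : ℝ)) := by ring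
      _ < c ^ 2 * (q * W) ^ 2 := by gcongr
      _ = _ := by rw [hc]; field_simp
  rw [hdec]
  refine (traceNorm_add_le (hA.1.sub hB.1) hT).trans_lt ?_
  have : (3 : ℝ) / h = 2 / h + 1 / h := by ring
  linarith

/-- The list of the coordinates of two families of vectors. -/
def coordinates {N d : ℕ} (g : Fin 2 → Fin N → Fin d → GaussianInt) (t : ℕ) : ℤ :=
  if h : t / 2 / d / N < 2 ∧ t / 2 / d % N < N ∧ t / 2 % d < d then
    if t % 2 = 0 then (g ⟨_, h.1⟩ ⟨_, h.2.1⟩ ⟨_, h.2.2⟩).re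
    else (g ⟨_, h.1⟩ ⟨_, h.2.1⟩ ⟨_, h.2.2⟩).im
  else 0

lemma coordinates_eq (g : Fin 2 → Fin N → Fin d → GaussianInt) (c : Fin 2) (i : Fin N)
    (a : Fin d) :
    coordinates g (2 * (d * (i + c * N) + a)) = (g c i a).re ∧
      coordinates g (2 * (d * (i + c * N) + a) + 1) = (g c i a).im := by
  have hd : 0 < d := a.pos
  have hN : 0 < N := i.pos
  have h1 : (d * ((i : ℕ) + c * N) + a) / d = i + c * N := by
    rw [Nat.mul_add_div hd, Nat.div_eq_of_lt a.2, add_zero]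
  have h2 : (d * ((i : ℕ) + c * N) + a) % d = a := by
    rw [Nat.mul_add_mod, Nat.mod_eq_of_lt a.2]
  have h3 : ((i : ℕ) + c * N) / N = c := by
    rw [Nat.add_mul_div_right _ _ hN, Nat.div_eq_of_lt i.2, zero_add]
  have h4 : ((i : ℕ) + c * N) % N = i := by
    rw [Nat.add_mul_mod_self_right, Nat.mod_eq_of_lt i.2]
  have e1 : 2 * (d * ((i : ℕ) + c * N) + a) / 2 = d * ((i : ℕ) + c * N) + a := by omega
  have e2 : (2 * (d * ((i : ℕ) + c * N) + a) + 1) / 2 = d * ((i : ℕ) + c * N) + a := by omega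
  have e3 : 2 * (d * ((i : ℕ) + c * N) + a) % 2 = 0 := by omega
  have e4 : (2 * (d * ((i : ℕ) + c * N) + a) + 1) % 2 = 1 := by omega
  constructor
  · simp only [coordinates, e1, e3, h1, h2, h3, h4, c.2, i.2, a.2, and_self, dite_true, if_true]
  · simp only [coordinates, e2, e4, h1, h2, h3, h4, c.2, i.2, a.2, and_self, dite_true]
    simp

lemma sum_coordinates (g : Fin 2 → Fin N → Fin d → GaussianInt) :
    ∑ t ∈ Finset.range (4 * d * N), (coordinates g t : ℝ) ^ 2 =
      ∑ c, ∑ i, ‖gaussVec (g c) i‖ ^ 2 := by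
  have h1 : 4 * d * N = 2 * N * d * 2 := by ring
  rw [h1, sum_range_mul, sum_range_mul, sum_range_mul, ← Fin.sum_univ_eq_sum_range
    (fun c => ∑ i ∈ Finset.range N, ∑ a ∈ Finset.range d, ∑ e ∈ Finset.range 2,
      (coordinates g (((c * N + i) * d + a) * 2 + e) : ℝ) ^ 2) 2]
  refine Finset.sum_congr rfl fun c _ => ?_
  rw [← Fin.sum_univ_eq_sum_range (fun i => ∑ a ∈ Finset.range d, ∑ e ∈ Finset.range 2,
      (coordinates g (((c * N + i) * d + a) * 2 + e) : ℝ) ^ 2) N]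
  refine Finset.sum_congr rfl fun i _ => ?_
  rw [← Fin.sum_univ_eq_sum_range (fun a => ∑ e ∈ Finset.range 2,
      (coordinates g (((c * N + i) * d + a) * 2 + e) : ℝ) ^ 2) d, EuclideanSpace.norm_sq_eq]
  refine Finset.sum_congr rfl fun a _ => ?_
  have h2 : (((c : ℕ) * N + i) * d + a) * 2 = 2 * (d * (i + c * N) + a) := by ring
  obtain ⟨c1, c2⟩ := coordinates_eq g c i a
  rw [Finset.sum_range_succ, Finset.sum_range_one, add_zero, h2, c1, c2,
    ← Complex.normSq_eq_norm_sq, Complex.normSq_apply]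
  simp only [gaussVec, ← GaussianInt.intCast_re, ← GaussianInt.intCast_im]
  ring

/-- The codes of families of short vectors are small. -/
lemma encode_coordinates_lt (hd : 0 < d) (hN : 0 < N) {κ : ℕ} (hκ : 3 ≤ κ)
    (g : Fin 2 → Fin N → Fin d → GaussianInt)
    (hg : ∀ c i, ‖gaussVec (g c) i‖ ^ 2 ≤ ((κ : ℝ) + 1) ^ 2 * d) :
    encode ((List.range (4 * d * N)).map (coordinates g)) < (16 * κ) ^ (8 * d * N) := by
  set n := 4 * d * N with hn
  have hκr : (3 : ℝ) ≤ κ := by exact_mod_cast hκ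
  -- A vector has 2d real coordinates and squared norm at most (κ + 1)²d, so d drops out of the
  -- average 64κ². Afterwards 3 · 64 ≤ 16² turns the product bound into (16κ)^(2n).
  have h1 : ∑ t ∈ Finset.range n, (16 * ((|coordinates g t| : ℤ) + 1 : ℝ) ^ 2) ≤
      n * (64 * (κ : ℝ) ^ 2) := by
    have h2 : ∑ t ∈ Finset.range n, (coordinates g t : ℝ) ^ 2 ≤ 2 * (N * ((κ + 1) ^ 2 * d)) := by
      rw [hn, sum_coordinates]
      refine (Finset.sum_le_sum fun c _ => Finset.sum_le_sum fun i _ => hg c i).trans_eq ?_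
      simp
    calc _ ≤ ∑ t ∈ Finset.range n, (32 * (coordinates g t : ℝ) ^ 2 + 32) := by
          refine Finset.sum_le_sum fun t _ => ?_
          push_cast
          nlinarith [sq_nonneg (|(coordinates g t : ℝ)| - 1), sq_abs (coordinates g t : ℝ)]
      _ = 32 * (∑ t ∈ Finset.range n, (coordinates g t : ℝ) ^ 2) + n * 32 := by
          rw [Finset.sum_add_distrib, ← Finset.mul_sum]
          simp
      _ ≤ 32 * (2 * (N * ((κ + 1) ^ 2 * d))) + n * 32 := by gcongr
      _ = n * (16 * (κ + 1) ^ 2 + 32) := by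
          rw [hn]; push_cast; ring
      _ ≤ _ := by gcongr; nlinarith
  have h3 := prod_le_pow_of_sum_le (by positivity) _ (fun t => by positivity) h1
  have h4 := encode_lt ((List.range n).map (coordinates g))
  rw [List.map_map] at h4
  have h5 : ((((List.range n).map ((fun g : ℤ => 16 * (g.natAbs + 1) ^ 2) ∘
      coordinates g)).prod : ℕ) : ℝ) =
      ∏ t ∈ Finset.range n, (16 * ((|coordinates g t| : ℤ) + 1 : ℝ) ^ 2) := by
    rw [show ((List.range n).map ((fun g : ℤ => 16 * (g.natAbs + 1) ^ 2) ∘ coordinates g)).prod =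
      ∏ t ∈ Finset.range n, 16 * ((coordinates g t).natAbs + 1) ^ 2 from rfl]
    push_cast
    refine Finset.prod_congr rfl fun t _ => ?_
    simp [Nat.cast_natAbs]
  have h6 : (encode ((List.range n).map (coordinates g)) : ℝ) + 1 ≤
      ((16 * κ : ℕ) : ℝ) ^ (8 * d * N) := by
    calc _ ≤ ((((List.range n).map ((fun g : ℤ => 16 * (g.natAbs + 1) ^ 2) ∘
          coordinates g)).prod : ℕ) : ℝ) := by exact_mod_cast h4
      _ ≤ (3 * (64 * (κ : ℝ) ^ 2)) ^ n := by rw [h5]; exact h3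
      _ ≤ ((16 * κ : ℝ) ^ 2) ^ n := by gcongr; nlinarith
      _ = _ := by
        rw [← pow_mul, hn]
        push_cast
        congr 1
        ring
  exact_mod_cast h6

end Perceptron

/-! ### Progress of the perceptron on separable states -/

section Progress

variable {d N h q M : ℕ} {E : ℕ → GaussianInt} {ρ : Matrix (Fin N → Fin d) (Fin N → Fin d) ℂ}

/-- Only the first 4dN integers matter: two families of N vectors with d complex coordinates. The
rest of the array may hold remnants of earlier codes. -/
lemma psi_congr (hd : 0 < d) {G G' : ℕ → ℤ} (hG : ∀ t < 4 * d * N, G t = G' t) {c : ℕ}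
    (hc : c < 2) (x : ℕ) : psi d N G c x = psi d N G' c x := by
  refine Finset.prod_congr rfl fun i hi => ?_
  have hi := Finset.mem_range.1 hi
  have h1 : x / d ^ i % d < d := Nat.mod_lt _ hd
  have h2 : i + c * N + 1 ≤ 2 * N := by nlinarith
  have h3 : d * (i + c * N + 1) ≤ d * (2 * N) := Nat.mul_le_mul_left _ h2
  have h4 : 2 * (d * (i + c * N) + x / d ^ i % d) + 1 < 4 * d * N := by nlinarith
  rw [family, family, hG _ h4, hG _ (by omega)]

lemma normSq_congr (hd : 0 < d) {G G' : ℕ → ℤ} (hG : ∀ t < 4 * d * N, G t = G' t) {c : ℕ}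
    (hc : c < 2) : normSq d N G c = normSq d N G' c := by
  simp only [normSq, psi_congr hd hG hc]

lemma update_congr (hd : 0 < d) {G G' : ℕ → ℤ} (hG : ∀ t < 4 * d * N, G t = G' t) :
    update d N h q E G = update d N h q E G' := by
  funext m
  simp only [update, psi_congr hd hG two_pos, psi_congr hd hG one_lt_two,
    normSq_congr hd hG two_pos, normSq_congr hd hG one_lt_two]

/-- The update that is listed by `G` makes progress. -/
def Useful (d N h q M : ℕ) (E : ℕ → GaussianInt) (S : ℕ → GaussianInt) (G : ℕ → ℤ) : Prop :=
  0 < normSq d N G 0 * normSq d N G 1 ∧ normSq d N G 0 * normSq d N G 1 ≤ M ∧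
    dot (d ^ N * d ^ N) S (update d N h q E G) ≤ 0

/-- The pair of `exists_gaussVec_pair` for the functional ⟨S, ·⟩. Its code is below M, so one sweep
over the residues modulo M meets it, and the bound on its squared norms also keeps the weight below
M. -/
lemma exists_useful (hN : 0 < N) (hd : 0 < d) (hh : 0 < h)
    (hE : toMat N d E = (q : ℝ) • ρ) (hρ : ρ ∈ separable (fun _ : Fin N => d))
    (hM : M = (16 * (8 * N * h)) ^ (8 * d * N)) (S : ℕ → GaussianInt) :
    ∃ l : List ℤ, l.length = 4 * d * N ∧ encode l < M ∧
      ∀ G : ℕ → ℤ, (∀ i (hi : i < l.length), G i = l[i]) → Useful d N h q M E S G := by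
  obtain ⟨g, hg0, hg1, hg2⟩ := exists_gaussVec_pair hN hd hh hρ (dotMat N d S)
  have hNh : 0 < N * h := Nat.mul_pos hN hh
  have hκ : 3 ≤ 8 * N * h := by nlinarith
  refine ⟨(List.range (4 * d * N)).map (coordinates g), by simp,
    hM ▸ encode_coordinates_lt hd hN hκ g hg1, fun G hG => ?_⟩
  have hfam : ∀ c : Fin 2, familyFin d N G c = g c := by
    intro c
    funext i a
    have hi : (i : ℕ) + c * N + 1 ≤ 2 * N := by nlinarith [c.2, i.2]
    have h3 : d * ((i : ℕ) + c * N + 1) ≤ d * (2 * N) := Nat.mul_le_mul_left _ hi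
    have h4 : 2 * (d * ((i : ℕ) + c * N) + a) + 1 < 4 * d * N := by nlinarith [a.2]
    obtain ⟨e1, e2⟩ := coordinates_eq g c i a
    have e3 := hG (2 * (d * ((i : ℕ) + c * N) + a)) (by simp; omega)
    have e4 := hG (2 * (d * ((i : ℕ) + c * N) + a) + 1) (by simp; omega)
    simp only [List.getElem_map, List.getElem_range, e1, e2] at e3 e4
    rw [familyFin, family, e3, e4]
  have f0 := hfam 0
  have f1 := hfam 1
  simp only [Fin.val_zero, Fin.val_one] at f0 f1
  set n0 := ∏ i, ‖gaussVec (g 0) i‖ ^ 2 with hn0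
  set n1 := ∏ i, ‖gaussVec (g 1) i‖ ^ 2 with hn1
  have m0 : (normSq d N G 0 : ℝ) = n0 := by rw [normSq_eq, f0]
  have m1 : (normSq d N G 1 : ℝ) = n1 := by rw [normSq_eq, f1]
  have p0 : 0 < n0 := hg0 0
  have p1 : 0 < n1 := hg0 1
  refine ⟨?_, ?_, ?_⟩
  · have : (0 : ℝ) < normSq d N G 0 * normSq d N G 1 := by rw [m0, m1]; positivity
    exact_mod_cast this
  · have hb : ∀ c, ∏ i, ‖gaussVec (g c) i‖ ^ 2 ≤ ((((8 * N * h : ℕ) : ℝ) + 1) ^ 2 * d) ^ N :=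
      fun c => by
        refine (Finset.prod_le_prod (fun i _ => by positivity) fun i _ => hg1 c i).trans_eq ?_
        simp
    have h1 : (8 * N * h + 1) ^ 2 * d ≤ (16 * (8 * N * h)) ^ (4 * d) := by
      calc _ ≤ (16 * (8 * N * h)) ^ 2 * (16 * (8 * N * h)) ^ d := by
            gcongr
            · omega
            · exact (Nat.lt_pow_self (by omega)).le
        _ = (16 * (8 * N * h)) ^ (2 + d) := by rw [pow_add]
        _ ≤ _ := Nat.pow_le_pow_right (by omega) (by omega)
    have h2 : n0 * n1 ≤ (M : ℝ) := by
      calc n0 * n1 ≤ ((((8 * N * h : ℕ) : ℝ) + 1) ^ 2 * d) ^ N *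
            ((((8 * N * h : ℕ) : ℝ) + 1) ^ 2 * d) ^ N := by
            gcongr
            · exact hb 0
            · exact hb 1
        _ = (((8 * N * h + 1) ^ 2 * d) ^ (2 * N) : ℕ) := by push_cast; ring
        _ ≤ (((16 * (8 * N * h)) ^ (4 * d)) ^ (2 * N) : ℕ) := by
            exact_mod_cast Nat.pow_le_pow_left h1 _
        _ = _ := by rw [hM, ← pow_mul]; congr 2; ring
    rw [← m0, ← m1] at h2
    exact_mod_cast h2
  · have : (dot (d ^ N * d ^ N) S (update d N h q E G) : ℝ) ≤ 0 := by
      rw [dot_eq, toMat_update hE, f0, f1, m0, m1]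
      simp only [map_smul, map_sub, smul_eq_mul]
      refine mul_nonpos_of_nonneg_of_nonpos (by positivity) ?_
      linarith
    exact_mod_cast this

lemma eq_zero_of_dot_self_nonpos {n : ℕ} {T : ℕ → GaussianInt} (hT : dot n T T ≤ 0) :
    ∀ m < n, T m = 0 := by
  have h0 : ∀ m ∈ Finset.range n, 0 ≤ (T m).re * (T m).re + (T m).im * (T m).im :=
    fun _ _ => add_nonneg (mul_self_nonneg _) (mul_self_nonneg _)
  intro m hm
  have h1 := (Finset.sum_eq_zero_iff_of_nonneg h0).1 (le_antisymm hT (Finset.sum_nonneg h0)) m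
    (Finset.mem_range.2 hm)
  obtain ⟨h2, h3⟩ := (add_eq_zero_iff_of_nonneg (mul_self_nonneg _) (mul_self_nonneg _)).1 h1
  exact Zsqrtd.ext (mul_self_eq_zero.1 h2) (mul_self_eq_zero.1 h3)

/-- Each sweep of M steps raises W by at least one. Within a sweep, either this has happened
already, or S has not changed and all codes tried so far are useless for it; the second alternative
cannot survive a full sweep, because a useful code exists for every S. -/
lemma Run.le_of_mem_separable (hN : 0 < N) (hd : 0 < d) (hh : 0 < h)
    (hE : toMat N d E = (q : ℝ) • ρ) (hρ : ρ ∈ separable (fun _ : Fin N => d))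
    (hM : M = (16 * (8 * N * h)) ^ (8 * d * N)) {j : ℕ} {S : ℕ → GaussianInt} {W : ℤ}
    (hr : Run d N h q M E j S W) :
    ((j / M : ℕ) : ℤ) ≤ W ∧ (((j / M : ℕ) : ℤ) + 1 ≤ W ∨
      ∀ l : List ℤ, l.length = 4 * d * N → encode l < j % M →
        ∀ G : ℕ → ℤ, (∀ i (hi : i < l.length), G i = l[i]) → ¬ Useful d N h q M E S G) := by
  have hM0 : 0 < M := by
    rw [hM]
    have := Nat.mul_pos hN hh
    exact pow_pos (by nlinarith) _
  induction hr with
  | zero h0 => exact ⟨by simp, Or.inr fun l _ hl => absurd hl (by simp)⟩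
  | @succ j S S' W W' hr hs ih =>
    obtain ⟨h1, h2⟩ := ih
    obtain ⟨G, hGl, hG⟩ := hs
    have hν0 : 0 ≤ normSq d N G 0 * normSq d N G 1 :=
      mul_nonneg (normSq_nonneg _ _) (normSq_nonneg _ _)
    have key : W ≤ W' ∧ (((j / M : ℕ) : ℤ) + 1 ≤ W' ∨
        ∀ l : List ℤ, l.length = 4 * d * N → encode l < j % M + 1 →
          ∀ G : ℕ → ℤ, (∀ i (hi : i < l.length), G i = l[i]) →
            ¬ Useful d N h q M E S' G) := by
      by_cases hu : Useful d N h q M E S G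
      · rw [if_pos hu.2] at hG
        have := hu.1
        exact ⟨by omega, Or.inl (by omega)⟩
      · have hW : W' = W ∧ ∀ m < d ^ N * d ^ N, S' m = S m := by
          split_ifs at hG with hc
          · have h3 : normSq d N G 0 * normSq d N G 1 = 0 :=
              le_antisymm (not_lt.1 fun h => hu ⟨h, hc⟩) hν0
            have h4 := dot_update_le hE (isState_of_mem_separable hρ) hh G
            rw [h3, mul_zero, zero_pow two_ne_zero, mul_zero] at h4
            refine ⟨by omega, fun m hm => ?_⟩
            rw [hG.1 m hm, eq_zero_of_dot_self_nonpos h4 m hm, add_zero]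
          · exact ⟨hG.2, hG.1⟩
        refine ⟨hW.1.ge, ?_⟩
        rw [hW.1]
        refine h2.imp id fun h2 l hl hl' G' hG' hu' => ?_
        have hu'' : Useful d N h q M E S G' :=
          ⟨hu'.1, hu'.2.1, by rw [← dot_congr hW.2 fun _ _ => rfl]; exact hu'.2.2⟩
        rcases Nat.lt_succ_iff_lt_or_eq.1 hl' with h5 | h5
        · exact h2 l hl h5 G' hG' hu''
        · have hGG : ∀ t < 4 * d * N, G' t = G t := fun t ht => by
            rw [hG' t (hl ▸ ht), hGl l h5 t (hl ▸ ht)]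
          refine hu ?_
          unfold Useful at hu'' ⊢
          rwa [← normSq_congr hd hGG two_pos, ← normSq_congr hd hGG one_lt_two,
            ← update_congr hd hGG]
    by_cases hj : j % M + 1 = M
    · have e1 : (j + 1) / M = j / M + 1 := by
        rw [Nat.succ_div, if_pos]
        rw [Nat.dvd_iff_mod_eq_zero, Nat.add_mod, ← Nat.mod_add_mod, Nat.mod_mod]
        simp [hj]
      have e2 : (j + 1) % M = 0 := by
        rw [Nat.add_mod, ← Nat.mod_add_mod, Nat.mod_mod]
        simp [hj]
      have h6 : ((j / M : ℕ) : ℤ) + 1 ≤ W' := by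
        refine key.2.resolve_right fun h7 => ?_
        obtain ⟨l, hl, hl', hu⟩ := exists_useful hN hd hh hE hρ hM S'
        have hG0 : ∀ i (hi : i < l.length), (fun i => l.getD i 0) i = l[i] := fun i hi => by
          simp [hi]
        exact h7 l hl (by omega) _ hG0 (hu _ hG0)
      rw [e1, e2]
      exact ⟨by push_cast; omega, Or.inr fun l _ hl => absurd hl (by simp)⟩
    · have hlt := Nat.mod_lt j hM0
      have e1 : (j + 1) / M = j / M := by
        rw [← Nat.div_add_mod j M, add_assoc, Nat.mul_add_div hM0,
          Nat.div_eq_of_lt (by omega : j % M + 1 < M), Nat.mul_add_div hM0, Nat.div_eq_of_lt hlt]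
      have e2 : (j + 1) % M = j % M + 1 := by
        rw [← Nat.mod_add_mod, Nat.mod_eq_of_lt (by omega : j % M + 1 < M)]
      rw [e1, e2]
      exact ⟨h1.trans key.1, key.2⟩

/-- The final test succeeds for separable states. -/
lemma Run.test_of_mem_separable (hN : 0 < N) (hd : 0 < d) (hh : 0 < h) (hq : 0 < q)
    (hE : toMat N d E = (q : ℝ) • ρ) (hρ : ρ ∈ separable (fun _ : Fin N => d))
    (hM : M = (16 * (8 * N * h)) ^ (8 * d * N)) {S : ℕ → GaussianInt} {W : ℤ}
    (hr : Run d N h q M E (32 * d ^ N * h * h * M * M) S W) :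
    (d ^ N : ℕ) * dot (d ^ N * d ^ N) S S < (q * W) ^ 2 := by
  have hM0 : 0 < M := by
    rw [hM]
    have := Nat.mul_pos hN hh
    exact pow_pos (by nlinarith) _
  have hD : 0 < d ^ N := pow_pos hd N
  have h1 := (hr.le_of_mem_separable hN hd hh hE hρ hM).1
  rw [Nat.mul_div_cancel _ hM0] at h1
  obtain ⟨-, -, h2⟩ := hr.dot_le hE (isState_of_mem_separable hρ) hh
  have hW : 0 < W := lt_of_lt_of_le (by exact_mod_cast (by positivity)) h1
  -- After 32 D h² M sweeps, with D = d^N, W is at least that number, and 18 < 32 leaves the test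
  -- strict.
  have h3 : (d ^ N : ℕ) * dot (d ^ N * d ^ N) S S ≤
      (d ^ N : ℕ) * (18 * (q * h) ^ 2 * M * W) := mul_le_mul_of_nonneg_left h2 (by positivity)
  refine h3.trans_lt ?_
  calc ((d ^ N : ℕ) : ℤ) * (18 * (q * h) ^ 2 * M * W)
      < (32 * d ^ N * h * h * M : ℕ) * ((q : ℤ) ^ 2 * W) := by
        have : (0 : ℤ) < (d ^ N : ℕ) * ((q : ℤ) * h) ^ 2 * M * W := by positivity
        push_cast at this ⊢
        nlinarith
    _ ≤ W * ((q : ℤ) ^ 2 * W) := mul_le_mul_of_nonneg_right h1 (by positivity)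
    _ = _ := by ring

end Progress

/-! ### The program -/

section Code

open SymExt.Expr (lit)

instance : Add Expr := ⟨Expr.add⟩

instance : Sub Expr := ⟨Expr.sub⟩

instance : Mul Expr := ⟨Expr.mul⟩

instance : Div Expr := ⟨Expr.div⟩

@[simp] lemma eval_hAdd (s : Mem) (a b : Expr) : (a + b).eval s = a.eval s + b.eval s := rfl

@[simp] lemma eval_hSub (s : Mem) (a b : Expr) : (a - b).eval s = a.eval s - b.eval s := rfl

@[simp] lemma eval_hMul (s : Mem) (a b : Expr) : (a * b).eval s = a.eval s * b.eval s := rfl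

@[simp] lemma eval_hDiv (s : Mem) (a b : Expr) : (a / b).eval s = a.eval s / b.eval s := rfl

variable {V : ℤ} {s : Mem} {Q : Mem → Prop}

lemma reaches_setVar {k : ℕ} {e : Expr} (x : ℤ) (he : e.eval s = x) (hx : |x| ≤ V)
    (hQ : Q (Function.update s (var k) x)) : Reaches V (setVar k e) 1 s Q :=
  reaches_store (by rwa [he]) (by rw [he]; exact hQ)

lemma reaches_setArr {r : ℕ} {i e : Expr} (k : ℕ) (x : ℤ) (hi : i.eval s = k)
    (he : e.eval s = x) (hx : |x| ≤ V) (hQ : Q (Function.update s (arr r k) x)) :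
    Reaches V (setArr r i e) 1 s Q :=
  reaches_store (by rwa [he]) (by rw [he, eval_arrAddr hi]; exact hQ)

/-- Reads one digit of a code: variables `5`, `6`, `7` hold the code, the index and the digit,
array `0` holds the decoded integers. -/
def decodeStep : Program :=
  .seq (setVar 7 (getVar 5 - lit 4 * (getVar 5 / lit 4)))
  (.seq (setVar 5 (getVar 5 / lit 4))
  (.cond (getVar 7 - lit 2)
    (.seq (setVar 6 (getVar 6 + lit 1)) (setArr 0 (getVar 6) (lit 0)))
    (setArr 0 (getVar 6) (lit 2 * getArr 0 (getVar 6) + getVar 7 - lit 1))))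

/-- Decodes the remainder of variable `4` modulo variable `2`. -/
def decodeProgram : Program :=
  .seq (setVar 5 (getVar 4 - getVar 2 * (getVar 4 / getVar 2)))
  (.seq (setVar 6 (lit 0))
  (.seq (setArr 0 (lit 0) (lit 0))
  (.loop (getVar 5) decodeStep)))

/-- The invariant of the decoding loop. -/
structure Decoding (M z : ℕ) (G₀ : ℕ → ℤ) (s₀ : Mem) (n : ℕ) (s : Mem) : Prop where
  frame : Frame [5, 6, 7] [0] s₀ s
  code : s (var 5) = n
  state : ∃ (k : ℕ) (G : ℕ → ℤ), s (var 6) = k ∧ (∀ i, s (arr 0 i) = G i) ∧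
    decode n k G = decode z 0 G₀ ∧ ((G k).natAbs + 1) * (n + 1) ≤ M ∧ k + n ≤ M ∧
    ∀ i, (G i).natAbs ≤ M

/-- The product (|current integer| + 1)(remaining code + 1) never grows: a digit at most doubles the
first factor and at least halves the second. Hence decoded integers stay below M. -/
lemma reaches_decodeStep {M z : ℕ} {G₀ : ℕ → ℤ} {s₀ : Mem} {n : ℕ} (hn : 0 < n)
    (hs : Decoding M z G₀ s₀ n s) (hV : (M : ℤ) + 3 ≤ V) :
    Reaches V decodeStep 5 s (Decoding M z G₀ s₀ (n / 4)) := by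
  obtain ⟨hF, h5, k, G, h6, hG, hdec, hb, hk, hGM⟩ := hs
  have hV3 : 3 ≤ V := by omega
  have e4 : (n : ℤ) - 4 * (n / 4) = ((n % 4 : ℕ) : ℤ) := by omega
  refine reaches_seq (n := 1) (n' := 4) (reaches_setVar ((n % 4 : ℕ) : ℤ) (by simp [h5, e4])
    (by rw [abs_of_nonneg] <;> omega) ?_)
  refine reaches_seq (n := 1) (n' := 3) (reaches_setVar ((n / 4 : ℕ) : ℤ) (by simp [h5])
    (by rw [abs_of_nonneg] <;> omega) ?_)
  rw [decode, if_neg (by omega)] at hdec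
  refine reaches_cond (n := 2) (fun hp => ?_) (fun hp => ?_)
  · simp at hp
    rw [if_pos (by omega)] at hdec
    refine reaches_seq (n := 1) (n' := 1) (reaches_setVar ((k + 1 : ℕ) : ℤ) (by simp [h6])
      (by rw [abs_of_nonneg] <;> omega) ?_)
    refine reaches_setArr (k + 1) 0 (by simp) (by simp) (by simp; omega) ?_
    refine ⟨?_, by simp, k + 1, Function.update G (k + 1) 0, by simp, fun i => ?_, hdec, ?_, ?_,
      fun i => ?_⟩
    · exact (((hF.set_var (by simp) _).set_var (by simp) _).set_var (by simp) _).set_arr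
        (by simp) _ _
    · by_cases hi : i = k + 1
      · simp [hi]
      · simp [hi, hG]
    · simp
      nlinarith [Nat.div_le_self n 4]
    · omega
    · by_cases hi : i = k + 1
      · simp [hi]
      · simp [hi, hGM]
  · simp at hp
    have h3 : n % 4 ≠ 3 := by omega
    rw [if_neg h3] at hdec
    have hb' := abs_decode_step (G := G) hn hb h3
    have hM' : (2 * G k + (n % 4 : ℕ) - 1).natAbs ≤ M :=
      (Nat.le_succ _).trans ((Nat.le_mul_of_pos_right _ (Nat.succ_pos _)).trans hb')
    refine Reaches.mono (n := 1) (reaches_setArr k (2 * G k + (n % 4 : ℕ) - 1) (by simp [h6]) ?_ ?_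
      ?_) (by omega) fun _ h => h
    · simp only [eval_hSub, eval_hAdd, eval_hMul, eval_lit, eval_getVar]
      rw [eval_getArr (k := k) (by simp [h6])]
      simp [hG]
    · rw [Int.abs_eq_natAbs]; omega
    · refine ⟨?_, by simp, k, Function.update G k (2 * G k + (n % 4 : ℕ) - 1), by simp [h6],
        fun i => ?_, hdec, by simpa using hb', by omega, fun i => ?_⟩
      · exact ((hF.set_var (by simp) _).set_var (by simp) _).set_arr (by simp) _ _
      · by_cases hi : i = k
        · simp [hi]
        · simp [hi, hG]
      · by_cases hi : i = k
        · simpa [hi] using hM'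
        · simp [hi, hGM]

/-- `G` starts with the integers that are listed by the code `z`. -/
def Decodes (z : ℕ) (G : ℕ → ℤ) : Prop :=
  ∀ l : List ℤ, encode l = z → ∀ i (hi : i < l.length), G i = l[i]

lemma reaches_decodeProgram {M j : ℕ} (hM : 0 < M) (h2 : s (var 2) = M) (h4 : s (var 4) = j)
    (hG : ∀ i, (s (arr 0 i)).natAbs ≤ M) (hV : (M : ℤ) + 3 ≤ V) :
    Reaches V decodeProgram (6 * M + 4) s fun s' => Frame [5, 6, 7] [0] s s' ∧
      Decodes (j % M) (fun i => s' (arr 0 i)) ∧ ∀ i, (s' (arr 0 i)).natAbs ≤ M := by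
  have hlt := Nat.mod_lt j hM
  have e1 : (j : ℤ) - M * (j / M) = ((j % M : ℕ) : ℤ) := by
    have := Int.emod_def (j : ℤ) M
    push_cast
    linarith
  refine Reaches.mono (n := 1 + (1 + (1 + ((j % M) * (1 + 5) + 1)))) ?_ (by omega) fun _ h => h
  refine reaches_seq (reaches_setVar ((j % M : ℕ) : ℤ) (by simp [h2, h4, e1])
    (by rw [abs_of_nonneg] <;> omega) ?_)
  refine reaches_seq (reaches_setVar 0 (by simp) (by simp; omega) ?_)
  refine reaches_seq (reaches_setArr 0 0 (by simp) (by simp) (by simp; omega) ?_)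
  -- Only cell 0 is cleared in advance; each later cell is cleared when a separator is read. Stale
  -- cells beyond are harmless but must be known to be at most M.
  set G₀ := Function.update (fun i => s (arr 0 i)) 0 0 with hG₀
  refine reaches_loop (Decoding M (j % M) G₀ s) ?_ ?_ (j % M) ?_
  · intro n s' hs hp
    have hn : 0 < n := by
      simp only [eval_getVar, hs.code] at hp
      exact_mod_cast hp
    exact ⟨n / 4, by omega, reaches_decodeStep hn hs hV⟩
  · rintro n s' ⟨hF, h5, k, G, h6, hG', hdec, hb, hk, hGM⟩ hp
    have hn : n = 0 := by
      simp only [eval_getVar, h5] at hp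
      omega
    subst hn
    rw [decode, if_pos rfl] at hdec
    refine ⟨hF, ?_, fun i => by rw [hG']; exact hGM i⟩
    rintro l hl i hi
    have := (decode_encode l 0 (G := G₀) (by simp [hG₀])).1 i hi
    rw [hl, zero_add, ← hdec] at this
    exact (hG' i).trans this
  · refine ⟨?_, by simp, 0, G₀, by simp, fun i => ?_, rfl, by simp [hG₀]; omega, by omega,
      fun i => ?_⟩
    · exact (((Frame.refl _ _ s).set_var (by simp) _).set_var (by simp) _).set_arr (by simp) _ _
    · by_cases hi : i = 0
      · simp [hi, hG₀]
      · simp [hi, hG₀]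
    · by_cases hi : i = 0
      · simp [hi, hG₀]
      · simpa [hi, hG₀] using hG i

end Code

/-! ### Program: coordinates of tensor products -/

section Code

open SymExt.Expr (lit)

variable {V : ℤ} {s : Mem} {N d M : ℕ}

/-- Multiplies the number in variables `11`, `12` with the next coordinate. -/
def psiStep : Program :=
  .seq (setVar 13 (getInp 1 * (getVar 9 + getVar 19 * getInp 0) +
    (getVar 10 - getInp 1 * (getVar 10 / getInp 1))))
  (.seq (setVar 10 (getVar 10 / getInp 1))
  (.seq (setVar 14 (getVar 11 * getArr 0 (lit 2 * getVar 13) -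
    getVar 12 * getArr 0 (lit 2 * getVar 13 + lit 1)))
  (.seq (setVar 12 (getVar 11 * getArr 0 (lit 2 * getVar 13 + lit 1) +
    getVar 12 * getArr 0 (lit 2 * getVar 13)))
  (setVar 11 (getVar 14)))))

/-- Computes the coordinate with the number in variable `8` of the two tensor products. -/
def psiProgram : Program :=
  .seq (setVar 19 (getVar 8 / getVar 1))
  (.seq (setVar 10 (getVar 8 - getVar 1 * (getVar 8 / getVar 1)))
  (.seq (setVar 11 (lit 1))
  (.seq (setVar 12 (lit 0))
  (forLoop 9 (getInp 0) psiStep))))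

lemma abs_mul_add_le {a b x y A X : ℤ} (ha : |a| ≤ A) (hb : |b| ≤ A) (hx : |x| ≤ X)
    (hy : |y| ≤ X) : |a * x - b * y| ≤ A * (2 * X) ∧ |a * y + b * x| ≤ A * (2 * X) := by
  have hA : 0 ≤ A := (abs_nonneg _).trans ha
  have h1 : ∀ {u v : ℤ}, |u| ≤ A → |v| ≤ X → |u * v| ≤ A * X := fun hu hv => by
    rw [abs_mul]; exact mul_le_mul hu hv (abs_nonneg _) hA
  constructor
  · refine (abs_sub _ _).trans ?_
    linarith [h1 ha hx, h1 hb hy]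
  · refine (abs_add_le _ _).trans ?_
    linarith [h1 ha hy, h1 hb hx]

/-- Each multiplication of Gaussian integers at most doubles the product of the coordinate bounds.
-/
lemma abs_prod_le {A : ℤ} (f : ℕ → GaussianInt) (hf : ∀ i, |(f i).re| ≤ A ∧ |(f i).im| ≤ A)
    (n : ℕ) : |(∏ i ∈ Finset.range n, f i).re| ≤ (2 * A) ^ n ∧
      |(∏ i ∈ Finset.range n, f i).im| ≤ (2 * A) ^ n := by
  induction n with
  | zero => simp
  | succ n ih =>
    rw [Finset.prod_range_succ, pow_succ, Zsqrtd.re_mul, Zsqrtd.im_mul]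
    have := abs_mul_add_le ih.1 ih.2 (hf n).1 (hf n).2
    refine ⟨le_trans (le_of_eq ?_) this.1, this.2⟩
    congr 1
    ring

lemma abs_psi_le {G : ℕ → ℤ} (hG : ∀ i, (G i).natAbs ≤ M) (c x : ℕ) :
    |(psi d N G c x).re| ≤ (2 * M : ℤ) ^ N ∧ |(psi d N G c x).im| ≤ (2 * M : ℤ) ^ N := by
  have h1 : ∀ i, |G i| ≤ M := fun i => by rw [Int.abs_eq_natAbs]; exact_mod_cast hG i
  exact abs_prod_le _ (fun i => ⟨h1 _, h1 _⟩) N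

lemma abs_natCast_le {a n : ℕ} (h : a ≤ n) (hn : (n : ℤ) ≤ V) : |(a : ℤ)| ≤ V := by
  rw [Nat.abs_cast]
  exact le_trans (by exact_mod_cast h) hn

lemma natCast_sub_mul_div (x d : ℕ) : (x : ℤ) - d * (x / d) = ((x % d : ℕ) : ℤ) := by
  have := Int.emod_def (x : ℤ) d
  push_cast
  linarith

lemma reaches_psiStep {i c y : ℕ} {z : GaussianInt} {G : ℕ → ℤ} {A : ℤ}
    (hN : s (inp 0) = N) (hds : s (inp 1) = d) (h9 : s (var 9) = i) (h19 : s (var 19) = c)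
    (h10 : s (var 10) = y) (h11 : s (var 11) = z.re) (h12 : s (var 12) = z.im)
    (hG : ∀ i, s (arr 0 i) = G i) (hGM : ∀ i, |G i| ≤ M)
    (hz : |z.re| ≤ A ∧ |z.im| ≤ A) (hA : A * (2 * M) ≤ V) (hy : (y : ℤ) ≤ V)
    (ht : ((d * (i + c * N) + y % d : ℕ) : ℤ) ≤ V) :
    Reaches V psiStep 5 s fun s' => Frame [10, 11, 12, 13, 14] [] s s' ∧
      s' (var 10) = (y / d : ℕ) ∧
      s' (var 11) = (z * ⟨G (2 * (d * (i + c * N) + y % d)),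
        G (2 * (d * (i + c * N) + y % d) + 1)⟩).re ∧
      s' (var 12) = (z * ⟨G (2 * (d * (i + c * N) + y % d)),
        G (2 * (d * (i + c * N) + y % d) + 1)⟩).im := by
  have e := natCast_sub_mul_div y d
  generalize htd : d * (i + c * N) + y % d = t at *
  obtain ⟨b1, b2⟩ := abs_mul_add_le hz.1 hz.2 (hGM (2 * t)) (hGM (2 * t + 1))
  have hre : (z * ⟨G (2 * t), G (2 * t + 1)⟩).re = z.re * G (2 * t) - z.im * G (2 * t + 1) := by
    rw [Zsqrtd.re_mul]
    ring
  have him : (z * ⟨G (2 * t), G (2 * t + 1)⟩).im = z.re * G (2 * t + 1) + z.im * G (2 * t) :=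
    Zsqrtd.im_mul _ _
  rw [hre, him]
  refine reaches_seq (n := 1) (n' := 4)
    (reaches_setVar (t : ℤ) ?_ (abs_natCast_le le_rfl ht) ?_)
  · simp only [eval_hAdd, eval_hMul, eval_hSub, eval_hDiv, eval_getInp, eval_getVar, hN,
      hds, h9, h10, h19, e]
    rw [← htd]
    push_cast
    ring
  refine reaches_seq (n := 1) (n' := 3) (reaches_setVar ((y / d : ℕ) : ℤ) (by simp [h10, hds])
    (abs_natCast_le (Nat.div_le_self _ _) hy) ?_)
  refine reaches_seq (n := 1) (n' := 2)
    (reaches_setVar (z.re * G (2 * t) - z.im * G (2 * t + 1)) ?_ (b1.trans hA) ?_)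
  · simp only [eval_hSub, eval_hMul, eval_getVar]
    rw [eval_getArr (e := lit 2 * getVar 13) (k := 2 * t) (by simp),
      eval_getArr (e := lit 2 * getVar 13 + lit 1) (k := 2 * t + 1) (by simp)]
    simp [hG, h11, h12]
  refine reaches_seq (n := 1) (n' := 1)
    (reaches_setVar (z.re * G (2 * t + 1) + z.im * G (2 * t)) ?_ (b2.trans hA) ?_)
  · simp only [eval_hAdd, eval_hMul, eval_getVar]
    rw [eval_getArr (e := lit 2 * getVar 13) (k := 2 * t) (by simp),
      eval_getArr (e := lit 2 * getVar 13 + lit 1) (k := 2 * t + 1) (by simp)]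
    simp [hG, h11, h12]
  refine reaches_setVar (z.re * G (2 * t) - z.im * G (2 * t + 1)) (by simp) (b1.trans hA) ?_
  refine ⟨?_, by simp, by simp, by simp⟩
  exact (((((Frame.refl _ _ s).set_var (by simp) _).set_var (by simp) _).set_var
    (by simp) _).set_var (by simp) _).set_var (by simp) _

lemma reaches_psiProgram {x : ℕ} {G : ℕ → ℤ} (hd : 0 < d) (hM : 0 < M)
    (hN : s (inp 0) = N) (hds : s (inp 1) = d) (h1 : s (var 1) = (d ^ N : ℕ)) (h8 : s (var 8) = x)
    (hx : x < 2 * d ^ N) (hG : ∀ i, s (arr 0 i) = G i) (hGM : ∀ i, (G i).natAbs ≤ M)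
    (hV1 : ((2 * d * N : ℕ) : ℤ) ≤ V) (hV2 : ((2 * d ^ N : ℕ) : ℤ) ≤ V)
    (hV3 : (2 * M : ℤ) ^ N ≤ V) :
    Reaches V psiProgram (7 * N + 6) s fun s' => Frame [9, 10, 11, 12, 13, 14, 19] [] s s' ∧
      s' (var 19) = (x / d ^ N : ℕ) ∧ s' (var 11) = (psi d N G (x / d ^ N) (x % d ^ N)).re ∧
      s' (var 12) = (psi d N G (x / d ^ N) (x % d ^ N)).im := by
  have hD : 0 < d ^ N := pow_pos hd N
  set c := x / d ^ N with hc
  have hc2 : c < 2 := (Nat.div_lt_iff_lt_mul hD).2 hx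
  set y := x % d ^ N with hy
  have hyx : y < d ^ N := Nat.mod_lt _ hD
  have e1 : (x : ℤ) - (d ^ N : ℕ) * (x / (d ^ N : ℕ)) = (y : ℤ) := natCast_sub_mul_div x (d ^ N)
  have hNV : (N : ℤ) ≤ V := le_trans (by exact_mod_cast (by nlinarith)) hV1
  have hGa : ∀ i, |G i| ≤ M := fun i => by rw [Int.abs_eq_natAbs]; exact_mod_cast hGM i
  refine Reaches.mono (n := 1 + (1 + (1 + (1 + (N * (5 + 2) + 2))))) ?_ (by omega) fun _ h => h
  refine reaches_seq (reaches_setVar (c : ℤ) (by simp [h1, h8, hc])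
    (abs_natCast_le (by omega) hV2) ?_)
  refine reaches_seq (reaches_setVar (y : ℤ)  (by simpa [h1, h8] using e1)
    (abs_natCast_le (by omega) hV2) ?_)
  refine reaches_seq (reaches_setVar 1 (by simp) (by simp; omega) ?_)
  refine reaches_seq (reaches_setVar 0 (by simp) (by simp; omega) ?_)
  set f : ℕ → GaussianInt := fun i => family d N G c i (y / d ^ i % d) with hf
  refine Reaches.mono (reaches_forLoop (fun i s' => Frame [9, 10, 11, 12, 13, 14, 19] [] s s' ∧
    s' (var 9) = i ∧ s' (var 19) = c ∧ s' (var 10) = (y / d ^ i : ℕ) ∧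
    s' (var 11) = (∏ k ∈ Finset.range i, f k).re ∧
    s' (var 12) = (∏ k ∈ Finset.range i, f k).im) hNV ?_ ?_ ?_) le_rfl
    fun s' hs' => ⟨hs'.1, hs'.2.2.1, hs'.2.2.2.2⟩
  · refine ⟨?_, by simp, by simp, by simp, by simp, by simp⟩
    exact (((((Frame.refl _ _ s).set_var (by simp) _).set_var (by simp) _).set_var
      (by simp) _).set_var (by simp) _).set_var (by simp) _
  · rintro i s' ⟨hF, h9, -⟩ -
    exact ⟨h9, by simp [hF.inp, hN]⟩
  · rintro i s' ⟨hF, h9, h19, h10, h11, h12⟩ hi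
    have g0 := hF.inp 0
    have g1 := hF.inp 1
    have gG : ∀ k, s' (arr 0 k) = G k := fun k => by
      rw [hF.arr 0 k (by simp) (by norm_num) (by simp) (by simp), hG]
    have had : y / d ^ i % d < d := Nat.mod_lt _ hd
    have ht2 : d * (i + c * N) + y / d ^ i % d ≤ 2 * d * N := by
      have h2 : i + c * N + 1 ≤ 2 * N := by nlinarith
      nlinarith [Nat.mul_le_mul_left d h2]
    have hpow : (2 * M : ℤ) ^ i * (2 * M) ≤ V := by
      rw [← pow_succ]
      exact (pow_le_pow_right₀ (by omega) (by omega)).trans hV3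
    have hy' : y / d ^ i ≤ 2 * d ^ N := (Nat.div_le_self _ _).trans (by omega)
    refine (reaches_psiStep (by rw [g0, hN]) (by rw [g1, hds]) h9 h19 h10 h11 h12 gG hGa
      (abs_prod_le f (fun k => ⟨hGa _, hGa _⟩) i) hpow (le_trans (by exact_mod_cast hy') hV2)
      (le_trans (by exact_mod_cast ht2) hV1)).mono le_rfl ?_
    rintro s'' ⟨hF', p10, p11, p12⟩
    have q9 := hF'.var 9 (by simp) (by norm_num)
    have q19 := hF'.var 19 (by simp) (by norm_num)
    refine ⟨by rw [q9, h9], (hF.trans hF' (by simp) (by simp)).set_var (by simp) _, by simp,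
      by simp [q19, h19], ?_, ?_, ?_⟩
    · simp [p10, Nat.div_div_eq_div_mul, pow_succ]
    · rw [Function.update_of_ne (by simp), p11, Finset.prod_range_succ]
      rfl
    · rw [Function.update_of_ne (by simp), p12, Finset.prod_range_succ]
      rfl

end Code

/-! ### Program: tensor products and their squared norms -/

section Code

open SymExt.Expr (lit)

variable {V : ℤ} {s s' : Mem} {N d h q M : ℕ} {E : ℕ → GaussianInt}

/-- The contents of a pair of arrays. -/
def cells (s : Mem) (r m : ℕ) : GaussianInt := ⟨s (arr r m), s (arr (r + 1) m)⟩

/-- The values of the constants of the main loop. -/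
structure Constants (N d h q M : ℕ) (E : ℕ → GaussianInt) (s : Mem) : Prop where
  parties : s (inp 0) = N
  dim : s (inp 1) = d
  den : s (inp 4) = q
  height : s (var 0) = h
  total : s (var 1) = (d ^ N : ℕ)
  period : s (var 2) = M
  re : ∀ m, s (inp (5 + 2 * m)) = (E m).re
  im : ∀ m, s (inp (5 + 2 * m + 1)) = (E m).im

lemma Constants.of_frame (hs : Constants N d h q M E s) {vs as : List ℕ} (hF : Frame vs as s s')
    (hv : ∀ k < 3, k ∉ vs) : Constants N d h q M E s' where
  parties := by rw [hF.inp, hs.parties]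
  dim := by rw [hF.inp, hs.dim]
  den := by rw [hF.inp, hs.den]
  height := by rw [hF.var 0 (hv 0 (by norm_num)) (by norm_num), hs.height]
  total := by rw [hF.var 1 (hv 1 (by norm_num)) (by norm_num), hs.total]
  period := by rw [hF.var 2 (hv 2 (by norm_num)) (by norm_num), hs.period]
  re m := by rw [hF.inp, hs.re]
  im m := by rw [hF.inp, hs.im]

/-- Stores one coordinate and adds it to the squared norm in array `9`. -/
def fillStep : Program :=
  .seq psiProgram
  (.seq (setArr 1 (getVar 8) (getVar 11))
  (.seq (setArr 2 (getVar 8) (getVar 12))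
  (setArr 9 (getVar 19) (getArr 9 (getVar 19) +
    (getVar 11 * getVar 11 + getVar 12 * getVar 12)))))

/-- Computes the two tensor products and their squared norms. -/
def fillProgram : Program :=
  .seq (setArr 9 (lit 0) (lit 0))
  (.seq (setArr 9 (lit 1) (lit 0))
  (forLoop 8 (getVar 1 + getVar 1) fillStep))

lemma abs_mul_self_add_le {a b A : ℤ} (ha : |a| ≤ A) (hb : |b| ≤ A) :
    |a * a + b * b| ≤ 2 * A ^ 2 := by
  have h1 := sq_le_sq' (abs_le.1 ha).1 (abs_le.1 ha).2
  have h2 := sq_le_sq' (abs_le.1 hb).1 (abs_le.1 hb).2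
  rw [abs_of_nonneg (add_nonneg (mul_self_nonneg _) (mul_self_nonneg _))]
  nlinarith

lemma abs_sum_range_le {f : ℕ → ℤ} {A : ℤ} {n : ℕ} (hf : ∀ i < n, |f i| ≤ A) :
    |∑ i ∈ Finset.range n, f i| ≤ n * A := by
  refine (Finset.abs_sum_le_sum_abs _ _).trans ((Finset.sum_le_sum fun i hi =>
    hf i (Finset.mem_range.1 hi)).trans_eq ?_)
  simp

lemma reaches_fillProgram (hd : 0 < d) (hM : 0 < M)
    (hs : Constants N d h q M E s) {G : ℕ → ℤ} (hG : ∀ i, s (arr 0 i) = G i)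
    (hGM : ∀ i, (G i).natAbs ≤ M) (hV1 : ((2 * d * N : ℕ) : ℤ) ≤ V)
    (hV3 : ((2 * d ^ N : ℕ) : ℤ) * (2 * ((2 * M : ℤ) ^ N) ^ 2) ≤ V) :
    Reaches V fillProgram (2 * d ^ N * (7 * N + 11) + 4) s fun s' =>
      Frame [8, 9, 10, 11, 12, 13, 14, 19] [1, 2, 9] s s' ∧
      (∀ c < 2, ∀ x < d ^ N, cells s' 1 (c * d ^ N + x) = psi d N G c x) ∧
      s' (arr 9 0) = normSq d N G 0 ∧ s' (arr 9 1) = normSq d N G 1 := by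
  have hD : 0 < d ^ N := pow_pos hd N
  generalize hB : (2 * M : ℤ) ^ N = B at hV3
  have hB1 : 1 ≤ B := hB ▸ one_le_pow₀ (by omega)
  have hBB : B ≤ B ^ 2 := by nlinarith
  have hV2 : ((2 * d ^ N : ℕ) : ℤ) ≤ V := le_trans (by nlinarith) hV3
  have hVB : 2 * B ^ 2 ≤ V :=
    le_trans (le_mul_of_one_le_left (by positivity) (by exact_mod_cast (by omega))) hV3
  have hpsi : ∀ c x, |(psi d N G c x).re| ≤ B ∧ |(psi d N G c x).im| ≤ B :=
    fun c x => hB ▸ abs_psi_le hGM c x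
  set P : ℕ → GaussianInt := fun x => psi d N G (x / d ^ N) (x % d ^ N) with hP
  set w : ℕ → ℤ := fun x => (P x).re * (P x).re + (P x).im * (P x).im with hw
  have hwB : ∀ x, |w x| ≤ 2 * B ^ 2 := fun x => abs_mul_self_add_le (hpsi _ _).1 (hpsi _ _).2
  have hsum : ∀ c n, n ≤ 2 * d ^ N →
      |∑ x ∈ Finset.range n, if x / d ^ N = c then w x else 0| ≤ V := fun c n hn => by
    refine (abs_sum_range_le (A := 2 * B ^ 2) fun x _ => ?_).trans (le_trans ?_ hV3)
    · split_ifs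
      · exact hwB x
      · simpa using (abs_nonneg _).trans (hwB x)
    · gcongr
  -- One loop over 2d^N indices fills both tensor products; the quotient of the index by d^N says
  -- which of the two norms is being accumulated.
  have hnorm : ∀ c < 2, (∑ x ∈ Finset.range (2 * d ^ N), if x / d ^ N = c then w x else 0) =
      normSq d N G c := fun c hc => by
    rw [sum_range_mul, Finset.sum_eq_single_of_mem c (Finset.mem_range.2 hc)]
    · refine Finset.sum_congr rfl fun x hx => ?_
      have hx := Finset.mem_range.1 hx
      have e1 : (c * d ^ N + x) / d ^ N = c := by
        rw [mul_comm, Nat.mul_add_div hD, Nat.div_eq_of_lt hx, add_zero]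
      have e2 : (c * d ^ N + x) % d ^ N = x := by
        rw [mul_comm, Nat.mul_add_mod, Nat.mod_eq_of_lt hx]
      simp only [hw, hP, e1, e2, if_true]
    · intro b _ hb
      refine Finset.sum_eq_zero fun x hx => if_neg ?_
      rwa [mul_comm, Nat.mul_add_div hD, Nat.div_eq_of_lt (Finset.mem_range.1 hx), add_zero]
  refine Reaches.mono (n := 1 + (1 + (2 * d ^ N * ((7 * N + 9) + 2) + 2))) ?_ (le_of_eq (by ring))
    fun _ h => h
  refine reaches_seq (reaches_setArr 0 0 (by simp) (by simp) (by simp; omega) ?_)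
  refine reaches_seq (reaches_setArr 1 0 (by simp) (by simp) (by simp; omega) ?_)
  refine Reaches.mono (reaches_forLoop (fun n s' =>
    Frame [8, 9, 10, 11, 12, 13, 14, 19] [1, 2, 9] s s' ∧ s' (var 8) = n ∧
    (∀ x < n, cells s' 1 x = P x) ∧ ∀ c < 2, s' (arr 9 c) =
      ∑ x ∈ Finset.range n, if x / d ^ N = c then w x else 0) hV2 ?_ ?_ ?_) le_rfl ?_
  · refine ⟨?_, by simp, fun x hx => absurd hx (by simp), fun c hc => ?_⟩
    · exact (((Frame.refl _ _ s).set_arr (by simp) _ _).set_arr (by simp) _ _).set_var (by simp) _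
    · interval_cases c <;> simp
  · rintro n s' ⟨hF, h8, -⟩ -
    have := hF.var 1 (by simp) (by norm_num)
    refine ⟨h8, ?_⟩
    simp only [eval_hAdd, eval_getVar, this, hs.total]
    push_cast
    ring
  · rintro n s' ⟨hF, h8, hc, hn⟩ hlt
    have hs' := hs.of_frame hF (by decide)
    have gG : ∀ k, s' (arr 0 k) = G k := fun k => by
      rw [hF.arr 0 k (by simp) (by norm_num) (by simp) (by simp), hG]
    refine Reaches.mono (n := (7 * N + 6) + (1 + (1 + 1))) ?_ (by omega) fun _ h => h
    refine reaches_seq ((reaches_psiProgram hd hM hs'.parties hs'.dim hs'.total h8 hlt gG hGM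
      hV1 hV2 (by rw [hB]; nlinarith)).mono le_rfl ?_)
    rintro s'' ⟨hF', p19, p11, p12⟩
    have q8 := hF'.var 8 (by simp) (by norm_num)
    rw [h8] at q8
    have hF2 := hF.trans hF' (by simp) (by simp)
    have gr : ∀ r k, r < 16 → s'' (arr r k) = s' (arr r k) := fun r k hr =>
      hF'.arr r k (by simp) hr (by simp) (by simp)
    refine reaches_seq (reaches_setArr n (P n).re (by simp [q8]) (by simp [p11, hP])
      (by nlinarith [(hpsi (n / d ^ N) (n % d ^ N)).1]) ?_)
    refine reaches_seq (reaches_setArr n (P n).im (by simp [q8]) (by simp [p12, hP])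
      (by nlinarith [(hpsi (n / d ^ N) (n % d ^ N)).2]) ?_)
    have hc2 : n / d ^ N < 2 := (Nat.div_lt_iff_lt_mul hD).2 hlt
    refine reaches_setArr (n / d ^ N)
      (∑ x ∈ Finset.range (n + 1), if x / d ^ N = n / d ^ N then w x else 0)
      (by simp [p19]) ?_ (hsum _ _ hlt) ?_
    · simp only [eval_hAdd, eval_hMul, eval_getVar]
      rw [eval_getArr (e := getVar 19) (k := n / d ^ N) (by simp [p19]), Finset.sum_range_succ,
        if_pos rfl, ← hn _ hc2]
      simp [p11, p12, gr, hw, hP]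
    · refine ⟨by simp [q8], ?_, by simp, fun x hx => ?_, fun c hc' => ?_⟩
      · exact (((hF2.set_arr (by simp) _ _).set_arr (by simp) _ _).set_arr (by simp) _ _).set_var
          (by simp) _
      · rcases Nat.lt_succ_iff_lt_or_eq.1 hx with h1 | rfl
        · rw [← hc x h1]
          simp [cells, gr, h1.ne]
        · simp [cells]
      · by_cases h1 : c = n / d ^ N
        · simp [h1]
        · have h2 : (∑ x ∈ Finset.range (n + 1), if x / d ^ N = c then w x else 0) =
              s' (arr 9 c) := by
            rw [Finset.sum_range_succ, if_neg (Ne.symm h1), add_zero, hn c hc']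
          rw [h2]
          simp [gr, h1]
  · rintro s' ⟨hF, -, h1, h2⟩
    refine ⟨hF, fun c hc x hx => ?_, ?_, ?_⟩
    · rw [h1 _ (by nlinarith)]
      simp only [hP]
      rw [mul_comm c, Nat.mul_add_div hD, Nat.div_eq_of_lt hx, add_zero, Nat.mul_add_mod,
        Nat.mod_eq_of_lt hx]
    · rw [h2 0 (by norm_num), hnorm 0 (by norm_num)]
    · rw [h2 1 (by norm_num), hnorm 1 (by norm_num)]

end Code

/-! ### Program: the update vector and its inner product with S -/

section Code

open SymExt.Expr (lit)

variable {V U T : ℤ} {s s' : Mem} {N d h q M : ℕ} {E : ℕ → GaussianInt}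

lemma update_re_im (G : ℕ → ℤ) (m : ℕ) {u u' v v' : GaussianInt}
    (hu : psi d N G 0 (m / d ^ N) = u) (hu' : psi d N G 0 (m % d ^ N) = u')
    (hv : psi d N G 1 (m / d ^ N) = v) (hv' : psi d N G 1 (m % d ^ N) = v') :
    (update d N h q E G m).re =
      (h + 1) * normSq d N G 1 * q * (u.re * u'.re + u.im * u'.im) -
        normSq d N G 0 * q * (v.re * v'.re + v.im * v'.im) -
        h * (normSq d N G 0 * normSq d N G 1) * (E m).re ∧
    (update d N h q E G m).im =
      (h + 1) * normSq d N G 1 * q * (u.im * u'.re - u.re * u'.im) -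
        normSq d N G 0 * q * (v.im * v'.re - v.re * v'.im) -
        h * (normSq d N G 0 * normSq d N G 1) * (E m).im := by
  simp only [update, hu, hu', hv, hv', Zsqrtd.re_sub, Zsqrtd.im_sub, Zsqrtd.re_mul, Zsqrtd.im_mul,
    Zsqrtd.re_intCast, Zsqrtd.im_intCast, Zsqrtd.re_star, Zsqrtd.im_star]
  constructor <;> ring

/-- The common form of the real and imaginary parts of the update vector, with the tensor products
`e` and `e'` of the first and second vectors and the input cell `i`. -/
def updateExpr (e e' i : Expr) : Expr :=
  (getVar 0 + lit 1) * getArr 9 (lit 1) * getInp 4 * e - getArr 9 (lit 0) * getInp 4 * e' -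
    getVar 0 * (getArr 9 (lit 0) * getArr 9 (lit 1)) * Expr.load i

/-- Real part of an entry of the projection on a tensor product. -/
def entryRe (x y : Expr) : Expr := getArr 1 x * getArr 1 y + getArr 2 x * getArr 2 y

/-- Imaginary part of an entry of the projection on a tensor product. -/
def entryIm (x y : Expr) : Expr := getArr 2 x * getArr 1 y - getArr 1 x * getArr 2 y

/-- Computes one entry of the update vector and adds its contribution to the inner product in
variable `15`. -/
def dotStep : Program :=
  .seq (setVar 8 (getVar 17 / getVar 1))
  (.seq (setVar 10 (getVar 17 - getVar 1 * (getVar 17 / getVar 1)))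
  (.seq (setArr 5 (getVar 17) (updateExpr (entryRe (getVar 8) (getVar 10))
    (entryRe (getVar 1 + getVar 8) (getVar 1 + getVar 10)) (lit 5 + lit 2 * getVar 17)))
  (.seq (setArr 6 (getVar 17) (updateExpr (entryIm (getVar 8) (getVar 10))
    (entryIm (getVar 1 + getVar 8) (getVar 1 + getVar 10)) (lit 5 + lit 2 * getVar 17 + lit 1)))
  (setVar 15 (getVar 15 + (getArr 3 (getVar 17) * getArr 5 (getVar 17) +
    getArr 4 (getVar 17) * getArr 6 (getVar 17)))))))

/-- Computes the update vector and its inner product with the vector in the arrays `3` and `4`. -/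
def dotProgram : Program :=
  .seq (setVar 15 (lit 0)) (forLoop 17 (getVar 1 * getVar 1) dotStep)

lemma eval_updateExpr {e e' i : Expr} {a b n0 n1 : ℤ} (k : ℕ) (hs : Constants N d h q M E s)
    (h0 : s (arr 9 0) = n0) (h1 : s (arr 9 1) = n1) (he : e.eval s = a) (he' : e'.eval s = b)
    (hi : i.eval s = inp k) :
    (updateExpr e e' i).eval s = (h + 1) * n1 * q * a - n0 * q * b - h * (n0 * n1) * s (inp k) := by
  simp only [updateExpr, eval_hSub, eval_hMul, eval_hAdd, eval_getVar, eval_lit, eval_getInp,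
    hs.height, hs.den, he, he']
  rw [eval_getArr (e := lit 0) (k := 0) (by simp), eval_getArr (e := lit 1) (k := 1) (by simp), h0, h1,
    show (Expr.load i).eval s = s (i.eval s) from rfl, hi]

lemma eval_entry {x y : Expr} (a b : ℕ) (hx : x.eval s = a) (hy : y.eval s = b) :
    (entryRe x y).eval s = (cells s 1 a).re * (cells s 1 b).re +
      (cells s 1 a).im * (cells s 1 b).im ∧
    (entryIm x y).eval s = (cells s 1 a).im * (cells s 1 b).re -
      (cells s 1 a).re * (cells s 1 b).im := by
  simp only [entryRe, entryIm, eval_hSub, eval_hMul, eval_hAdd, eval_getArr hx, eval_getArr hy,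
    cells, and_self]

/-- The last term uses the bound n₀n₁ ≤ M checked by the program, the others only separate bounds on
the norms. -/
lemma abs_update_le {a b n0 n1 e B X : ℤ} (hn0 : 0 ≤ n0) (hn1 : 0 ≤ n1) (h0 : n0 ≤ X)
    (h1 : n1 ≤ X) (ha : |a| ≤ B) (hb : |b| ≤ B) (hM : n0 * n1 ≤ M) (he : |e| ≤ q) :
    |(h + 1) * n1 * q * a - n0 * q * b - h * (n0 * n1) * e| ≤
      (h + 2) * X * q * B + h * M * q := by
  have hB : 0 ≤ B := (abs_nonneg _).trans ha
  have hX : 0 ≤ X := hn0.trans h0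
  have hq : (0 : ℤ) ≤ q := Int.natCast_nonneg q
  have hh : (0 : ℤ) ≤ h := Int.natCast_nonneg h
  have a1 : |(h + 1) * n1 * q * a| ≤ (h + 1) * X * q * B := by
    rw [abs_mul, abs_of_nonneg (a := (h + 1) * n1 * (q : ℤ)) (by positivity)]
    gcongr
  have a2 : |n0 * q * b| ≤ X * q * B := by
    rw [abs_mul, abs_of_nonneg (a := n0 * (q : ℤ)) (by positivity)]
    gcongr
  have a3 : |h * (n0 * n1) * e| ≤ h * M * q := by
    rw [abs_mul, abs_of_nonneg (a := h * (n0 * n1)) (by positivity)]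
    gcongr
  refine (abs_sub _ _).trans ((add_le_add ((abs_sub _ _).trans (add_le_add a1 a2)) a3).trans_eq ?_)
  ring

lemma abs_sub_mul_le {a b c e B : ℤ} (ha : |a| ≤ B) (hb : |b| ≤ B) (hc : |c| ≤ B) (he : |e| ≤ B) :
    |a * b + c * e| ≤ 2 * B ^ 2 ∧ |a * b - c * e| ≤ 2 * B ^ 2 := by
  have h1 := abs_mul_add_le ha hc hb he
  have h2 := abs_mul_add_le ha hc he hb
  rw [show 2 * B ^ 2 = B * (2 * B) by ring]
  exact ⟨h2.2, h1.1⟩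

/-- The memory before the computation of the update vector that is listed by `G`. -/
structure Filled (N d M : ℕ) (G : ℕ → ℤ) (B : ℤ) (s : Mem) : Prop where
  psi_eq : ∀ c < 2, ∀ x < d ^ N, cells s 1 (c * d ^ N + x) = psi d N G c x
  norm0 : s (arr 9 0) = normSq d N G 0
  norm1 : s (arr 9 1) = normSq d N G 1
  abs_le : ∀ c x, |(psi d N G c x).re| ≤ B ∧ |(psi d N G c x).im| ≤ B
  mul_le : normSq d N G 0 * normSq d N G 1 ≤ M

lemma Filled.normSq_le {G : ℕ → ℤ} {B : ℤ} (hf : Filled N d M G B s) (c : ℕ) :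
    normSq d N G c ≤ (d ^ N : ℕ) * (2 * B ^ 2) :=
  (le_abs_self _).trans (abs_sum_range_le fun x _ =>
    abs_mul_self_add_le (hf.abs_le c x).1 (hf.abs_le c x).2)

lemma Filled.of_frame {G : ℕ → ℤ} {B : ℤ} (hf : Filled N d M G B s) {vs as : List ℕ}
    (hF : Frame vs as s s') (hv : ∀ j ∈ vs, j < 31) (ha : ∀ j ∈ as, j < 16)
    (h1 : 1 ∉ as) (h2 : 2 ∉ as) (h9 : 9 ∉ as) : Filled N d M G B s' where
  psi_eq c hc x hx := by
    rw [← hf.psi_eq c hc x hx, cells, cells, hF.arr 1 _ h1 (by norm_num) hv ha,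
      hF.arr 2 _ h2 (by norm_num) hv ha]
  norm0 := by rw [hF.arr 9 0 h9 (by norm_num) hv ha, hf.norm0]
  norm1 := by rw [hF.arr 9 1 h9 (by norm_num) hv ha, hf.norm1]
  abs_le := hf.abs_le
  mul_le := hf.mul_le

lemma Filled.abs_update_le {G : ℕ → ℤ} {B : ℤ} (hf : Filled N d M G B s) {m : ℕ}
    (hE : |(E m).re| ≤ q ∧ |(E m).im| ≤ q)
    (hU : (h + 2) * ((d ^ N : ℕ) * (2 * B ^ 2)) * q * (2 * B ^ 2) + h * M * q ≤ U) :
    |(update d N h q E G m).re| ≤ U ∧ |(update d N h q E G m).im| ≤ U := by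
  obtain ⟨e1, e2⟩ := update_re_im (h := h) (q := q) (E := E) (d := d) (N := N) G m rfl rfl rfl rfl
  rw [e1, e2]
  have hb := hf.abs_le
  constructor
  · exact (SymExt.abs_update_le (normSq_nonneg _ _) (normSq_nonneg _ _) (hf.normSq_le 0)
      (hf.normSq_le 1) (abs_sub_mul_le (hb _ _).1 (hb _ _).1 (hb _ _).2 (hb _ _).2).1
      (abs_sub_mul_le (hb _ _).1 (hb _ _).1 (hb _ _).2 (hb _ _).2).1 hf.mul_le hE.1).trans hU
  · exact (SymExt.abs_update_le (normSq_nonneg _ _) (normSq_nonneg _ _) (hf.normSq_le 0)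
      (hf.normSq_le 1) (abs_sub_mul_le (hb _ _).2 (hb _ _).1 (hb _ _).1 (hb _ _).2).2
      (abs_sub_mul_le (hb _ _).2 (hb _ _).1 (hb _ _).1 (hb _ _).2).2 hf.mul_le hE.2).trans hU

lemma reaches_dotStep (hd : 0 < d) (hs : Constants N d h q M E s) {G : ℕ → ℤ} {B a : ℤ} {m : ℕ}
    (hf : Filled N d M G B s) (hm : m < d ^ N * d ^ N) (h17 : s (var 17) = m)
    (h15 : s (var 15) = a) (hE : |(E m).re| ≤ q ∧ |(E m).im| ≤ q)
    (hU : (h + 2) * ((d ^ N : ℕ) * (2 * B ^ 2)) * q * (2 * B ^ 2) + h * M * q ≤ U)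
    (hUV : U ≤ V) (hmV : ((d ^ N * d ^ N : ℕ) : ℤ) ≤ V)
    (ha : |a + ((cells s 3 m).re * (update d N h q E G m).re +
      (cells s 3 m).im * (update d N h q E G m).im)| ≤ V) :
    Reaches V dotStep 5 s fun s' => Frame [8, 10, 15] [5, 6] s s' ∧
      (∀ k, k ≠ m → cells s' 5 k = cells s 5 k) ∧ cells s' 5 m = update d N h q E G m ∧
      s' (var 15) = a + ((cells s 3 m).re * (update d N h q E G m).re +
        (cells s 3 m).im * (update d N h q E G m).im) := by
  have hD : 0 < d ^ N := pow_pos hd N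
  have hx : m / d ^ N < d ^ N := Nat.div_lt_of_lt_mul hm
  have hy : m % d ^ N < d ^ N := Nat.mod_lt _ hD
  have e := natCast_sub_mul_div m (d ^ N)
  obtain ⟨u1, u2⟩ := hf.abs_update_le (h := h) hE hU
  obtain ⟨e1, e2⟩ := update_re_im (h := h) (q := q) (E := E) (d := d) (N := N) G m rfl rfl rfl rfl
  -- The two tensor products lie one after the other in the same arrays, the second at offset d^N.
  have p0 : ∀ x < d ^ N, cells s 1 x = psi d N G 0 x := fun x hx => by
    rw [← hf.psi_eq 0 two_pos x hx, zero_mul, zero_add]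
  have p1 : ∀ x < d ^ N, cells s 1 (d ^ N + x) = psi d N G 1 x := fun x hx => by
    rw [← hf.psi_eq 1 one_lt_two x hx, one_mul]
  generalize hwd : update d N h q E G m = w at *
  refine reaches_seq (n := 1) (n' := 4) (reaches_setVar ((m / d ^ N : ℕ) : ℤ)
    (by simp [h17, hs.total]) (abs_natCast_le ((Nat.div_le_self _ _).trans hm.le) hmV) ?_)
  refine reaches_seq (n := 1) (n' := 3) (reaches_setVar ((m % d ^ N : ℕ) : ℤ)
    (by simpa [h17, hs.total] using e) (abs_natCast_le ((Nat.mod_le _ _).trans hm.le) hmV) ?_)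
  set s₁ := Function.update (Function.update s (var 8) ((m / d ^ N : ℕ) : ℤ)) (var 10)
    ((m % d ^ N : ℕ) : ℤ) with hs₁
  have hF1 : Frame [8, 10, 15] [5, 6] s s₁ :=
    ((Frame.refl _ _ s).set_var (by simp) _).set_var (by simp) _
  have v8 : s₁ (var 8) = (m / d ^ N : ℕ) := by simp [hs₁]
  have v10 : s₁ (var 10) = (m % d ^ N : ℕ) := by simp [hs₁]
  have v17 : s₁ (var 17) = m := by simp [hs₁, h17]
  have v15 : s₁ (var 15) = a := by simp [hs₁, h15]
  have hc : ∀ r k, r < 15 → cells s₁ r k = cells s r k := fun r k hr => by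
    simp [cells, hs₁]
  have c1 := hs.of_frame hF1 (by decide)
  clear_value s₁
  have arr9 : ∀ k, s₁ (arr 9 k) = s (arr 9 k) := fun k => congrArg Zsqrtd.re (hc 9 k (by norm_num))
  refine reaches_seq (n := 1) (n' := 2) (reaches_setArr m w.re (by simp [v17]) ?_
    (u1.trans hUV) ?_)
  · rw [eval_updateExpr (5 + 2 * m) c1 (by rw [arr9, hf.norm0]) (by rw [arr9, hf.norm1])
      (eval_entry (m / d ^ N) (m % d ^ N) (by simp [v8]) (by simp [v10])).1
      (eval_entry (d ^ N + m / d ^ N) (d ^ N + m % d ^ N) (by simp [v8, c1.total])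
        (by simp [v10, c1.total])).1 (by simp [v17, inp]), e1, c1.re]
    simp only [hc 1 _ (by norm_num), p0 _ hx, p0 _ hy, p1 _ hx, p1 _ hy]
  set s₂ := Function.update s₁ (arr 5 m) w.re with hs₂
  have hF2 : Frame [8, 10, 15] [5, 6] s s₂ := hF1.set_arr (by simp) _ _
  have w8 : s₂ (var 8) = (m / d ^ N : ℕ) := by simp [hs₂, v8]
  have w10 : s₂ (var 10) = (m % d ^ N : ℕ) := by simp [hs₂, v10]
  have w17 : s₂ (var 17) = m := by simp [hs₂, v17]
  have hc' : ∀ k, cells s₂ 1 k = cells s 1 k := fun k => by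
    rw [← hc 1 k (by norm_num)]; simp [cells, hs₂]
  have arr9' : ∀ k, s₂ (arr 9 k) = s (arr 9 k) := fun k => by rw [← arr9]; simp [hs₂]
  have c2 := hs.of_frame hF2 (by decide)
  refine reaches_seq (n := 1) (n' := 1) (reaches_setArr m w.im (by simp [w17]) ?_
    (u2.trans hUV) ?_)
  · rw [eval_updateExpr (5 + 2 * m + 1) c2 (by rw [arr9', hf.norm0]) (by rw [arr9', hf.norm1])
      (eval_entry (m / d ^ N) (m % d ^ N) (by simp [w8]) (by simp [w10])).2
      (eval_entry (d ^ N + m / d ^ N) (d ^ N + m % d ^ N) (by simp [w8, c2.total])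
        (by simp [w10, c2.total])).2 (by simp [w17, inp]), e2, c2.im]
    simp only [hc', p0 _ hx, p0 _ hy, p1 _ hx, p1 _ hy]
  have r3 : s₁ (arr 3 m) = (cells s 3 m).re := congrArg Zsqrtd.re (hc 3 m (by norm_num))
  have r4 : s₁ (arr 4 m) = (cells s 3 m).im := congrArg Zsqrtd.im (hc 3 m (by norm_num))
  refine reaches_setVar (a + ((cells s 3 m).re * w.re + (cells s 3 m).im * w.im)) ?_ ha ?_
  · simp only [eval_hAdd, eval_hMul, eval_getVar]
    rw [eval_getArr (e := getVar 17) (k := m) (by simp [w17]),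
      eval_getArr (e := getVar 17) (k := m) (by simp [w17]),
      eval_getArr (e := getVar 17) (k := m) (by simp [w17]),
      eval_getArr (e := getVar 17) (k := m) (by simp [w17])]
    simp [hs₂, v15, r3, r4]
  · refine ⟨(hF2.set_arr (by simp) _ _).set_var (by simp) _, fun k hk => ?_, ?_, by simp⟩
    · rw [← hc 5 k (by norm_num)]
      simp [cells, hs₂, hk]
    · simp [cells, hs₂]

end Code

/-! ### Program: one perceptron step and the main loop -/

section Code

open SymExt.Expr (lit)

variable {V U T : ℤ} {s s' : Mem} {N d h q M J : ℕ} {E : ℕ → GaussianInt}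

lemma reaches_dotProgram (hd : 0 < d) (hs : Constants N d h q M E s) {G : ℕ → ℤ} {B : ℤ}
    (hf : Filled N d M G B s) (hE : ∀ m < d ^ N * d ^ N, |(E m).re| ≤ q ∧ |(E m).im| ≤ q)
    (hU : (h + 2) * ((d ^ N : ℕ) * (2 * B ^ 2)) * q * (2 * B ^ 2) + h * M * q ≤ U)
    (hUV : U ≤ V) (hmV : ((d ^ N * d ^ N : ℕ) : ℤ) ≤ V)
    (hT : ∀ m < d ^ N * d ^ N, |(cells s 3 m).re| ≤ T ∧ |(cells s 3 m).im| ≤ T)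
    (hTV : ((d ^ N * d ^ N : ℕ) : ℤ) * (2 * T * U) ≤ V) (hT0 : 0 ≤ T) (hU0 : 0 ≤ U) :
    Reaches V dotProgram (7 * (d ^ N * d ^ N) + 3) s fun s' => Frame [8, 10, 15, 17] [5, 6] s s' ∧
      (∀ m < d ^ N * d ^ N, cells s' 5 m = update d N h q E G m) ∧
      s' (var 15) = dot (d ^ N * d ^ N) (cells s 3) (update d N h q E G) := by
  generalize hw : update d N h q E G = w
  have hwU : ∀ m < d ^ N * d ^ N, |(w m).re| ≤ U ∧ |(w m).im| ≤ U :=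
    fun m hm => hw ▸ hf.abs_update_le (hE m hm) hU
  have hsum : ∀ n ≤ d ^ N * d ^ N, |dot n (cells s 3) w| ≤ V := fun n hn => by
    refine (abs_sum_range_le (A := 2 * T * U) fun m hm => ?_).trans (le_trans ?_ hTV)
    · obtain ⟨t1, t2⟩ := hT m (hm.trans_le hn)
      obtain ⟨t3, t4⟩ := hwU m (hm.trans_le hn)
      refine (abs_add_le _ _).trans ?_
      rw [abs_mul, abs_mul]
      calc _ ≤ T * U + T * U := by gcongr
        _ = _ := by ring
    · gcongr
  have hV0 : 0 ≤ V := hU0.trans hUV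
  refine Reaches.mono (n := 1 + (d ^ N * d ^ N * (5 + 2) + 2)) ?_ (by omega) fun _ h => h
  refine reaches_seq (reaches_setVar 0 (by simp) (by simpa) ?_)
  refine Reaches.mono (reaches_forLoop (fun n s' => Frame [8, 10, 15, 17] [5, 6] s s' ∧
    s' (var 17) = n ∧ (∀ m < n, cells s' 5 m = w m) ∧ s' (var 15) = dot n (cells s 3) w)
    hmV ?_ ?_ ?_) le_rfl fun s' hs' => ⟨hs'.1, hs'.2.2⟩
  · refine ⟨?_, by simp, fun m hm => absurd hm (by simp), by simp [dot]⟩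
    exact ((Frame.refl _ _ s).set_var (by simp) _).set_var (by simp) _
  · rintro n s' ⟨hF, h17, -⟩ -
    have := hs.of_frame hF (by decide)
    refine ⟨h17, ?_⟩
    simp [this.total]
  · rintro n s' ⟨hF, h17, h5, h15⟩ hn
    have c' := hs.of_frame hF (by decide)
    have f' := hf.of_frame hF (by decide) (by decide) (by decide) (by decide) (by decide)
    have e3 : cells s' 3 n = cells s 3 n := by
      rw [cells, cells, hF.arr 3 _ (by simp) (by norm_num) (by simp) (by simp),
        hF.arr 4 _ (by simp) (by norm_num) (by simp) (by simp)]
    have e4 : dot (n + 1) (cells s 3) w = dot n (cells s 3) w +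
        ((cells s 3 n).re * (w n).re + (cells s 3 n).im * (w n).im) := Finset.sum_range_succ _ _
    refine (reaches_dotStep hd c' f' hn h17 h15 (hE n hn) hU hUV hmV
      (by rw [e3, hw, ← e4]; exact hsum _ hn)).mono le_rfl ?_
    rintro s'' ⟨hF', p5, p5', p15⟩
    rw [hw] at p5' p15
    have q17 := hF'.var 17 (by simp) (by norm_num)
    refine ⟨by rw [q17, h17], (hF.trans hF' (by simp) (by simp)).set_var (by simp) _, by simp,
      fun m hm => ?_, ?_⟩
    · have e5 : ∀ x, cells (Function.update s'' (var 17) x) 5 m = cells s'' 5 m := fun x => by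
        simp [cells]
      rw [e5]
      rcases Nat.lt_succ_iff_lt_or_eq.1 hm with h1 | rfl
      · rw [p5 m h1.ne, h5 m h1]
      · exact p5'
    · rw [Function.update_of_ne (by simp), p15, e3, e4]

/-- Adds the update vector. -/
def addProgram : Program :=
  forLoop 17 (getVar 1 * getVar 1)
    (.seq (setArr 3 (getVar 17) (getArr 3 (getVar 17) + getArr 5 (getVar 17)))
    (setArr 4 (getVar 17) (getArr 4 (getVar 17) + getArr 6 (getVar 17))))

lemma reaches_addProgram (hs : Constants N d h q M E s)
    (hmV : ((d ^ N * d ^ N : ℕ) : ℤ) ≤ V)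
    (hT : ∀ m < d ^ N * d ^ N, |(cells s 3 m + cells s 5 m).re| ≤ V ∧
      |(cells s 3 m + cells s 5 m).im| ≤ V) :
    Reaches V addProgram (4 * (d ^ N * d ^ N) + 2) s fun s' => Frame [17] [3, 4] s s' ∧
      ∀ m < d ^ N * d ^ N, cells s' 3 m = cells s 3 m + cells s 5 m := by
  refine Reaches.mono (reaches_forLoop (m := 2) (fun n s' => Frame [17] [3, 4] s s' ∧
    s' (var 17) = n ∧ (∀ m < n, cells s' 3 m = cells s 3 m + cells s 5 m) ∧
    ∀ m, n ≤ m → cells s' 3 m = cells s 3 m) hmV ?_ ?_ ?_) (by omega)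
    fun s' hs' => ⟨hs'.1, hs'.2.2.1⟩
  · refine ⟨(Frame.refl _ _ s).set_var (by simp) _, by simp, fun m hm => absurd hm (by simp),
      fun m _ => by simp [cells]⟩
  · rintro n s' ⟨hF, h17, -⟩ -
    have := hs.of_frame hF (by decide)
    refine ⟨h17, ?_⟩
    simp [this.total]
  · rintro n s' ⟨hF, h17, h3, h3'⟩ hn
    have e5 : s' (arr 5 n) = s (arr 5 n) := hF.arr 5 _ (by simp) (by norm_num) (by simp) (by simp)
    have e6 : s' (arr 6 n) = s (arr 6 n) := hF.arr 6 _ (by simp) (by norm_num) (by simp) (by simp)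
    have e3 : s' (arr 3 n) = s (arr 3 n) := congrArg Zsqrtd.re (h3' n le_rfl)
    have e4 : s' (arr 4 n) = s (arr 4 n) := congrArg Zsqrtd.im (h3' n le_rfl)
    obtain ⟨t1, t2⟩ := hT n hn
    refine reaches_seq (n := 1) (n' := 1) (reaches_setArr n (cells s 3 n + cells s 5 n).re
      (by simp [h17]) ?_ t1 ?_)
    · simp only [eval_hAdd]
      rw [eval_getArr (e := getVar 17) (k := n) (by simp [h17]),
        eval_getArr (e := getVar 17) (k := n) (by simp [h17]), e3, e5]
      rfl
    refine reaches_setArr n (cells s 3 n + cells s 5 n).im (by simp [h17]) ?_ t2 ?_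
    · simp only [eval_hAdd]
      rw [eval_getArr (e := getVar 17) (k := n) (by simp [h17]),
        eval_getArr (e := getVar 17) (k := n) (by simp [h17])]
      simp [e4, e6, cells]
    · refine ⟨by simp [h17], ((hF.set_arr (by simp) _ _).set_arr (by simp) _ _).set_var (by simp) _,
        by simp, fun m hm => ?_, fun m hm => ?_⟩
      · rcases Nat.lt_succ_iff_lt_or_eq.1 hm with h1 | rfl
        · rw [← h3 m h1]
          simp [cells, h1.ne]
        · simp [cells]
      · rw [← h3' m (by omega)]
        have : m ≠ n := by omega
        simp [cells, this]

/-- One step of the perceptron. -/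
def bodyProgram : Program :=
  .seq decodeProgram
  (.seq fillProgram
  (.cond (getArr 9 (lit 0) * getArr 9 (lit 1) - getVar 2) .skip
  (.seq dotProgram
  (.cond (getVar 15) .skip
  (.seq addProgram
  (setVar 16 (getVar 16 + getArr 9 (lit 0) * getArr 9 (lit 1))))))))

/-- Bounds for the numbers that are stored in the main loop. -/
structure Bounds (N d h q M J : ℕ) (U V : ℤ) : Prop where
  update : (h + 2) * ((d ^ N : ℕ) * (2 * ((2 * M : ℤ) ^ N) ^ 2)) * q *
    (2 * ((2 * M : ℤ) ^ N) ^ 2) + h * M * q ≤ U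
  code : (M : ℤ) + 3 ≤ V
  index : ((2 * d * N : ℕ) : ℤ) ≤ V
  norm : ((2 * d ^ N : ℕ) : ℤ) * (2 * ((2 * M : ℤ) ^ N) ^ 2) ≤ V
  total : ((d ^ N * d ^ N : ℕ) : ℤ) ≤ V
  dot : ((d ^ N * d ^ N : ℕ) : ℤ) * (2 * (J * U) * U) ≤ V
  vec : (J + 1) * U ≤ V
  weight : ((J + 1) * M : ℤ) ≤ V
  square : ((d ^ N * d ^ N : ℕ) : ℤ) * (2 * (J * U) ^ 2) ≤ V

/-- Cost of one step of the perceptron. -/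
def bodyCost (N d M : ℕ) : ℕ :=
  (6 * M + 4) + (2 * d ^ N * (7 * N + 11) + 4) + 11 * (d ^ N * d ^ N) + 8

/-- Besides simulating `Step`, this keeps the entries of S below jU after j steps, as each update
adds at most U. The linear growth is what bounds all numbers stored later. -/
lemma reaches_bodyProgram (hd : 0 < d) (hM : 0 < M) (hb : Bounds N d h q M J U V)
    (hs : Constants N d h q M E s) {j : ℕ} (hj : j < J) (h4 : s (var 4) = j)
    (hG : ∀ i, (s (arr 0 i)).natAbs ≤ M)
    (hE : ∀ m < d ^ N * d ^ N, |(E m).re| ≤ q ∧ |(E m).im| ≤ q)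
    (hT : ∀ m < d ^ N * d ^ N, |(cells s 3 m).re| ≤ j * U ∧ |(cells s 3 m).im| ≤ j * U)
    (hW : 0 ≤ s (var 16) ∧ s (var 16) ≤ j * M) :
    Reaches V bodyProgram (bodyCost N d M) s fun s' =>
      Frame [5, 6, 7, 8, 9, 10, 11, 12, 13, 14, 15, 16, 17, 19] [0, 1, 2, 3, 4, 5, 6, 9] s s' ∧
      Step d N h q M E (j % M) (cells s 3) (s (var 16)) (cells s' 3) (s' (var 16)) ∧
      (∀ i, (s' (arr 0 i)).natAbs ≤ M) ∧
      ∀ m < d ^ N * d ^ N, |(cells s' 3 m).re| ≤ (j + 1 : ℕ) * U ∧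
        |(cells s' 3 m).im| ≤ (j + 1 : ℕ) * U := by
  have hU0 : 0 ≤ U := le_trans (by positivity) hb.update
  have hUV : U ≤ V := le_trans (le_mul_of_one_le_left hU0 (by omega)) hb.vec
  have hjJ : (j : ℤ) + 1 ≤ J := by exact_mod_cast hj
  have hjU : j * U ≤ J * U := by gcongr
  refine Reaches.mono (n := (6 * M + 4) + ((2 * d ^ N * (7 * N + 11) + 4) +
    (1 + ((7 * (d ^ N * d ^ N) + 3) + (1 + ((4 * (d ^ N * d ^ N) + 2) + 1)))))) ?_
    (by unfold bodyCost; omega) fun _ h => h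
  refine reaches_seq ((reaches_decodeProgram hM hs.period h4 hG hb.code).mono le_rfl ?_)
  rintro s₁ ⟨hF1, hdec, hG1⟩
  have c1 := hs.of_frame hF1 (by decide)
  set G : ℕ → ℤ := fun i => s₁ (arr 0 i) with hGd
  refine reaches_seq ((reaches_fillProgram hd hM c1 (G := G) (fun _ => rfl) hG1 hb.index
    hb.norm).mono le_rfl ?_)
  rintro s₂ ⟨hF2, f1, n0, n1⟩
  have c2 := c1.of_frame hF2 (by decide)
  have hF12 : Frame [5, 6, 7, 8, 9, 10, 11, 12, 13, 14, 15, 16, 17, 19]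
      [0, 1, 2, 3, 4, 5, 6, 9] s s₂ :=
    (((Frame.refl _ _ s).trans hF1 (by simp) (by simp)).trans hF2 (by simp) (by simp))
  have a0 : ∀ i, s₂ (arr 0 i) = G i := fun i =>
    hF2.arr 0 i (by simp) (by norm_num) (by simp) (by simp)
  have a3 : ∀ m, cells s₂ 3 m = cells s 3 m := fun m => by
    rw [cells, cells, hF2.arr 3 m (by simp) (by norm_num) (by simp) (by simp),
      hF2.arr 4 m (by simp) (by norm_num) (by simp) (by simp),
      hF1.arr 3 m (by simp) (by norm_num) (by simp) (by simp),
      hF1.arr 4 m (by simp) (by norm_num) (by simp) (by simp)]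
  have a16 : s₂ (var 16) = s (var 16) := by
    rw [hF2.var 16 (by simp) (by norm_num), hF1.var 16 (by simp) (by norm_num)]
  -- Shared by the two ways of skipping: too large a weight, before the update is computed, and a
  -- positive inner product, afterwards.
  have hskip : ∀ s₃ : Mem, Frame [8, 10, 15, 17] [5, 6] s₂ s₃ →
      ¬ (normSq d N G 0 * normSq d N G 1 ≤ M ∧
        dot (d ^ N * d ^ N) (cells s 3) (SymExt.update d N h q E G) ≤ 0) →
      Frame [5, 6, 7, 8, 9, 10, 11, 12, 13, 14, 15, 16, 17, 19] [0, 1, 2, 3, 4, 5, 6, 9] s s₃ ∧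
      Step d N h q M E (j % M) (cells s 3) (s (var 16)) (cells s₃ 3) (s₃ (var 16)) ∧
      (∀ i, (s₃ (arr 0 i)).natAbs ≤ M) ∧
      ∀ m < d ^ N * d ^ N, |(cells s₃ 3 m).re| ≤ (j + 1 : ℕ) * U ∧
        |(cells s₃ 3 m).im| ≤ (j + 1 : ℕ) * U := by
    intro s₃ hF3 hn
    have e3 : ∀ m, cells s₃ 3 m = cells s 3 m := fun m => by
      rw [← a3, cells, cells, hF3.arr 3 m (by simp) (by norm_num) (by simp) (by simp),
        hF3.arr 4 m (by simp) (by norm_num) (by simp) (by simp)]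
    refine ⟨hF12.trans hF3 (by simp) (by simp), ⟨G, hdec, ?_⟩, fun i => ?_, fun m hm => ?_⟩
    · rw [if_neg hn]
      exact ⟨fun m _ => e3 m, by rw [hF3.var 16 (by simp) (by norm_num), a16]⟩
    · rw [hF3.arr 0 i (by simp) (by norm_num) (by simp) (by simp), a0]
      exact hG1 i
    · rw [e3 m]
      have : j * U ≤ ((j + 1 : ℕ) : ℤ) * U := by push_cast; linarith
      exact ⟨(hT m hm).1.trans this, (hT m hm).2.trans this⟩
  have hν : ∀ {s₃ : Mem}, s₃ (arr 9 0) = normSq d N G 0 → s₃ (arr 9 1) = normSq d N G 1 →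
      (getArr 9 (lit 0) * getArr 9 (lit 1)).eval s₃ = normSq d N G 0 * normSq d N G 1 := by
    intro s₃ h0 h1
    rw [eval_hMul, eval_getArr (e := lit 0) (k := 0) (by simp),
      eval_getArr (e := lit 1) (k := 1) (by simp), h0, h1]
  refine reaches_cond (fun hp => ?_) (fun hp => ?_)
  · rw [eval_hSub, hν n0 n1, eval_getVar, c2.period] at hp
    refine (reaches_skip (hskip s₂ (Frame.refl _ _ _) fun h => ?_)).mono (by omega) fun _ h => h
    omega
  rw [eval_hSub, hν n0 n1, eval_getVar, c2.period] at hp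
  have hle : normSq d N G 0 * normSq d N G 1 ≤ M := by omega
  have hfill : Filled N d M G ((2 * M : ℤ) ^ N) s₂ := ⟨f1, n0, n1, abs_psi_le hG1, hle⟩
  refine reaches_seq ((reaches_dotProgram hd c2 hfill hE hb.update hUV hb.total (T := j * U)
    (fun m hm => by rw [a3]; exact hT m hm) (le_trans (by gcongr) hb.dot) (by positivity)
    hU0).mono le_rfl ?_)
  rintro s₃ ⟨hF3, h5, h15⟩
  have e3 : ∀ m, cells s₃ 3 m = cells s 3 m := fun m => by
    rw [← a3, cells, cells, hF3.arr 3 m (by simp) (by norm_num) (by simp) (by simp),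
      hF3.arr 4 m (by simp) (by norm_num) (by simp) (by simp)]
  rw [dot_congr (fun m _ => a3 m) fun _ _ => rfl] at h15
  refine reaches_cond (fun hp => ?_) (fun hp => ?_)
  · rw [eval_getVar, h15] at hp
    refine (reaches_skip (hskip s₃ hF3 fun h => ?_)).mono (by omega) fun _ h => h
    omega
  rw [eval_getVar, h15, not_lt] at hp
  have c3 := c2.of_frame hF3 (by decide)
  have hnew : ∀ m < d ^ N * d ^ N,
      |(cells s 3 m + SymExt.update d N h q E G m).re| ≤ (j + 1 : ℕ) * U ∧
      |(cells s 3 m + SymExt.update d N h q E G m).im| ≤ (j + 1 : ℕ) * U := fun m hm => by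
    obtain ⟨t1, t2⟩ := hT m hm
    obtain ⟨t3, t4⟩ := hfill.abs_update_le (h := h) (hE m hm) hb.update
    have e : ((j + 1 : ℕ) : ℤ) * U = j * U + U := by push_cast; ring
    rw [e]
    exact ⟨(abs_add_le _ _).trans (add_le_add t1 t3), (abs_add_le _ _).trans (add_le_add t2 t4)⟩
  have hjV : ((j + 1 : ℕ) : ℤ) * U ≤ V :=
    le_trans (mul_le_mul_of_nonneg_right (by push_cast; omega) hU0) hb.vec
  refine reaches_seq ((reaches_addProgram c3 hb.total fun m hm => ?_).mono le_rfl ?_)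
  · rw [e3, h5 m hm]
    exact ⟨(hnew m hm).1.trans hjV, (hnew m hm).2.trans hjV⟩
  rintro s₄ ⟨hF4, h3⟩
  have m0 : s₄ (arr 9 0) = normSq d N G 0 := by
    rw [hF4.arr 9 0 (by simp) (by norm_num) (by simp) (by simp),
      hF3.arr 9 0 (by simp) (by norm_num) (by simp) (by simp), n0]
  have m1 : s₄ (arr 9 1) = normSq d N G 1 := by
    rw [hF4.arr 9 1 (by simp) (by norm_num) (by simp) (by simp),
      hF3.arr 9 1 (by simp) (by norm_num) (by simp) (by simp), n1]
  have b16 : s₄ (var 16) = s (var 16) := by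
    rw [hF4.var 16 (by simp) (by norm_num), hF3.var 16 (by simp) (by norm_num), a16]
  have hν0 : 0 ≤ normSq d N G 0 * normSq d N G 1 :=
    mul_nonneg (normSq_nonneg _ _) (normSq_nonneg _ _)
  refine reaches_setVar (s (var 16) + normSq d N G 0 * normSq d N G 1) ?_ ?_ ?_
  · rw [eval_hAdd, hν m0 m1, eval_getVar, b16]
  · rw [abs_of_nonneg (by omega)]
    have : ((j : ℤ) + 1) * M ≤ (J + 1) * M := by gcongr
    linarith [hb.weight, hW.2]
  · have e4 : ∀ x, cells (Function.update s₄ (var 16) x) 3 = cells s₄ 3 := fun x => by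
      funext m; simp [cells]
    refine ⟨((hF12.trans hF3 (by simp) (by simp)).trans hF4 (by simp) (by simp)).set_var
      (by simp) _, ⟨G, hdec, ?_⟩, fun i => ?_, fun m hm => ?_⟩
    · rw [if_pos ⟨hle, hp⟩]
      refine ⟨fun m hm => ?_, by simp⟩
      rw [e4, h3 m hm, e3, h5 m hm]
    · rw [Function.update_of_ne (by simp), hF4.arr 0 i (by simp) (by norm_num) (by simp) (by simp),
        hF3.arr 0 i (by simp) (by norm_num) (by simp) (by simp), a0]
      exact hG1 i
    · rw [e4, h3 m hm, e3, h5 m hm]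
      exact hnew m hm

lemma reaches_mainLoop {ρ : Matrix (Fin N → Fin d) (Fin N → Fin d) ℂ} (hd : 0 < d) (hM : 0 < M)
    (hh : 0 < h) (hE : toMat N d E = (q : ℝ) • ρ) (hρ : IsState ρ)
    (hb : Bounds N d h q M J U V) (hs : Constants N d h q M E s) (hJ : s (var 3) = J)
    (hG : ∀ i, (s (arr 0 i)).natAbs ≤ M)
    (hEq : ∀ m < d ^ N * d ^ N, |(E m).re| ≤ q ∧ |(E m).im| ≤ q)
    (h3 : ∀ m, cells s 3 m = 0) (h16 : s (var 16) = 0) :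
    Reaches V (forLoop 4 (getVar 3) bodyProgram) (J * (bodyCost N d M + 2) + 2) s fun s' =>
      Constants N d h q M E s' ∧ Run d N h q M E J (cells s' 3) (s' (var 16)) ∧
      ∀ m < d ^ N * d ^ N, |(cells s' 3 m).re| ≤ J * U ∧ |(cells s' 3 m).im| ≤ J * U := by
  have hJV : (J : ℤ) ≤ V := by
    have h1 := hb.weight
    have : (1 : ℤ) ≤ M := by exact_mod_cast hM
    nlinarith
  have e4 : ∀ (s : Mem) x, cells (Function.update s (var 4) x) 3 = cells s 3 := fun s x => by
    funext m; simp [cells]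
  refine Reaches.mono (reaches_forLoop (fun j s' =>
    Frame [4, 5, 6, 7, 8, 9, 10, 11, 12, 13, 14, 15, 16, 17, 19] [0, 1, 2, 3, 4, 5, 6, 9] s s' ∧
    s' (var 4) = j ∧ Run d N h q M E j (cells s' 3) (s' (var 16)) ∧
    (∀ i, (s' (arr 0 i)).natAbs ≤ M) ∧
    ∀ m < d ^ N * d ^ N, |(cells s' 3 m).re| ≤ j * U ∧ |(cells s' 3 m).im| ≤ j * U)
    hJV ?_ ?_ ?_) le_rfl
    fun s' hs' => ⟨hs.of_frame hs'.1 (by decide), hs'.2.2.1, hs'.2.2.2.2⟩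
  · refine ⟨(Frame.refl _ _ s).set_var (by simp) _, by simp, ?_, fun i => ?_, fun m _ => ?_⟩
    · rw [e4, Function.update_of_ne (by simp), h16]
      exact .zero fun m _ => h3 m
    · rw [Function.update_of_ne (by simp)]
      exact hG i
    · rw [e4, h3]
      simp
  · rintro j s' ⟨hF, h4, -⟩ -
    exact ⟨h4, by rw [eval_getVar, hF.var 3 (by simp) (by norm_num), hJ]⟩
  · rintro j s' ⟨hF, h4, hr, hG', hT⟩ hj
    have hW := hr.dot_le hE hρ hh
    refine (reaches_bodyProgram hd hM hb (hs.of_frame hF (by decide)) hj h4 hG' hEq hT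
      ⟨hW.1, hW.2.1⟩).mono le_rfl ?_
    rintro s'' ⟨hF', hst, hG'', hT'⟩
    refine ⟨by rw [hF'.var 4 (by simp) (by norm_num), h4],
      (hF.trans hF' (by simp) (by simp)).set_var (by simp) _, by simp, ?_, fun i => ?_, ?_⟩
    · rw [e4, Function.update_of_ne (by simp)]
      exact .succ hr hst
    · rw [Function.update_of_ne (by simp)]
      exact hG'' i
    · rw [e4]
      exact hT'

end Code

/-! ### Program: constants, final test and the whole algorithm -/

section Code

open SymExt.Expr (lit)

variable {V U T : ℤ} {s s' : Mem} {N d h q M J : ℕ} {E : ℕ → GaussianInt}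

/-- Multiplies variable `v` with the value of `x` as many times as `e` says. -/
def powLoop (v : ℕ) (e x : Expr) : Program := forLoop 9 e (setVar v (getVar v * x))

lemma reaches_powLoop {v n b : ℕ} {e x : Expr} (hv9 : v ≠ 9)
    (h1 : s (var v) = 1) (hn : (n : ℤ) ≤ V) (hb : 0 < b) (hbV : ((b ^ n : ℕ) : ℤ) ≤ V)
    (he : ∀ s', Frame [v, 9] [] s s' → e.eval s' = n)
    (hx : ∀ s', Frame [v, 9] [] s s' → x.eval s' = b) :
    Reaches V (powLoop v e x) (3 * n + 2) s fun s' => Frame [v, 9] [] s s' ∧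
      s' (var v) = (b ^ n : ℕ) := by
  refine Reaches.mono (reaches_forLoop (m := 1) (fun i s' => Frame [v, 9] [] s s' ∧
    s' (var 9) = i ∧ s' (var v) = (b ^ i : ℕ)) hn ?_ ?_ ?_) (by omega)
    fun s' hs' => ⟨hs'.1, hs'.2.2⟩
  · exact ⟨(Frame.refl _ _ s).set_var (by simp) _, by simp, by simp [hv9, h1]⟩
  · rintro i s' ⟨hF, h9, -⟩ -
    exact ⟨h9, he s' hF⟩
  · rintro i s' ⟨hF, h9, hi⟩ hin
    refine reaches_setVar ((b ^ (i + 1) : ℕ) : ℤ) ?_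
      (abs_natCast_le (Nat.pow_le_pow_right hb hin) hbV) ?_
    · rw [eval_hMul, eval_getVar, hi, hx s' hF]
      push_cast
      ring
    · exact ⟨by simp [hv9.symm, h9], (hF.set_var (by simp) _).set_var (by simp) _, by simp,
        by simp [hv9]⟩

/-- Computes the constants of the main loop. -/
def setupProgram : Program :=
  .seq (setVar 0 (lit 4 * (getInp 3 / getInp 2 + lit 1)))
  (.seq (setVar 13 (lit 16 * (lit 8 * getInp 0 * getVar 0)))
  (.seq (setVar 2 (lit 1))
  (.seq (powLoop 2 (lit 8 * getInp 1 * getInp 0) (getVar 13))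
  (.seq (setVar 1 (lit 1))
  (.seq (powLoop 1 (getInp 0) (getInp 1))
  (setVar 3 (lit 32 * getVar 1 * getVar 0 * getVar 0 * getVar 2 * getVar 2)))))))

lemma reaches_setupProgram {p r : ℕ} (hN : s (inp 0) = N) (hds : s (inp 1) = d)
    (hp : s (inp 2) = p) (hr : s (inp 3) = r) (hq : s (inp 4) = q) (hN0 : 0 < N) (hd : 0 < d)
    (hh : h = 4 * (r / p + 1)) (hM : M = (16 * (8 * N * h)) ^ (8 * d * N))
    (hJ : J = 32 * d ^ N * h * h * M * M)
    (hV : (M : ℤ) ≤ V) (hV1 : ((d ^ N : ℕ) : ℤ) ≤ V) (hV2 : (J : ℤ) ≤ V)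
    (hre : ∀ m, s (inp (5 + 2 * m)) = (E m).re) (him : ∀ m, s (inp (5 + 2 * m + 1)) = (E m).im) :
    Reaches V setupProgram (24 * d * N + 3 * N + 9) s fun s' =>
      Frame [0, 1, 2, 3, 9, 13] [] s s' ∧ Constants N d h q M E s' ∧ s' (var 3) = J := by
  have hh0 : 0 < h := by rw [hh]; positivity
  have hNh := Nat.mul_pos hN0 hh0
  have hdN := Nat.mul_pos hd hN0
  set b := 16 * (8 * N * h) with hb
  have hb2 : 2 ≤ b := by nlinarith
  have hbM : b ≤ M := hM ▸ Nat.le_self_pow (by nlinarith) b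
  have hdM : 8 * d * N ≤ M := hM ▸ (Nat.lt_pow_self hb2).le
  have hhM : h ≤ M := le_trans (by nlinarith) hbM
  have hNM : N ≤ M := le_trans (by nlinarith) hdM
  have hV0 : 1 ≤ V := le_trans (by exact_mod_cast (by omega : 1 ≤ M)) hV
  refine Reaches.mono (n := 1 + (1 + (1 + ((3 * (8 * d * N) + 2) + (1 + ((3 * N + 2) + 1))))))
    ?_ (le_of_eq (by ring)) fun _ h => h
  refine reaches_seq (reaches_setVar (h : ℤ) ?_ (abs_natCast_le hhM hV) ?_)
  · simp [hp, hr, hh]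
  refine reaches_seq (reaches_setVar (b : ℤ) ?_ (abs_natCast_le hbM hV) ?_)
  · simp [hN, hb]
  refine reaches_seq (reaches_setVar 1 (by simp) (by simpa) ?_)
  set s₁ := Function.update (Function.update (Function.update s (var 0) (h : ℤ)) (var 13) (b : ℤ))
    (var 2) 1 with hs₁
  have hF1 : Frame [0, 1, 2, 3, 9, 13] [] s s₁ :=
    (((Frame.refl _ _ s).set_var (by simp) _).set_var (by simp) _).set_var (by simp) _
  have k0 : s₁ (var 0) = h := by simp [hs₁]
  have k13 : s₁ (var 13) = b := by simp [hs₁]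
  have k2 : s₁ (var 2) = 1 := by simp [hs₁]
  clear_value s₁
  refine reaches_seq ((reaches_powLoop (n := 8 * d * N) (b := b) (by norm_num) k2
    (le_trans (by exact_mod_cast hdM) hV) (by omega) (hM ▸ hV) (fun s' hF => ?_)
    fun s' hF => ?_).mono le_rfl ?_)
  · simp [hF.inp, hF1.inp, hN, hds]
  · simp [hF.var 13 (by simp) (by norm_num), k13]
  rintro s₂ ⟨hF2, l2⟩
  refine reaches_seq (reaches_setVar 1 (by simp) (by simpa) ?_)
  set s₃ := Function.update s₂ (var 1) 1 with hs₃
  have hF3 : Frame [0, 1, 2, 3, 9, 13] [] s s₃ :=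
    (hF1.trans hF2 (by simp) (by simp)).set_var (by simp) _
  refine reaches_seq ((reaches_powLoop (n := N) (b := d) (by norm_num)
    (by simp [hs₃]) (le_trans (by exact_mod_cast hNM) hV) hd hV1 (fun s' hF => ?_)
    fun s' hF => ?_).mono le_rfl ?_)
  · simp [hF.inp, hF3.inp, hN]
  · simp [hF.inp, hF3.inp, hds]
  rintro s₄ ⟨hF4, m1⟩
  have m0 : s₄ (var 0) = h := by
    rw [hF4.var 0 (by simp) (by norm_num), hs₃, Function.update_of_ne (by simp),
      hF2.var 0 (by simp) (by norm_num), k0]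
  have m2 : s₄ (var 2) = M := by
    rw [hF4.var 2 (by simp) (by norm_num), hs₃, Function.update_of_ne (by simp), l2, hM]
  have hF5 : Frame [0, 1, 2, 3, 9, 13] [] s s₄ := hF3.trans hF4 (by simp) (by simp)
  refine reaches_setVar (J : ℤ) ?_ (abs_natCast_le le_rfl hV2) ?_
  · simp [m0, m1, m2, hJ]
  · refine ⟨hF5.set_var (by simp) _, ⟨?_, ?_, ?_, by simp [m0], by simp [m1], by simp [m2], ?_, ?_⟩,
      by simp⟩
    all_goals simp [hF5.inp, hN, hds, hq, hre, him]

/-- The final test. -/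
def testProgram : Program :=
  .seq (setVar 18 (lit 0))
  (.seq (forLoop 17 (getVar 1 * getVar 1) (setVar 18 (getVar 18 +
    (getArr 3 (getVar 17) * getArr 3 (getVar 17) + getArr 4 (getVar 17) * getArr 4 (getVar 17)))))
  (.cond (getInp 4 * getVar 16 * (getInp 4 * getVar 16) - getVar 1 * getVar 18)
    (.store (lit (inp 0)) (lit 1)) (.store (lit (inp 0)) (lit 0))))

lemma reaches_testProgram (hs : Constants N d h q M E s) (hV : 1 ≤ V)
    (hmV : ((d ^ N * d ^ N : ℕ) : ℤ) ≤ V)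
    (hT : ∀ m < d ^ N * d ^ N, |(cells s 3 m).re| ≤ T ∧ |(cells s 3 m).im| ≤ T)
    (hTV : ((d ^ N * d ^ N : ℕ) : ℤ) * (2 * T ^ 2) ≤ V) :
    Reaches V testProgram (3 * (d ^ N * d ^ N) + 5) s fun s' => s' (inp 0) =
      if (d ^ N : ℕ) * dot (d ^ N * d ^ N) (cells s 3) (cells s 3) < (q * s (var 16)) ^ 2
      then 1 else 0 := by
  have hsum : ∀ n ≤ d ^ N * d ^ N, |dot n (cells s 3) (cells s 3)| ≤ V := fun n hn => by
    refine (abs_sum_range_le (A := 2 * T ^ 2) fun m hm =>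
      abs_mul_self_add_le (hT m (hm.trans_le hn)).1 (hT m (hm.trans_le hn)).2).trans
      (le_trans ?_ hTV)
    gcongr
  refine Reaches.mono (n := 1 + ((d ^ N * d ^ N * (1 + 2) + 2) + (1 + 1))) ?_ (by omega)
    fun _ h => h
  refine reaches_seq (reaches_setVar 0 (by simp) (by simp; omega) ?_)
  refine reaches_seq (Reaches.mono (reaches_forLoop (fun n s' => Frame [17, 18] [] s s' ∧
    s' (var 17) = n ∧ s' (var 18) = dot n (cells s 3) (cells s 3)) hmV ?_ ?_ ?_) le_rfl ?_)
  · refine ⟨?_, by simp, by simp [dot]⟩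
    exact ((Frame.refl _ _ s).set_var (by simp) _).set_var (by simp) _
  · rintro n s' ⟨hF, h17, -⟩ -
    have := hs.of_frame hF (by decide)
    exact ⟨h17, by simp [this.total]⟩
  · rintro n s' ⟨hF, h17, h18⟩ hn
    have e4 : dot (n + 1) (cells s 3) (cells s 3) = dot n (cells s 3) (cells s 3) +
        ((cells s 3 n).re * (cells s 3 n).re + (cells s 3 n).im * (cells s 3 n).im) :=
      Finset.sum_range_succ _ _
    refine reaches_setVar (dot (n + 1) (cells s 3) (cells s 3)) ?_ (hsum _ hn) ?_
    · simp only [eval_hAdd, eval_hMul, eval_getVar]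
      rw [eval_getArr (e := getVar 17) (k := n) (by simp [h17]),
        eval_getArr (e := getVar 17) (k := n) (by simp [h17]), h18,
        hF.arr 3 n (by simp) (by norm_num) (by simp) (by simp),
        hF.arr 4 n (by simp) (by norm_num) (by simp) (by simp), e4]
      rfl
    · exact ⟨by simp [h17], (hF.set_var (by simp) _).set_var (by simp) _, by simp, by simp⟩
  · rintro s' ⟨hF, h17, h18⟩
    have c' := hs.of_frame hF (by decide)
    have h16 := hF.var 16 (by simp) (by norm_num)
    have e : (getInp 4 * getVar 16 * (getInp 4 * getVar 16) - getVar 1 * getVar 18).eval s' =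
        (q * s (var 16)) ^ 2 -
          (d ^ N : ℕ) * dot (d ^ N * d ^ N) (cells s 3) (cells s 3) := by
      simp only [eval_hSub, eval_hMul, eval_getVar, eval_getInp, c'.den, c'.total, h16, h18]
      ring
    refine reaches_cond (fun hp => ?_) (fun hp => ?_)
    · rw [e, sub_pos] at hp
      rw [if_pos hp]
      exact reaches_store (by simpa) (by simp)
    · rw [e, sub_pos] at hp
      rw [if_neg hp]
      exact reaches_store (by simp; omega) (by simp)

/-- The perceptron algorithm for at least two parties. -/
def perceptronProgram : Program :=
  .seq setupProgram (.seq (forLoop 4 (getVar 3) bodyProgram) testProgram)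

/-- Number of steps of the perceptron algorithm. -/
def perceptronCost (N d M J : ℕ) : ℕ :=
  (24 * d * N + 3 * N + 9) + ((J * (bodyCost N d M + 2) + 2) + (3 * (d ^ N * d ^ N) + 5))

/-- Cells at negative addresses are zero in the input, so S and W start at zero without an
initialising loop. -/
lemma reaches_perceptronProgram {ρ : Matrix (Fin N → Fin d) (Fin N → Fin d) ℂ} {p r : ℕ}
    (hN : s (inp 0) = N) (hds : s (inp 1) = d)
    (hp : s (inp 2) = p) (hr : s (inp 3) = r) (hq : s (inp 4) = q) (hN0 : 0 < N) (hd : 0 < d)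
    (hh : h = 4 * (r / p + 1)) (hM : M = (16 * (8 * N * h)) ^ (8 * d * N))
    (hJ : J = 32 * d ^ N * h * h * M * M) (hq0 : 0 < q)
    (hre : ∀ m, s (inp (5 + 2 * m)) = (E m).re) (him : ∀ m, s (inp (5 + 2 * m + 1)) = (E m).im)
    (hb : Bounds N d h q M J U V) (hE : toMat N d E = (q : ℝ) • ρ) (hρ : IsState ρ)
    (hEq : ∀ m < d ^ N * d ^ N, |(E m).re| ≤ q ∧ |(E m).im| ≤ q)
    (hneg : ∀ a, a < 0 → s a = 0) :
    Reaches V perceptronProgram (perceptronCost N d M J) s fun s' =>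
      (ρ ∈ separable (fun _ : Fin N => d) → s' (inp 0) = 1) ∧
      ((∀ σ ∈ separable (fun _ : Fin N => d), 3 / (h : ℝ) ≤ traceNorm (ρ - σ)) →
        s' (inp 0) = 0) := by
  have hh0 : 0 < h := by rw [hh]; positivity
  have hM0 : 0 < M := by
    have := Nat.mul_pos hN0 hh0
    exact hM ▸ pow_pos (by nlinarith) _
  have hMV : (M : ℤ) ≤ V := by linarith [hb.code]
  have hDV : ((d ^ N : ℕ) : ℤ) ≤ V :=
    le_trans (by exact_mod_cast Nat.le_mul_of_pos_right _ (pow_pos hd N)) hb.total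
  have hJV : (J : ℤ) ≤ V := by
    have h1 := hb.weight
    have : (1 : ℤ) ≤ M := by exact_mod_cast hM0
    nlinarith
  have hvar : ∀ k, s (var k) = 0 := fun k => hneg _ (by unfold var; omega)
  have harr : ∀ r k, s (arr r k) = 0 := fun r k => hneg _ (by unfold arr; omega)
  refine reaches_seq ((reaches_setupProgram hN hds hp hr hq hN0 hd hh hM hJ hMV hDV hJV hre
    him).mono le_rfl ?_)
  rintro s₁ ⟨hF1, c1, h3⟩
  have a1 : ∀ r k, r < 16 → s₁ (arr r k) = 0 := fun r k hr => by
    rw [hF1.arr r k (by simp) hr (by simp) (by simp), harr]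
  refine reaches_seq ((reaches_mainLoop hd hM0 hh0 hE hρ hb c1 h3 (fun i => ?_) hEq (fun m => ?_)
    ?_).mono le_rfl ?_)
  · rw [a1 0 i (by norm_num)]
    exact Nat.zero_le _
  · simp only [cells, a1 3 m (by norm_num), a1 (3 + 1) m (by norm_num)]
    rfl
  · rw [hF1.var 16 (by simp) (by norm_num), hvar]
  rintro s₂ ⟨c2, hr2, hT⟩
  refine (reaches_testProgram c2 (by omega) hb.total hT hb.square).mono le_rfl ?_
  intro s₃ h0
  refine ⟨fun hsep => ?_, fun hfar => ?_⟩
  · rw [h0, if_pos]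
    subst hJ
    exact hr2.test_of_mem_separable hN0 hd hh0 hq0 hE hsep hM
  · rw [h0, if_neg]
    intro ht
    obtain ⟨σ, hσ, hlt⟩ := hr2.exists_near hE hρ hh0 hq0 ht
    exact absurd (hfar σ hσ) (not_le.2 hlt)

/-- The algorithm of the theorem. -/
def separabilityProgram : Program :=
  .cond (getInp 0 - lit 1) perceptronProgram (.store (lit (inp 0)) (lit 1))

end Code

/-! ### The input and the running time -/

section Input

variable {N d p r q : ℕ} {R J : Matrix (Fin N → Fin d) (Fin N → Fin d) ℤ} {s : Mem}

/-- The entries of the matrix in the input. -/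
def inputEntry (s : Mem) (m : ℕ) : GaussianInt := ⟨s (inp (5 + 2 * m)), s (inp (5 + 2 * m + 1))⟩

lemma inputEntry_num (hs : IsInput N d p r q R J s) (x y : Fin N → Fin d) :
    inputEntry s (num x * d ^ N + num y) = ⟨R x y, J x y⟩ := by
  have h1 := hs.entryRe x y
  have h2 := hs.entryIm x y
  rw [basisNumber_eq, basisNumber_eq] at h1 h2
  rw [← h1, ← h2, inputEntry, inp, inp]
  push_cast
  rfl

lemma toMat_inputEntry (hs : IsInput N d p r q R J s) (hq : 0 < q) :
    toMat N d (inputEntry s) = (q : ℝ) • rationalMatrix q R J := by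
  ext x y
  have hq' : (q : ℂ) ≠ 0 := by exact_mod_cast hq.ne'
  rw [toMat, Matrix.of_apply, inputEntry_num hs, GaussianInt.toComplex_def', Matrix.smul_apply,
    rationalMatrix, Matrix.of_apply, Complex.real_smul]
  push_cast
  field_simp

lemma exists_num_eq {m : ℕ} (hd : 0 < d) (hm : m < d ^ N * d ^ N) :
    ∃ x y : Fin N → Fin d, m = num x * d ^ N + num y := by
  refine ⟨finFunctionFinEquiv.symm ⟨m / d ^ N, Nat.div_lt_of_lt_mul hm⟩,
    finFunctionFinEquiv.symm ⟨m % d ^ N, Nat.mod_lt _ (pow_pos hd N)⟩, ?_⟩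
  rw [num, num, Equiv.apply_symm_apply, Equiv.apply_symm_apply]
  exact (Nat.div_add_mod' m _).symm

/-- Entries of a state have modulus at most one, so the numerators are bounded by q. This is why ℓ
need not count the bits of the matrix entries. -/
lemma abs_inputEntry_le (hs : IsInput N d p r q R J s) (hd : 0 < d) (hq : 0 < q)
    (hρ : IsState (rationalMatrix q R J)) {m : ℕ} (hm : m < d ^ N * d ^ N) :
    |(inputEntry s m).re| ≤ q ∧ |(inputEntry s m).im| ≤ q := by
  obtain ⟨x, y, rfl⟩ := exists_num_eq hd hm
  have hqr : (0 : ℝ) < q := by exact_mod_cast hq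
  have h1 : ‖rationalMatrix q R J x y‖ ^ 2 ≤ 1 := by
    have h2 := sum_norm_sq_le_trace_sq hρ.1
    rw [hρ.2, Complex.one_re, one_pow] at h2
    refine le_trans ?_ h2
    exact (Finset.single_le_sum (f := fun y => ‖rationalMatrix q R J x y‖ ^ 2)
      (fun _ _ => by positivity) (Finset.mem_univ y)).trans
      (Finset.single_le_sum (f := fun x => ∑ y, ‖rationalMatrix q R J x y‖ ^ 2)
        (fun _ _ => by positivity) (Finset.mem_univ x))
  have h3 : ‖GaussianInt.toComplex (inputEntry s (num x * d ^ N + num y))‖ ≤ q := by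
    have := congrFun (congrFun (toMat_inputEntry hs hq) x) y
    rw [toMat, Matrix.of_apply, Matrix.smul_apply] at this
    rw [this, norm_smul, Real.norm_of_nonneg hqr.le]
    exact mul_le_of_le_one_right hqr.le ((sq_le_one_iff₀ (norm_nonneg _)).1 h1)
  have h4 := (Complex.abs_re_le_norm _).trans h3
  have h5 := (Complex.abs_im_le_norm _).trans h3
  rw [← GaussianInt.intCast_re] at h4
  rw [← GaussianInt.intCast_im] at h5
  exact ⟨by exact_mod_cast h4, by exact_mod_cast h5⟩

lemma abs_input_le (hs : IsInput N d p r q R J s) (hd : 0 < d) (hq : 0 < q)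
    (hρ : IsState (rationalMatrix q R J)) {V : ℤ} (hN : (N : ℤ) ≤ V) (hdV : (d : ℤ) ≤ V)
    (hp : (p : ℤ) ≤ V) (hr : (r : ℤ) ≤ V) (hqV : (q : ℤ) ≤ V) (a : ℤ) : |s a| ≤ V := by
  have hV : 0 ≤ V := le_trans (Int.natCast_nonneg q) hqV
  have hnat : ∀ n : ℕ, (n : ℤ) ≤ V → |(n : ℤ)| ≤ V := fun n h => by rwa [Nat.abs_cast]
  rcases lt_or_ge a 0 with h0 | h0
  · rw [hs.below a h0]
    simpa
  rcases le_or_gt (5 + 2 * ((d : ℤ) ^ N * (d : ℤ) ^ N)) a with h1 | h1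
  · rw [hs.above a h1]
    simpa
  lift a to ℕ using h0
  rcases lt_or_ge a 5 with h5 | h5
  · interval_cases a
    · exact hs.parties ▸ hnat N hN
    · exact hs.dim ▸ hnat d hdV
    · exact hs.errorNum ▸ hnat p hp
    · exact hs.errorDen ▸ hnat r hr
    · exact hs.entryDen ▸ hnat q hqV
  · have h2 : a < 5 + 2 * (d ^ N * d ^ N) := by exact_mod_cast h1
    have hm : (a - 5) / 2 < d ^ N * d ^ N := by omega
    obtain ⟨b1, b2⟩ := abs_inputEntry_le hs hd hq hρ hm
    rcases Nat.mod_two_eq_zero_or_one (a - 5) with h3 | h3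
    · have e : (a : ℤ) = inp (5 + 2 * ((a - 5) / 2)) := by unfold inp; omega
      rw [e]
      exact b1.trans hqV
    · have e : (a : ℤ) = inp (5 + 2 * ((a - 5) / 2) + 1) := by unfold inp; omega
      rw [e]
      exact b2.trans hqV

end Input

/-! ### Sizes of the parameters and of the stored numbers -/

section Cost

variable {N d h q M J : ℕ}

/-- The quantities of the algorithm are polynomial in `M`. -/
structure Small (N d h M J : ℕ) : Prop where
  large : 10000 ≤ M
  parties : N ≤ M
  height : h ≤ M
  total : d ^ N ≤ M
  index : 8 * d * N ≤ M
  steps : J = 32 * d ^ N * h * h * M * M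

lemma small_of_eq (hN : 2 ≤ N) (hd : 0 < d) (hh : 4 ≤ h)
    (hM : M = (16 * (8 * N * h)) ^ (8 * d * N)) (hJ : J = 32 * d ^ N * h * h * M * M) :
    Small N d h M J := by
  have hNh : 8 ≤ N * h := by nlinarith
  have hdN : 2 ≤ d * N := by nlinarith
  set b := 16 * (8 * N * h) with hb
  have hb2 : 1024 ≤ b := by nlinarith
  have hbM : b ≤ M := hM ▸ Nat.le_self_pow (by nlinarith) b
  have hdM : 8 * d * N ≤ M := hM ▸ (Nat.lt_pow_self (by omega)).le
  refine ⟨?_, by nlinarith, by nlinarith, ?_, hdM, hJ⟩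
  · calc 10000 ≤ b ^ 2 := by nlinarith
      _ ≤ M := hM ▸ Nat.pow_le_pow_right (by omega) (by nlinarith)
  · calc d ^ N ≤ (2 ^ d) ^ N := Nat.pow_le_pow_left Nat.lt_two_pow_self.le N
      _ = 2 ^ (d * N) := by rw [pow_mul]
      _ ≤ b ^ (d * N) := Nat.pow_le_pow_left (by omega) _
      _ ≤ M := hM ▸ Nat.pow_le_pow_right (by omega) (by nlinarith)

lemma Small.steps_le (hs : Small N d h M J) : J ≤ 32 * M ^ 5 := by
  rw [hs.steps]
  have h1 := hs.total
  have h2 := hs.height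
  calc 32 * d ^ N * h * h * M * M ≤ 32 * M * M * M * M * M := by gcongr
    _ = _ := by ring

/-- At most 32M⁵ rounds of at most 72M² steps each; 32 · 72 and the remaining lower-order terms fit
below 10000 ≤ M. -/
lemma Small.cost_le (hs : Small N d h M J) : perceptronCost N d M J + 1 ≤ M ^ 8 := by
  have h0 := hs.large
  have h1 : bodyCost N d M + 2 ≤ 72 * M ^ 2 := by
    unfold bodyCost
    have e1 : 2 * d ^ N * (7 * N + 11) ≤ 2 * M * (7 * M + 11) :=
      Nat.mul_le_mul (Nat.mul_le_mul_left _ hs.total) (by linarith [hs.parties])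
    have e2 : d ^ N * d ^ N ≤ M * M := Nat.mul_le_mul hs.total hs.total
    nlinarith
  have h2 : J * (bodyCost N d M + 2) ≤ 32 * M ^ 5 * (72 * M ^ 2) := Nat.mul_le_mul hs.steps_le h1
  have h3 : d ^ N * d ^ N ≤ M * M := Nat.mul_le_mul hs.total hs.total
  have h4 : 24 * d * N ≤ 3 * M := by have := hs.index; nlinarith
  have h5 := hs.parties
  have h6 : 6 * M + 3 * M ^ 2 + 17 ≤ 7 * M ^ 2 := by nlinarith
  have h7 : M ^ 2 ≤ M ^ 7 := Nat.pow_le_pow_right (by omega) (by norm_num)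
  have h8 : 10000 * M ^ 7 ≤ M ^ 8 := by
    calc _ ≤ M * M ^ 7 := Nat.mul_le_mul_right _ h0
      _ = _ := by ring
  unfold perceptronCost
  nlinarith

/-- With X = 2^(M²) all parameters are below X, and so is the bound (2M)^N for tensor coordinates;
every required quantity is then X to a fixed power times at most Y². The logarithm of the final
bound is polynomial in M and in the input length. -/
lemma Small.bounds (hs : Small N d h M J) {Y : ℕ} (hY : 1 ≤ Y) (hq : q ≤ Y) :
    Bounds N d h q M J ((2 ^ M ^ 2 : ℕ) ^ 8 * Y : ℤ) ((2 ^ M ^ 2 : ℕ) ^ 40 * (Y : ℤ) ^ 2) := by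
  have h0 := hs.large
  have hMX : M ^ 2 ≤ 2 ^ M ^ 2 := Nat.lt_two_pow_self.le
  have hBX : (2 * M) ^ N ≤ 2 ^ M ^ 2 := by
    calc (2 * M) ^ N ≤ (2 ^ M) ^ N := by
          refine Nat.pow_le_pow_left ?_ N
          obtain ⟨k, rfl⟩ : ∃ k, M = k + 1 := ⟨M - 1, by omega⟩
          rw [pow_succ, mul_comm]
          exact Nat.mul_le_mul_right _ Nat.lt_two_pow_self
      _ = 2 ^ (M * N) := by rw [pow_mul]
      _ ≤ _ := Nat.pow_le_pow_right (by norm_num) (by nlinarith [hs.parties])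
  generalize hX : 2 ^ M ^ 2 = X at *
  have hMX1 : 10000 * M ≤ X := le_trans (by nlinarith) hMX
  have hX1 : 10000 ≤ X := by omega
  have hD : d ^ N ≤ X := hs.total.trans (by omega)
  have hJ : J + 1 ≤ X ^ 6 := by
    calc J + 1 ≤ 32 * M ^ 5 + 1 := by linarith [hs.steps_le]
      _ ≤ 10000 * M * M ^ 5 := by
          have : 1 ≤ M ^ 5 := Nat.one_le_pow _ _ (by omega)
          nlinarith
      _ ≤ X * X ^ 5 := by gcongr; omega
      _ = X ^ 6 := by ring
  have hp : ∀ {a b : ℕ}, a ≤ b → X ^ a * Y ≤ X ^ b * Y ^ 2 := fun hab =>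
    Nat.mul_le_mul (Nat.pow_le_pow_right (by omega) hab) (Nat.le_self_pow two_ne_zero Y)
  have hp1 : ∀ {b : ℕ}, 1 ≤ b → X ≤ X ^ b * Y ^ 2 := fun hb => by
    have := hp hb
    rw [pow_one] at this
    exact (Nat.le_mul_of_pos_right _ hY).trans this
  have hDD : d ^ N * d ^ N ≤ X ^ 2 := by rw [sq]; exact Nat.mul_le_mul hD hD
  have hsq : d ^ N * d ^ N * (2 * (J * (X ^ 8 * Y)) ^ 2) ≤ X ^ 40 * Y ^ 2 := by
    calc _ ≤ X ^ 2 * (X * (X ^ 6 * (X ^ 8 * Y)) ^ 2) := by gcongr <;> omega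
      _ = X ^ 31 * Y ^ 2 := by ring
      _ ≤ _ := by gcongr <;> omega
  constructor
  · have : (h + 2) * (d ^ N * (2 * ((2 * M) ^ N) ^ 2)) * q * (2 * ((2 * M) ^ N) ^ 2) + h * M * q ≤
        X ^ 8 * Y := by
      have hh := hs.height
      calc _ ≤ X * (X * (2 * X ^ 2)) * Y * (2 * X ^ 2) + X * X * Y := by
            gcongr <;> omega
        _ = (4 * X ^ 6 + X ^ 2) * Y := by ring
        _ ≤ X ^ 8 * Y := by
            gcongr
            have e1 : X ^ 2 ≤ X ^ 6 := Nat.pow_le_pow_right (by omega) (by norm_num)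
            have e2 : 5 ≤ X ^ 2 := by nlinarith
            calc _ ≤ 5 * X ^ 6 := by omega
              _ ≤ X ^ 2 * X ^ 6 := Nat.mul_le_mul_right _ e2
              _ = _ := by ring
    exact_mod_cast this
  · have : M + 3 ≤ X ^ 40 * Y ^ 2 := le_trans (by omega) (hp1 (by norm_num))
    exact_mod_cast this
  · have : 2 * d * N ≤ X ^ 40 * Y ^ 2 := by
      refine le_trans ?_ (hp1 (by norm_num))
      have := hs.index
      nlinarith
    exact_mod_cast this
  · have : 2 * d ^ N * (2 * ((2 * M) ^ N) ^ 2) ≤ X ^ 40 * Y ^ 2 := by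
      calc _ ≤ X * X * (X * X ^ 2) := by gcongr <;> omega
        _ = X ^ 5 * 1 := by ring
        _ ≤ X ^ 5 * Y := Nat.mul_le_mul_left _ hY
        _ ≤ _ := hp (by norm_num)
    exact_mod_cast this
  · have : d ^ N * d ^ N ≤ X ^ 40 * Y ^ 2 := by
      calc _ ≤ X ^ 2 * 1 := by omega
        _ ≤ X ^ 2 * Y := Nat.mul_le_mul_left _ hY
        _ ≤ _ := hp (by norm_num)
    exact_mod_cast this
  · have : d ^ N * d ^ N * (2 * (J * (X ^ 8 * Y)) * (X ^ 8 * Y)) ≤ X ^ 40 * Y ^ 2 := by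
      calc _ ≤ X ^ 2 * (X * (X ^ 6 * (X ^ 8 * Y)) * (X ^ 8 * Y)) := by gcongr <;> omega
        _ = X ^ 25 * Y ^ 2 := by ring
        _ ≤ _ := by gcongr <;> omega
    exact_mod_cast this
  · have : (J + 1) * (X ^ 8 * Y) ≤ X ^ 40 * Y ^ 2 := by
      calc _ ≤ X ^ 6 * (X ^ 8 * Y) := by gcongr
        _ = X ^ 14 * Y := by ring
        _ ≤ _ := hp (by norm_num)
    exact_mod_cast this
  · have : (J + 1) * M ≤ X ^ 40 * Y ^ 2 := by
      calc _ ≤ X ^ 6 * X := by gcongr; omega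
        _ = X ^ 7 * 1 := by ring
        _ ≤ X ^ 7 * Y := Nat.mul_le_mul_left _ hY
        _ ≤ _ := hp (by norm_num)
    exact_mod_cast this
  · exact_mod_cast hsq

lemma le_two_pow_bits (n : ℕ) : n ≤ 2 ^ bits n := by
  have h1 : n < 2 ^ n.size := Nat.lt_size_self n
  exact h1.le.trans (Nat.pow_le_pow_right (by norm_num) (Nat.le_succ _))

end Cost

/-! ### Accuracy and running time in terms of N/ε -/

section Time

variable {N d p r q : ℕ} {ε : ℝ}

/-- The accuracy of the perceptron algorithm. -/
lemma three_div_le (hp : 0 < p) (hr : 0 < r) (hε : ε = (p : ℝ) / r) :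
    3 / ((4 * (r / p + 1) : ℕ) : ℝ) ≤ ε := by
  have hp' : (0 : ℝ) < p := by exact_mod_cast hp
  have hr' : (0 : ℝ) < r := by exact_mod_cast hr
  have h1 : r < p * (r / p + 1) := Nat.lt_mul_div_succ r hp
  have h2 : (r : ℝ) ≤ p * ((r / p : ℕ) + 1) := by exact_mod_cast h1.le
  rw [hε, div_le_div_iff₀ (by positivity) hr']
  push_cast
  nlinarith

lemma height_le (hp : 0 < p) (hr : 0 < r) (hε : ε = (p : ℝ) / r) (hε1 : ε ≤ 1) :
    ((4 * (r / p + 1) : ℕ) : ℝ) ≤ 8 / ε := by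
  have hp' : (0 : ℝ) < p := by exact_mod_cast hp
  have hr' : (0 : ℝ) < r := by exact_mod_cast hr
  have hε0 : 0 < ε := hε ▸ div_pos hp' hr'
  have h1 : ((r / p : ℕ) : ℝ) ≤ 1 / ε := by
    rw [hε, one_div_div]
    exact Nat.cast_div_le
  have h2 : 1 ≤ 1 / ε := (one_le_div hε0).2 hε1
  have h3 : 8 / ε = 8 * (1 / ε) := by ring
  push_cast
  linarith

/-- The period of the perceptron is at most exponential. -/
lemma period_le {h M : ℕ} (hN : 2 ≤ N) (hε0 : 0 < ε) (hε1 : ε ≤ 1) (hh : (h : ℝ) ≤ 8 / ε)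
    (hM : M = (16 * (8 * N * h)) ^ (8 * d * N)) :
    (M : ℝ) ≤ Real.exp (88 * (d * N * Real.log (N / ε))) := by
  have hN' : (2 : ℝ) ≤ N := by exact_mod_cast hN
  have hx : 2 ≤ (N : ℝ) / ε := by
    rw [le_div_iff₀ hε0]
    nlinarith
  have h1 : ((16 * (8 * N * h) : ℕ) : ℝ) ≤ Real.exp (11 * Real.log (N / ε)) := by
    have e : Real.exp (11 * Real.log (N / ε)) = ((N : ℝ) / ε) ^ 11 := by
      rw [show (11 : ℝ) * Real.log (N / ε) = ((11 : ℕ) : ℝ) * Real.log (N / ε) by norm_num,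
        Real.exp_nat_mul, Real.exp_log (by positivity)]
    rw [e]
    push_cast
    calc (16 : ℝ) * (8 * N * h) ≤ 16 * (8 * N * (8 / ε)) := by gcongr
      _ = 2 ^ 10 * (N / ε) := by ring
      -- Constants are absorbed through 2 ≤ N/ε, which holds since there are at least two parties.
      _ ≤ (N / ε) ^ 10 * (N / ε) := by gcongr
      _ = _ := by ring
  calc (M : ℝ) = ((16 * (8 * N * h) : ℕ) : ℝ) ^ (8 * d * N) := by rw [hM]; push_cast; ring
    _ ≤ Real.exp (11 * Real.log (N / ε)) ^ (8 * d * N) := by gcongr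
    _ = _ := by
      rw [← Real.exp_nat_mul]
      push_cast
      congr 1
      ring

/-- The bit cost of polynomially many steps. -/
lemma cost_le_add {M n L w l t : ℕ} (hM : 10000 ≤ M) (hn : n ≤ M ^ 8) (hl : 1 ≤ l)
    (hL : L = 40 * M ^ 2 + 2 * l) (ht : t ≤ n * (9 * L ^ 2 * w ^ 2)) :
    t ≤ l ^ 4 + M ^ (28 + 4 * w) := by
  have hM2 : 1 ≤ M ^ 2 := Nat.one_le_pow _ _ (by omega)
  have h1 : L ≤ 42 * M ^ 2 * l := by rw [hL]; nlinarith
  have hw : w ≤ M ^ w := (Nat.lt_pow_self (by omega)).le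
  have h2 : t ≤ M ^ (14 + 2 * w) * l ^ 2 := by
    calc t ≤ M ^ 8 * (9 * (42 * M ^ 2 * l) ^ 2 * (M ^ w) ^ 2) := by
          refine ht.trans ?_
          gcongr
      _ = 15876 * M ^ 12 * (M ^ w) ^ 2 * l ^ 2 := by ring
      _ ≤ M ^ 2 * M ^ 12 * (M ^ w) ^ 2 * l ^ 2 := by gcongr; nlinarith
      _ = _ := by rw [← pow_mul, ← pow_add, ← pow_add]; congr 2; ring
  -- The product of a power of M and a power of l is bounded by the sum of their squares; this
  -- separates the input length from the exponential.
  have h3 : M ^ (28 + 4 * w) = (M ^ (14 + 2 * w)) ^ 2 := by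
    rw [← pow_mul]; congr 1; ring
  rw [h3]
  generalize M ^ (14 + 2 * w) = A at *
  have h4 : l ^ 4 = (l ^ 2) ^ 2 := by ring
  rw [h4]
  generalize l ^ 2 = b at *
  zify at *
  nlinarith [sq_nonneg ((A : ℤ) - b), sq_nonneg (A : ℤ), sq_nonneg (b : ℤ)]

end Time

/-! ### Correctness and running time of the algorithm -/

section Algorithm

open SymExt.Expr (lit)

variable {N d p r q : ℕ} {R J : Matrix (Fin N → Fin d) (Fin N → Fin d) ℤ} {s : Mem} {ε : ℝ}

/-- The algorithm stops at once if there is only one party. -/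
lemma exec_separabilityProgram_one (h0 : s 0 = 1) :
    ∃ t s', Exec separabilityProgram s t s' ∧ t ≤ 16 ∧ s' 0 = 1 := by
  have hn : ¬ 0 < (getInp 0 - lit 1).eval s := by
    simp [inp, h0]
  refine ⟨_, _, .cond_neg hn (.store _ _ _), ?_, ?_⟩
  · have b0 : bits 0 = 1 := by decide
    have b1 : bits 1 = 2 := by decide
    have e : (getInp 0 - lit 1).cost s = 10 := by
      change (bits 0 + bits 0 + bits (s 0)) + bits 1 + bits (s 0) + bits 1 = 10
      rw [h0, b0, b1]
    rw [e]
    change 10 + (bits 0 + bits 1 + bits 0 + bits 1) ≤ 16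
    rw [b0, b1]
  · simp [inp]

lemma exec_separabilityProgram (hN : 2 ≤ N) (hd : 0 < d) (hp : 0 < p) (hr : 0 < r) (hq : 0 < q)
    (hε : ε = (p : ℝ) / r) (hε1 : ε ≤ 1) (hρ : IsState (rationalMatrix q R J))
    (hs : IsInput N d p r q R J s) :
    ∃ (t : ℕ) (s' : Mem), Exec separabilityProgram s t s' ∧
      (t : ℝ) ≤ ((bits p + bits r + bits q : ℕ) : ℝ) ^ 4 +
        Real.exp (((88 * (28 + 4 * separabilityProgram.width) : ℕ) : ℝ) *
          (d * N * Real.log (N / ε))) ∧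
      (rationalMatrix q R J ∈ separable (fun _ : Fin N => d) → s' 0 = 1) ∧
      ((∀ σ ∈ separable (fun _ : Fin N => d), ε ≤ traceNorm (rationalMatrix q R J - σ)) →
        s' 0 = 0) := by
  obtain ⟨h, hh⟩ : ∃ h, h = 4 * (r / p + 1) := ⟨_, rfl⟩
  obtain ⟨M, hM⟩ : ∃ M, M = (16 * (8 * N * h)) ^ (8 * d * N) := ⟨_, rfl⟩
  obtain ⟨T, hT⟩ : ∃ T, T = 32 * d ^ N * h * h * M * M := ⟨_, rfl⟩
  obtain ⟨l, hl⟩ : ∃ l, l = bits p + bits r + bits q := ⟨_, rfl⟩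
  have hh4 : 4 ≤ h := by rw [hh]; exact Nat.le_mul_of_pos_right 4 (Nat.succ_pos _)
  have hsm := small_of_eq hN hd hh4 hM hT
  have hM0 := hsm.large
  have hY : ∀ n : ℕ, bits n ≤ l → n ≤ 2 ^ l := fun n hn =>
    (le_two_pow_bits n).trans (Nat.pow_le_pow_right (by norm_num) hn)
  have hpY := hY p (by omega)
  have hrY := hY r (by omega)
  have hqY := hY q (by omega)
  have hY1 : 1 ≤ 2 ^ l := Nat.one_le_two_pow
  have hb := hsm.bounds hY1 hqY
  set V : ℤ := ((2 ^ M ^ 2 : ℕ) : ℤ) ^ 40 * ((2 ^ l : ℕ) : ℤ) ^ 2 with hV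
  have hVL : V ≤ 2 ^ (40 * M ^ 2 + 2 * l) := by
    rw [hV]
    push_cast
    rw [← pow_mul, ← pow_mul, ← pow_add]
    exact le_of_eq (by ring)
  have hYV : ((2 ^ l : ℕ) : ℤ) ≤ V := by
    have h1 : 2 ^ l ≤ (2 ^ M ^ 2) ^ 40 * (2 ^ l) ^ 2 :=
      (Nat.le_self_pow two_ne_zero _).trans (Nat.le_mul_of_pos_left _ (by positivity))
    rw [hV]
    exact_mod_cast h1
  have hYV' : ∀ n : ℕ, n ≤ 2 ^ l → (n : ℤ) ≤ V := fun n hn =>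
    le_trans (by exact_mod_cast hn) hYV
  have hNd : N ≤ 2 * d * N ∧ d ≤ 2 * d * N := by constructor <;> nlinarith
  have hcell := abs_input_le hs hd hq hρ (le_trans (by exact_mod_cast hNd.1) hb.index)
    (le_trans (by exact_mod_cast hNd.2) hb.index) (hYV' p hpY) (hYV' r hrY) (hYV' q hqY)
  have hreach : Reaches V separabilityProgram (1 + perceptronCost N d M T) s fun s' =>
      (rationalMatrix q R J ∈ separable (fun _ : Fin N => d) → s' (inp 0) = 1) ∧
      ((∀ σ ∈ separable (fun _ : Fin N => d),
        3 / (h : ℝ) ≤ traceNorm (rationalMatrix q R J - σ)) → s' (inp 0) = 0) := by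
    have h0 : s (inp 0) = N := hs.parties
    refine reaches_cond (fun _ => ?_) (fun hn => absurd ?_ hn)
    · exact reaches_perceptronProgram (E := inputEntry s) h0 hs.dim hs.errorNum hs.errorDen
        hs.entryDen (by omega) hd hh hM hT hq (fun _ => rfl) (fun _ => rfl) hb
        (toMat_inputEntry hs hq) hρ (fun m hm => abs_inputEntry_le hs hd hq hρ hm) hs.below
    · simp only [eval_hSub, eval_getInp, eval_lit, h0]
      omega
  obtain ⟨n, hn, s', hst, hfin⟩ := hreach
  -- Here L = 40M² + 2l is the bit length of V, and the input cells are bounded by V as well.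
  obtain ⟨-, t, hex, ht⟩ := hst.exists_exec (by positivity) hVL hcell le_rfl
  have hlp : 1 ≤ l := by have := bits_pos p; omega
  have hcost := hsm.cost_le
  have ht' := cost_le_add hM0 (hn.trans (by omega)) hlp rfl ht
  have hp' : (0 : ℝ) < p := by exact_mod_cast hp
  have hr' : (0 : ℝ) < r := by exact_mod_cast hr
  have hε0 : 0 < ε := hε ▸ div_pos hp' hr'
  refine ⟨t, s', hex, ?_, hfin.1, fun hfar => hfin.2 fun σ hσ => ?_⟩
  · have h1 := period_le (d := d) hN hε0 hε1 (hh ▸ height_le hp hr hε hε1) hM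
    calc (t : ℝ) ≤ (l : ℝ) ^ 4 + (M : ℝ) ^ (28 + 4 * separabilityProgram.width) := by
          exact_mod_cast ht'
      _ ≤ (l : ℝ) ^ 4 + Real.exp (88 * (d * N * Real.log (N / ε))) ^
          (28 + 4 * separabilityProgram.width) := by gcongr
      _ = _ := by
          rw [← Real.exp_nat_mul, hl]
          congr 2
          push_cast
          ring
  · exact le_trans (hh ▸ three_div_le hp hr hε) (hfar σ hσ)

end Algorithm

end SymExt

theorem mainTheorem4 :
    (∀ (N : ℕ) (d k : Fin N → ℕ) (ρ : Matrix (∀ i, Fin (d i)) (∀ i, Fin (d i)) ℂ),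
      ρ ∈ SymExt.extendible d k →
        ∃ σ ∈ SymExt.separable d,
          SymExt.traceNorm (ρ - σ) ≤
            4 * ∑ i : Fin N with i.val + 1 < N, (d i : ℝ) / (k i : ℝ)) ∧
    (∃ (prog : SymExt.Program) (C : ℕ),
      ∀ (N d p r q : ℕ) (R J : Matrix (Fin N → Fin d) (Fin N → Fin d) ℤ) (ε : ℝ)
        (ρ : Matrix (Fin N → Fin d) (Fin N → Fin d) ℂ) (s : SymExt.Mem),
        1 ≤ N → 0 < q → 0 < r → ε = (p : ℝ) / (r : ℝ) → 0 < ε → ε ≤ 1 →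
        ρ = SymExt.rationalMatrix q R J → SymExt.IsState ρ →
        SymExt.IsInput N d p r q R J s →
        ∃ (t : ℕ) (s' : SymExt.Mem), SymExt.Exec prog s t s' ∧
          (t : ℝ) ≤ ((SymExt.bits p + SymExt.bits r + SymExt.bits q : ℕ) : ℝ) ^ C +
            Real.exp ((C : ℝ) * ((d : ℝ) * (N : ℝ) * Real.log ((N : ℝ) / ε))) ∧
          (ρ ∈ SymExt.separable (fun _ : Fin N => d) → s' 0 = 1) ∧
          ((∀ σ ∈ SymExt.separable (fun _ : Fin N => d), ε ≤ SymExt.traceNorm (ρ - σ)) →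
            s' 0 = 0)) := by
  refine ⟨fun N d k ρ hρ => ?_, SymExt.separabilityProgram,
    88 * (28 + 4 * SymExt.separabilityProgram.width), ?_⟩
  · obtain ⟨σ, hσ, h⟩ := SymExt.exists_separable_near hρ
    refine ⟨σ, hσ, h.trans ?_⟩
    -- The bound obtained has the constant 2, so nonnegativity of the sum suffices.
    have : 0 ≤ ∑ i : Fin N with i.val + 1 < N, (d i : ℝ) / (k i : ℝ) :=
      Finset.sum_nonneg fun i _ => by positivity
    linarith
  intro N d p r q R J ε ρ s hN hq hr hε hε0 hε1 hρq hρ hs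
  subst hρq
  have hp : 0 < p := by
    rcases Nat.eq_zero_or_pos p with rfl | h
    · simp [hε] at hε0
    · exact h
  -- Positive integers have at least two bits, sign included. So ℓ⁴ covers the constant running time
  -- for one party, and ℓ⁴ ≤ ℓ^C.
  have hl : (6 : ℝ) ≤ ((SymExt.bits p + SymExt.bits r + SymExt.bits q : ℕ) : ℝ) := by
    have h : ∀ n : ℕ, 0 < n → 2 ≤ SymExt.bits n := fun n hn =>
      Nat.succ_le_succ (Nat.size_pos.2 hn)
    have h1 := h p hp
    have h2 := h r hr
    have h3 := h q hq
    exact_mod_cast (by omega : 6 ≤ SymExt.bits p + SymExt.bits r + SymExt.bits q)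
  have hpow : ((SymExt.bits p + SymExt.bits r + SymExt.bits q : ℕ) : ℝ) ^ 4 ≤
      ((SymExt.bits p + SymExt.bits r + SymExt.bits q : ℕ) : ℝ) ^
        (88 * (28 + 4 * SymExt.separabilityProgram.width)) :=
    pow_le_pow_right₀ (by linarith) (by omega)
  rcases hN.eq_or_lt with rfl | hN2
  · obtain ⟨t, s', hex, ht, hout⟩ :=
      SymExt.exec_separabilityProgram_one (s := s) (by simpa using hs.parties)
    have hsep := SymExt.mem_separable_of_one_party hρ
    refine ⟨t, s', hex, ?_, fun _ => hout, fun hfar => ?_⟩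
    · have h1 : (t : ℝ) ≤ 16 := by exact_mod_cast ht
      have h2 : (6 : ℝ) ^ 4 ≤
          ((SymExt.bits p + SymExt.bits r + SymExt.bits q : ℕ) : ℝ) ^ 4 := by gcongr
      refine le_trans ?_ (le_add_of_nonneg_right (Real.exp_pos _).le)
      linarith
    -- A one-party state is separable, hence at distance 0 from itself; the second promise is void
    -- as ε > 0.
    · have h1 := hfar _ hsep
      have h0 : (0 : Matrix (Fin 1 → Fin d) (Fin 1 → Fin d) ℂ).PosSemidef := .zero
      have h2 := SymExt.traceNorm_sub_le h0 h0
      rw [sub_zero, Matrix.trace_zero, Complex.zero_re, add_zero] at h2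
      rw [sub_self] at h1
      linarith
  -- For d = 0 the index set is empty and the trace would be 0.
  · have hd : 0 < d := by
      rcases Nat.eq_zero_or_pos d with rfl | h
      · have : IsEmpty (Fin N → Fin 0) := ⟨fun f => (f ⟨0, by omega⟩).elim0⟩
        have h1 := hρ.2
        rw [Matrix.trace, Finset.univ_eq_empty, Finset.sum_empty] at h1
        exact absurd h1 zero_ne_one
      · exact h
    obtain ⟨t, s', hex, ht, hout⟩ :=
      SymExt.exec_separabilityProgram hN2 hd hp hr hq hε hε1 hρ hs
    exact ⟨t, s', hex, ht.trans (by gcongr), hout⟩
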